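/- **Setting.** Let $\mathbb C = A_0\subseteq A_1\subseteq A_2\subseteq\cdots$ be an inductive sequence of atomic $W^*$-algebras with separable preduals (each $A_n$ is $*$-isomorphic to an $\ell^\infty$-direct sum of countably many $B(\mathcal H)$ with $\mathcal H\neq 0$ separable), with unital normal inclusions, and let $A=\varinjlim A_n$ be its $C^*$-inductive limit. Let $\alpha^t:\mathbb R\curvearrowright A$ be a flow with $\alpha^t(A_n)=A_n$ for all $t,n$ whose restriction to each $A_n$ is continuous in the $u$-topology (i.e. $t\mapsto\varphi\circ\alpha^t|_{A_n}$ is norm continuous for every normal functional $\varphi$ on $A_n$). Let $\mathfrak Z_n$ be the set of minimal projections of the center $\mathcal Z(A_n)$ and $\mathfrak Z=\bigsqcup_{n}\mathfrak Z_n$. Identify $\mathcal Z(A_n)=\ell^\infty(\mathfrak Z_n)$ via $zf=f(z)z$, and $\mathcal Z(A_n)_*=\ell^1(\mathfrak Z_n)$ via $\langle\omega,f\rangle_n=\sum_{z\in\mathfrak Z_n}\omega(z)f(z)$. Let $\beta\in\mathbb R$ be such that every block $zA_n$ ($z\in\mathfrak Z_n$) has a (necessarily unique) normal $(\alpha^t,\beta)$-KMS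 state $\tau_z$. Put $$E_n(a)=\sum_{z\in\mathfrak Z_n}\tau_z(za)\,z\quad(a\in A_n),\qquad \Theta_{n+1,n}=E_{n+1}|_{\mathcal Z(A_n)},\qquad \Theta_{m,n}=\Theta_{m,m-1}\circ\cdots\circ\Theta_{n+1,n},\qquad \kappa(z',z)=\tau_{z'}(z'z)$$ for $z'\in\mathfrak Z_{n+1}$, $z\in\mathfrak Z_n$. * $K^{\rm ln}_\beta(\alpha^t)$ is the set of $(\alpha^t,\beta)$-KMS states $\omega$ on $A$ with $\omega|_{A_n}$ normal for all $n$, with the weak$^*$ topology. * $H_1^+(\kappa)$ is the set of functions $\nu:\mathfrak Z\to[0,\infty)$ with $\nu(1)=1$ (where $\mathfrak Z_0=\{1\}$) and $\nu(z)=\sum_{z'\in\mathfrak Z_{n+1}}\nu(z')\kappa(z',z)$ for all $n$ and $z\in\mathfrak Z_n$, with the topology of pointwise convergence. * $\mathcal S(\alpha^t,\beta)$ is the operator system inductive limit of $(\mathcal Z(A_n),\Theta_{n+1,n})$: the Archimedeanization of the inductive limit of matrix ordered spaces. As a vector space it is the algebraic inductive limit modulo the classes of those $f\in\mathcal Z(A_n)$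 with $\lim_m\|\Theta_{m,n}(f)\|=0$. Let $\Theta_{\infty,n}:\mathcal Z(A_n)\to\mathcal S(\alpha^t,\beta)$ be the canonical maps. $S^{\rm ln}(\mathcal S(\alpha^t,\beta))$ is the set of states $\omega$ on it that are locally normal, i.e. $\omega\circ\Theta_{\infty,n}\in\mathcal Z(A_n)_*$ for all large $n$, with the weak$^*$ topology. * $\mathcal L(\alpha^t,\beta)$ is the space of sequences $(\omega_n)$ with $\omega_n\in\mathcal Z(A_n)_*$, $\sup_n\|\omega_n\|<\infty$ and $\langle\omega_{n+1},\Theta_{n+1,n}(f)\rangle_{n+1}=\langle\omega_n,f\rangle_n$ for all $n$ and $f\in\mathcal Z(A_n)$. The map $\iota:\mathcal L(\alpha^t,\beta)\to\mathcal S(\alpha^t,\beta)^*$ is determined by $\iota(\omega)(\Theta_{\infty,n}(f))=\langle\omega_n,f\rangle_n$. **Theorem 3.11.** The sets $K^{\rm ln}_\beta(\alpha^t)$, $H_1^+(\kappa)$ and $S^{\rm ln}(\mathcal S(\alpha^t,\beta))$ are convex, and: 1. The map $H_1^+(\kappa)\ni\nu\mapsto\nu_\bullet:=(\nu|_{\mathfrak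 Z_n})_{n}\in\mathcal L(\alpha^t,\beta)$ is well defined, injective and affine. 2. $S^{\rm ln}(\mathcal S(\alpha^t,\beta))=\{\iota(\nu_\bullet):\nu\in H_1^+(\kappa)\}$. 3. For each $\omega\in S^{\rm ln}(\mathcal S(\alpha^t,\beta))$ there is a unique $E_\bullet^*(\omega)\in K^{\rm ln}_\beta(\alpha^t)$ with $E_\bullet^*(\omega)|_{A_n}=\omega\circ\Theta_{\infty,n}\circ E_n$ for all $n$. For $\omega\in K^{\rm ln}_\beta(\alpha^t)$ let $\nu[\omega](z)=\omega(z)$, $z\in\mathfrak Z$. Then $$K^{\rm ln}_\beta(\alpha^t)\xrightarrow{\ \omega\mapsto\nu[\omega]\ }H_1^+(\kappa)\xrightarrow{\ \nu\mapsto\iota(\nu_\bullet)\ }S^{\rm ln}(\mathcal S(\alpha^t,\beta))\xrightarrow{\ \omega\mapsto E_\bullet^*(\omega)\ }K^{\rm ln}_\beta(\alpha^t)$$ are well-defined affine homeomorphisms, and the composition of the three maps around the triangle, starting at any of the three sets, is the identity. -/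

import Mathlib

open scoped ComplexOrder

noncomputable section

/-! ### Atomic `W*`-algebras, central projections, normality, the KMS condition -/

/-- An atomic `W*`-algebra with separable predual: up to `*`-isomorphism, an `ℓ^∞`-direct sum of
countably many algebras `B(H i)` with `H i` nonzero separable Hilbert spaces.  (Every separable
Hilbert space has an isometric copy in `Type`.) -/
def IsAtomicWStar (M : Type*) [Ring M] [StarRing M] [Algebra ℂ M] : Prop :=
  ∃ (I : Type) (_ : Countable I) (H : I → Type) (_ : ∀ i, NormedAddCommGroup (H i))
    (_ : ∀ i, InnerProductSpace ℂ (H i)) (_ : ∀ i, CompleteSpace (H i))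
    (_ : ∀ i, Nontrivial (H i)) (_ : ∀ i, TopologicalSpace.SeparableSpace (H i)),
    Nonempty (M ≃⋆ₐ[ℂ] lp (fun i => H i →L[ℂ] H i) ⊤)

/-- Projections of the center. -/
def IsCentralProjection {M : Type*} [Ring M] [StarRing M] (p : M) : Prop :=
  IsStarProjection p ∧ p ∈ Set.center M

/-- Minimal projections of the center. -/
def IsMinimalCentralProjection {M : Type*} [Ring M] [StarRing M] (z : M) : Prop :=
  IsCentralProjection z ∧ z ≠ 0 ∧ ∀ p : M, IsCentralProjection p → p * z = p → p = 0 ∨ p = z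

/-- Normal states.  A positive linear functional on a `W*`-algebra is normal if it preserves
suprema of bounded increasing nets, i.e. if it is Scott continuous. -/
structure IsNormalState {M : Type*} [Ring M] [Algebra ℂ M] [PartialOrder M]
    (φ : M →ₗ[ℂ] ℂ) : Prop where
  nonneg : ∀ a, 0 ≤ a → 0 ≤ φ a
  unital : φ 1 = 1
  normal : ScottContinuous φ

/-- The `(σ, β)`-KMS condition for `φ`, tested on elements of `B`: for all `a b ∈ B` there is a
bounded continuous function on the closed strip between `Im z = 0` and `Im z = β`, analytic in
the open strip, with boundary values `φ (a * σ t b)` and `φ (σ t b * a)`. -/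
def IsKMSOn {M : Type*} [Mul M] (σ : ℝ → M → M) (β : ℝ) (B : Set M) (φ : M → ℂ) : Prop :=
  ∀ a ∈ B, ∀ b ∈ B, ∃ G : ℂ → ℂ,
    ContinuousOn G {w | w.im ∈ Set.uIcc 0 β} ∧
    DifferentiableOn ℂ G {w | w.im ∈ Set.uIoo 0 β} ∧
    (∃ C : ℝ, ∀ w : ℂ, w.im ∈ Set.uIcc 0 β → ‖G w‖ ≤ C) ∧
    ∀ t : ℝ, G t = φ (a * σ t b) ∧ G (t + β * Complex.I) = φ (σ t b * a)

/-- Affine maps between (convex) subsets of real vector spaces. -/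
def IsAffineBetween {V W : Type*} [AddCommGroup V] [Module ℝ V] [AddCommGroup W] [Module ℝ W]
    {X : Set V} {Y : Set W} (f : X → Y) : Prop :=
  ∀ (x y : X) (s t : ℝ), 0 ≤ s → 0 ≤ t → s + t = 1 →
    ∀ h : s • (x : V) + t • (y : V) ∈ X,
      (f ⟨s • (x : V) + t • (y : V), h⟩ : W) = s • (f x : W) + t • (f y : W)

/-- The topology of pointwise convergence (the weak* topology) on a set of linear functionals. -/
instance pointwiseTopology {V : Type*} [AddCommGroup V] [Module ℂ V] (X : Set (V →ₗ[ℂ] ℂ)) :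
    TopologicalSpace X :=
  TopologicalSpace.induced (fun (φ : X) (v : V) => (φ : V →ₗ[ℂ] ℂ) v) inferInstance

section Structure

variable {M : Type*} [Ring M] [StarRing M] [Algebra ℂ M]

theorem exists_eq_smul_one_of_commute {H : Type*} [NormedAddCommGroup H] [InnerProductSpace ℂ H]
    [CompleteSpace H] (T : H →L[ℂ] H) (hT : ∀ R : H →L[ℂ] H, R * T = T * R) :
    ∃ c : ℂ, T = c • (1 : H →L[ℂ] H) := by
  obtain ⟨c, hc⟩ := (Algebra.IsCentral.mem_center_iff ℂ (D := H →L[ℂ] H) (x := T)).1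
    (Subalgebra.mem_center_iff.2 hT)
  exact ⟨c, by rw [hc, Algebra.algebraMap_eq_smul_one]⟩

/-- The center of an atomic `W*`-algebra is `ℓ^∞` over the minimal central projections. -/
theorem IsAtomicWStar.center_structure (hM : IsAtomicWStar M) :
    (∀ z : M, IsMinimalCentralProjection z → ∀ c ∈ Set.center M, ∃ l : ℂ, z * c = l • z) ∧
    (∀ a : M, (∀ z : M, IsMinimalCentralProjection z → z * a = 0) → a = 0) ∧
    (∀ f : {z : M // IsMinimalCentralProjection z} → ℂ, (∃ C : ℝ, ∀ z, ‖f z‖ ≤ C) →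
      ∃ c ∈ Set.center M, ∀ z : {z : M // IsMinimalCentralProjection z},
        (z : M) * c = f z • (z : M)) := by
  classical
  obtain ⟨I, _, H, _, _, _, _, _, ⟨e⟩⟩ := hM
  have hcen : ∀ c : M, c ∈ Set.center M ↔ ∀ g : M, g * c = c * g := fun c =>
    Semigroup.mem_center_iff
  have hcomp : ∀ c ∈ Set.center M, ∀ i, ∃ l : ℂ, (e c : ∀ i, H i →L[ℂ] H i) i = l • 1 := by
    intro c hc i
    refine exists_eq_smul_one_of_commute _ fun R => ?_
    have h := (hcen c).1 hc (e.symm (lp.single ⊤ i R))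
    have h' := congrArg (fun x => (e x : ∀ i, H i →L[ℂ] H i) i) h
    simpa [map_mul, lp.infty_coeFn_mul] using h'
  let u : I → M := fun i => e.symm (lp.single ⊤ i 1)
  have heu : ∀ i j, (e (u i) : ∀ i, H i →L[ℂ] H i) j
      = (Pi.single i 1 : ∀ i, H i →L[ℂ] H i) j := by
    intro i j
    simp [u]
  have hext : ∀ a b : M, (∀ j, (e a : ∀ i, H i →L[ℂ] H i) j
      = (e b : ∀ i, H i →L[ℂ] H i) j) → a = b := by
    intro a b h
    exact e.injective (lp.ext (funext h))
  have hmul : ∀ a b : M, ∀ j, (e (a * b) : ∀ i, H i →L[ℂ] H i) j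
      = (e a : ∀ i, H i →L[ℂ] H i) j * (e b : ∀ i, H i →L[ℂ] H i) j := by
    intro a b j
    rw [map_mul, lp.infty_coeFn_mul]
    rfl
  have hsmul : ∀ (l : ℂ) (b : M), ∀ j, (e (l • b) : ∀ i, H i →L[ℂ] H i) j
      = l • (e b : ∀ i, H i →L[ℂ] H i) j := by
    intro a b j
    rw [map_smul, lp.coeFn_smul]
    rfl
  have huu : ∀ i, u i * u i = u i := by
    intro i
    refine hext _ _ fun j => ?_
    rw [hmul, heu]
    by_cases hij : j = i
    · subst hij; simp
    · simp [hij]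
  have hustar : ∀ i, star (u i) = u i := by
    intro i
    refine hext _ _ fun j => ?_
    rw [map_star, lp.coeFn_star, Pi.star_apply, heu]
    by_cases hij : j = i
    · subst hij; simp
    · simp [hij]
  have hucen : ∀ i, u i ∈ Set.center M := by
    intro i
    rw [hcen]
    intro g
    refine hext _ _ fun j => ?_
    rw [hmul, hmul, heu]
    by_cases hij : j = i
    · subst hij; simp
    · simp [hij]
  have hu0 : ∀ i, u i ≠ 0 := by
    intro i h
    have := heu i i
    rw [h] at this
    simp at this
  -- a central element is a multiple of `u i` on the `i`-th block
  have hblock : ∀ c ∈ Set.center M, ∀ i, ∃ l : ℂ, u i * c = l • u i := by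
    intro c hc i
    obtain ⟨l, hl⟩ := hcomp c hc i
    refine ⟨l, hext _ _ fun j => ?_⟩
    rw [hmul, hsmul, heu]
    by_cases hij : j = i
    · subst hij; simp [hl]
    · simp [hij]
  have hu : ∀ i, IsMinimalCentralProjection (u i) := by
    intro i
    refine ⟨⟨⟨huu i, hustar i⟩, hucen i⟩, hu0 i, ?_⟩
    intro p hp hpu
    obtain ⟨l, hl⟩ := hblock p hp.2 i
    have hpl : p = l • u i := by
      rw [← hl, (hcen p).1 hp.2 (u i), hpu]
    have h1 : (l * l) • u i = l • u i := by
      have h := hp.1.isIdempotentElem.eq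
      rw [hpl, smul_mul_smul_comm, huu] at h
      exact h
    have h2 : l * l = l := by
      have h3 : (l * l - l) • u i = 0 := by rw [sub_smul, h1, sub_self]
      have h4 := congrArg (fun x => (e x : ∀ i, H i →L[ℂ] H i) i) h3
      simp only [hsmul, heu, Pi.single_eq_same, map_zero] at h4
      have h5 : (l * l - l) = 0 := by
        have := smul_eq_zero.1 h4
        simpa using this
      exact sub_eq_zero.1 h5
    rcases eq_or_ne l 0 with h0 | h0
    · left; rw [hpl, h0, zero_smul]
    · right
      have : l = 1 := mul_left_cancel₀ h0 (by rw [h2, mul_one])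
      rw [hpl, this, one_smul]
  have hmin : ∀ z : M, IsMinimalCentralProjection z → ∃ i, z = u i := by
    intro z hz
    have : ∃ i, u i * z ≠ 0 := by
      by_contra! hall
      refine hz.2.1 (hext _ _ fun j => ?_)
      have h4 := congrArg (fun x => (e x : ∀ i, H i →L[ℂ] H i) j) (hall j)
      simpa [hmul, heu] using h4
    obtain ⟨i, hi⟩ := this
    have hcomm : u i * z = z * u i := (hcen z).1 hz.1.2 (u i)
    have hp : IsCentralProjection (u i * z) := by
      refine ⟨⟨?_, ?_⟩, Set.mul_mem_center (hucen i) hz.1.2⟩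
      · change u i * z * (u i * z) = u i * z
        calc u i * z * (u i * z) = u i * (z * u i) * z := by simp only [mul_assoc]
          _ = (u i * u i) * (z * z) := by rw [← hcomm]; simp only [mul_assoc]
          _ = u i * z := by rw [huu, hz.1.1.isIdempotentElem.eq]
      · change star (u i * z) = u i * z
        rw [star_mul, hustar, hz.1.1.isSelfAdjoint.star_eq, hcomm]
    have h1 : u i * z = u i := by
      rcases (hu i).2.2 _ hp (by rw [hcomm, mul_assoc, huu]) with h | h
      · exact absurd h hi
      · exact h
    have h2 : u i * z = z := by
      rcases hz.2.2 _ hp (by rw [mul_assoc, hz.1.1.isIdempotentElem.eq]) with h | h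
      · exact absurd h hi
      · exact h
    exact ⟨i, h2.symm.trans h1⟩
  refine ⟨?_, ?_, ?_⟩
  · intro z hz c hc
    obtain ⟨i, rfl⟩ := hmin z hz
    exact hblock c hc i
  · intro a ha
    refine hext _ _ fun j => ?_
    have h4 := congrArg (fun x => (e x : ∀ i, H i →L[ℂ] H i) j) (ha (u j) (hu j))
    simpa [hmul, heu] using h4
  · rintro f ⟨C, hC⟩
    let g : ∀ i, H i →L[ℂ] H i := fun i => f ⟨u i, hu i⟩ • 1
    have hg : Memℓp g ⊤ := by
      refine memℓp_infty ⟨C, ?_⟩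
      rintro _ ⟨i, rfl⟩
      simpa [g, norm_smul] using hC ⟨u i, hu i⟩
    let G : lp (fun i => H i →L[ℂ] H i) ⊤ := ⟨g, hg⟩
    have heG : ∀ j, (e (e.symm G) : ∀ i, H i →L[ℂ] H i) j = g j := by
      intro j
      rw [StarAlgEquiv.apply_symm_apply]
    refine ⟨e.symm G, ?_, ?_⟩
    · rw [hcen]
      intro x
      refine hext _ _ fun j => ?_
      rw [hmul, hmul, heG]
      simp [g]
    · rintro ⟨z, hz⟩
      obtain ⟨i, rfl⟩ := hmin z hz
      refine hext _ _ fun j => ?_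
      rw [hmul, hsmul, heG, heu]
      by_cases hij : j = i
      · subst hij; simp [g]
      · simp [hij]

end Structure

/-! ### Flows on inductive limits of atomic `W*`-algebras -/

/-- An inductive sequence `A 0 = ℂ ⊆ A 1 ⊆ ...` of atomic `W*`-algebras with separable preduals,
with unital normal inclusions, inside its `C*`-inductive limit `A`, together with a flow on `A`
which preserves every `A n` and is continuous on every `A n` in the `u`-topology. -/
structure LocallyAtomicFlow (A : Type*) [CStarAlgebra A] [PartialOrder A] [StarOrderedRing A] where
  /-- The algebras `A n`. -/
  alg : ℕ → StarSubalgebra ℂ A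
  alg_zero : alg 0 = ⊥
  alg_le : ∀ n, alg n ≤ alg (n + 1)
  atomic : ∀ n, IsAtomicWStar (alg n)
  normal_inclusion : ∀ n, ScottContinuous (StarSubalgebra.inclusion (alg_le n))
  dense_iUnion : Dense (⋃ n, (alg n : Set A))
  /-- The flow. -/
  flow : ℝ → A ≃⋆ₐ[ℂ] A
  flow_zero : ∀ a, flow 0 a = a
  flow_add : ∀ s t a, flow (s + t) a = flow s (flow t a)
  flow_image : ∀ t n, (flow t) '' (alg n : Set A) = (alg n : Set A)
  /-- Continuity in the `u`-topology: for normal states `φ` of `A n`, the functional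
  `φ ∘ flow t` depends continuously on `t` in norm. -/
  flow_continuous : ∀ (n : ℕ) (φ : alg n →ₗ[ℂ] ℂ), IsNormalState φ → ∀ s : ℝ, ∀ ε > 0,
    ∀ᶠ t in nhds s, ∀ (a : alg n) (x y : alg n), (x : A) = flow t a → (y : A) = flow s a →
      ‖φ x - φ y‖ ≤ ε * ‖(a : A)‖

namespace LocallyAtomicFlow

variable {A : Type*} [CStarAlgebra A] [PartialOrder A] [StarOrderedRing A]
variable (F : LocallyAtomicFlow A)

theorem flow_mem (n : ℕ) (t : ℝ) (a : F.alg n) : F.flow t a ∈ F.alg n := by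
  have h : F.flow t a ∈ (F.flow t) '' (F.alg n : Set A) := ⟨a, a.2, rfl⟩
  rwa [F.flow_image] at h

/-- The restriction of the flow to `A n`. -/
def flowOn (n : ℕ) (t : ℝ) (a : F.alg n) : F.alg n := ⟨F.flow t a, F.flow_mem n t a⟩

/-- The inclusion `A n ⊆ A (n + 1)`. -/
def incl (n : ℕ) : F.alg n →⋆ₐ[ℂ] F.alg (n + 1) := StarSubalgebra.inclusion (F.alg_le n)

/-- The minimal projections of the center of `A n`. -/
abbrev MinProj (n : ℕ) : Type _ := {z : F.alg n // IsMinimalCentralProjection z}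

/-- The center of `A n`. -/
abbrev Center (n : ℕ) : StarSubalgebra ℂ (F.alg n) :=
  StarSubalgebra.centralizer ℂ (Set.univ : Set (F.alg n))

/-- `τ` is a normal `(α, β)`-KMS state on the block `zA n`.  States on `zA n` are identified,
via `a ↦ τ (za)`, with the states `τ` on `A n` such that `τ z = 1`. -/
def IsBlockKMSState (β : ℝ) (n : ℕ) (z : F.MinProj n) (τ : F.alg n →ₗ[ℂ] ℂ) : Prop :=
  IsNormalState τ ∧ τ z.1 = 1 ∧ IsKMSOn (F.flowOn n) β {a | z.1 * a = a} τ

/-- The inverse temperature `β` is admissible if every block `zA n` has a normal KMS state. -/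
def Admissible (β : ℝ) : Prop :=
  ∀ (n : ℕ) (z : F.MinProj n), ∃ τ : F.alg n →ₗ[ℂ] ℂ, F.IsBlockKMSState β n z τ

/-- The locally normal `(α, β)`-KMS states on `A`. -/
def lnKMS (β : ℝ) : Set (WeakDual ℂ A) :=
  {ω | (∀ a, 0 ≤ a → 0 ≤ ω a) ∧ ω 1 = 1 ∧
    IsKMSOn (fun t a => F.flow t a) β Set.univ ω ∧
    ∀ n, ScottContinuous (fun a : F.alg n => ω (a : A))}

theorem mem_center_iff {n : ℕ} {c : F.alg n} : c ∈ F.Center n ↔ c ∈ Set.center (F.alg n) := by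
  rw [StarSubalgebra.mem_centralizer_iff, Semigroup.mem_center_iff]
  exact ⟨fun h g => (h g trivial).1, fun h g _ => ⟨h g, h (star g)⟩⟩

theorem exists_coeff {n : ℕ} (f : F.Center n) (z : F.MinProj n) :
    ∃ l : ℂ, z.1 * (f : F.alg n) = l • z.1 :=
  (F.atomic n).center_structure.1 z.1 z.2 _ (F.mem_center_iff.1 f.2)

/-- The identification of the center of `A n` with the bounded functions on its minimal
projections: `coeff f z` is the scalar `f(z)` with `zf = f(z)z`. -/
def coeff {n : ℕ} (f : F.Center n) (z : F.MinProj n) : ℂ := (F.exists_coeff f z).choose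

theorem mul_eq_coeff_smul {n : ℕ} (f : F.Center n) (z : F.MinProj n) :
    z.1 * (f : F.alg n) = F.coeff f z • z.1 := (F.exists_coeff f z).choose_spec

theorem coeff_eq_iff {n : ℕ} (f : F.Center n) (z : F.MinProj n) (l : ℂ) :
    F.coeff f z = l ↔ z.1 * (f : F.alg n) = l • z.1 := by
  rw [F.mul_eq_coeff_smul]
  refine ⟨fun h => by rw [h], fun h => ?_⟩
  have h0 : (F.coeff f z - l) • z.1 = 0 := by rw [sub_smul, h, sub_self]
  rcases smul_eq_zero.1 h0 with h1 | h1
  · exact sub_eq_zero.1 h1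
  · exact absurd h1 z.2.2.1

theorem center_ext {n : ℕ} {f g : F.Center n} (h : ∀ z, F.coeff f z = F.coeff g z) : f = g := by
  refine Subtype.ext (sub_eq_zero.1 ?_)
  refine (F.atomic n).center_structure.2.1 _ fun z hz => ?_
  rw [mul_sub, F.mul_eq_coeff_smul f ⟨z, hz⟩, F.mul_eq_coeff_smul g ⟨z, hz⟩, h, sub_self]

theorem coeff_add {n : ℕ} (f g : F.Center n) (z : F.MinProj n) :
    F.coeff (f + g) z = F.coeff f z + F.coeff g z := by
  rw [F.coeff_eq_iff, add_smul, ← F.mul_eq_coeff_smul, ← F.mul_eq_coeff_smul, ← mul_add]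
  rfl

theorem coeff_smul {n : ℕ} (l : ℂ) (f : F.Center n) (z : F.MinProj n) :
    F.coeff (l • f) z = l * F.coeff f z := by
  rw [F.coeff_eq_iff, mul_smul, ← F.mul_eq_coeff_smul, ← mul_smul_comm]
  rfl

theorem norm_coeff_le {n : ℕ} (f : F.Center n) (z : F.MinProj n) :
    ‖F.coeff f z‖ ≤ ‖((f : F.alg n) : A)‖ := by
  have h : ((z.1 : F.alg n) : A) * ((f : F.alg n) : A) = F.coeff f z • ((z.1 : F.alg n) : A) :=
    congrArg (fun x : F.alg n => (x : A)) (F.mul_eq_coeff_smul f z)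
  have hz : 0 < ‖((z.1 : F.alg n) : A)‖ :=
    norm_pos_iff.2 fun h0 => z.2.2.1 (Subtype.ext h0)
  have h1 := norm_mul_le ((z.1 : F.alg n) : A) ((f : F.alg n) : A)
  rw [h, norm_smul, mul_comm] at h1
  exact le_of_mul_le_mul_left h1 hz

theorem exists_center_of_bounded {n : ℕ} (f : F.MinProj n → ℂ) (hf : ∃ C : ℝ, ∀ z, ‖f z‖ ≤ C) :
    ∃ c : F.Center n, ∀ z, F.coeff c z = f z := by
  obtain ⟨c, hc, h⟩ := (F.atomic n).center_structure.2.2 f hf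
  exact ⟨⟨c, F.mem_center_iff.2 hc⟩, fun z => (F.coeff_eq_iff _ z _).2 (h z)⟩

theorem norm_apply_le {n : ℕ} {φ : F.alg n →ₗ[ℂ] ℂ} (hφ : IsNormalState φ) (a : F.alg n) :
    ‖φ a‖ ≤ 2 * ‖(a : A)‖ := by
  have hsa : ∀ b : F.alg n, IsSelfAdjoint (b : A) → ‖φ b‖ ≤ ‖(b : A)‖ := by
    intro b hb
    have e1 : ((((‖(b : A)‖ : ℝ) : ℂ) • (1 : F.alg n) : F.alg n) : A)
        = algebraMap ℝ A ‖(b : A)‖ := by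
      rw [Algebra.algebraMap_eq_smul_one]
      exact Complex.coe_smul _ _
    have h1 : 0 ≤ (((‖(b : A)‖ : ℝ) : ℂ) • (1 : F.alg n) - b : F.alg n) := by
      change (0 : A) ≤ ((((‖(b : A)‖ : ℝ) : ℂ) • (1 : F.alg n) : F.alg n) : A) - (b : A)
      rw [e1]
      exact sub_nonneg.2 hb.le_algebraMap_norm_self
    have h2 : 0 ≤ (((‖(b : A)‖ : ℝ) : ℂ) • (1 : F.alg n) + b : F.alg n) := by
      change (0 : A) ≤ ((((‖(b : A)‖ : ℝ) : ℂ) • (1 : F.alg n) : F.alg n) : A) + (b : A)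
      rw [e1]
      have := hb.neg_algebraMap_norm_le_self
      exact neg_le_iff_add_nonneg'.1 this
    have h1' := hφ.nonneg _ h1
    have h2' := hφ.nonneg _ h2
    rw [map_sub, map_smul, hφ.unital, smul_eq_mul, mul_one] at h1'
    rw [map_add, map_smul, hφ.unital, smul_eq_mul, mul_one] at h2'
    rw [Complex.nonneg_iff] at h1' h2'
    have him : (φ b).im = 0 := by
      have := h2'.2
      simpa using this.symm
    have hre : φ b = ((φ b).re : ℂ) := by
      apply Complex.ext <;> simp [him]
    rw [hre, Complex.norm_real, Real.norm_eq_abs, abs_le]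
    have r1 := h1'.1
    have r2 := h2'.1
    simp at r1 r2
    constructor <;> linarith
  have hdec : a = (1 / 2 : ℂ) • (a + star a)
      + (-Complex.I / 2) • (Complex.I • (a - star a)) := by
    rw [smul_smul]
    have : -Complex.I / 2 * Complex.I = 1 / 2 := by
      linear_combination (-1 / 2 : ℂ) * Complex.I_mul_I
    rw [this, ← smul_add]
    have : a + star a + (a - star a) = (2 : ℂ) • a := by rw [two_smul]; abel
    rw [this, smul_smul]
    norm_num
  have s1 : ‖φ (a + star a)‖ ≤ 2 * ‖(a : A)‖ := by
    refine (hsa _ ?_).trans ?_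
    · exact IsSelfAdjoint.add_star_self (a : A)
    · have : ‖(a : A) + star (a : A)‖ ≤ ‖(a : A)‖ + ‖star (a : A)‖ := norm_add_le _ _
      rw [norm_star] at this
      change ‖(a : A) + star (a : A)‖ ≤ _
      linarith
  have s2 : ‖φ (Complex.I • (a - star a))‖ ≤ 2 * ‖(a : A)‖ := by
    refine (hsa _ ?_).trans ?_
    · change star (Complex.I • ((a : A) - star (a : A))) = Complex.I • ((a : A) - star (a : A))
      rw [star_smul, star_sub, star_star]
      simp only [Complex.star_def, Complex.conj_I, neg_smul, smul_sub]
      abel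
    · have : ‖(a : A) - star (a : A)‖ ≤ ‖(a : A)‖ + ‖star (a : A)‖ := norm_sub_le _ _
      rw [norm_star] at this
      change ‖Complex.I • ((a : A) - star (a : A))‖ ≤ _
      rw [norm_smul, Complex.norm_I, one_mul]
      linarith
  calc ‖φ a‖ = ‖(1 / 2 : ℂ) * φ (a + star a)
        + (-Complex.I / 2) * φ (Complex.I • (a - star a))‖ := by
        conv_lhs => rw [hdec]
        rw [map_add, map_smul, map_smul, smul_eq_mul, smul_eq_mul]
    _ ≤ ‖(1 / 2 : ℂ)‖ * ‖φ (a + star a)‖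
        + ‖(-Complex.I / 2 : ℂ)‖ * ‖φ (Complex.I • (a - star a))‖ := by
        refine (norm_add_le _ _).trans ?_
        rw [norm_mul, norm_mul]
    _ ≤ 2 * ‖(a : A)‖ := by
        have : ‖(-Complex.I / 2 : ℂ)‖ = 1 / 2 := by simp
        rw [this]
        have : ‖(1 / 2 : ℂ)‖ = 1 / 2 := by simp
        rw [this]
        linarith

/-! #### The predual of the center and harmonic functions -/

/-- The predual of the center of `A n`, identified with `ℓ^1` over the minimal projections. -/
abbrev Predual (n : ℕ) : Type _ := lp (fun _ : F.MinProj n => ℂ) 1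

theorem summable_pairing {n : ℕ} (ω : F.Predual n) (f : F.Center n) :
    Summable fun z => ω z * F.coeff f z := by
  have h : Summable fun z => ‖ω z‖ := by
    have := (lp.memℓp ω).summable (by norm_num)
    simpa using this
  refine Summable.of_norm_bounded (h.mul_right ‖((f : F.alg n) : A)‖) fun z => ?_
  rw [norm_mul]
  exact mul_le_mul_of_nonneg_left (F.norm_coeff_le f z) (norm_nonneg _)

/-- The duality pairing `⟨ω, f⟩ = ∑ z, ω(z) f(z)`. -/
def pairing {n : ℕ} (ω : F.Predual n) : F.Center n →ₗ[ℂ] ℂ where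
  toFun f := ∑' z, ω z * F.coeff f z
  map_add' f g := by
    rw [← (F.summable_pairing ω f).tsum_add (F.summable_pairing ω g)]
    simp only [coeff_add, mul_add]
  map_smul' l f := by
    rw [RingHom.id_apply, smul_eq_mul, ← tsum_mul_left]
    refine tsum_congr fun z => ?_
    rw [coeff_smul]
    ring

theorem norm_pairing_le {n : ℕ} (ω : F.Predual n) (f : F.Center n) :
    ‖F.pairing ω f‖ ≤ ‖ω‖ * ‖((f : F.alg n) : A)‖ := by
  have h : Summable fun z => ‖ω z‖ := by
    have := (lp.memℓp ω).summable (by norm_num)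
    simpa using this
  have hn : ‖ω‖ = ∑' z, ‖ω z‖ := by
    have := lp.norm_eq_tsum_rpow (p := 1) (by norm_num) ω
    simpa using this
  rw [hn, ← tsum_mul_right]
  refine tsum_of_norm_bounded (h.mul_right _).hasSum fun z => ?_
  rw [norm_mul]
  exact mul_le_mul_of_nonneg_left (F.norm_coeff_le f z) (norm_nonneg _)

theorem pairing_add {n : ℕ} (ω η : F.Predual n) (f : F.Center n) :
    F.pairing (ω + η) f = F.pairing ω f + F.pairing η f := by
  change ∑' z, (ω + η) z * F.coeff f z = ∑' z, ω z * F.coeff f z + ∑' z, η z * F.coeff f z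
  rw [← (F.summable_pairing ω f).tsum_add (F.summable_pairing η f)]
  refine tsum_congr fun z => ?_
  rw [lp.coeFn_add, Pi.add_apply, add_mul]

theorem pairing_smul {n : ℕ} (l : ℂ) (ω : F.Predual n) (f : F.Center n) :
    F.pairing (l • ω) f = l * F.pairing ω f := by
  change ∑' z, (l • ω) z * F.coeff f z = l * ∑' z, ω z * F.coeff f z
  rw [← tsum_mul_left]
  refine tsum_congr fun z => ?_
  rw [lp.coeFn_smul, Pi.smul_apply, smul_eq_mul, mul_assoc]

/-- The unit of `A 0 = ℂ`, which is its only minimal projection: the root of the Bratteli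
diagram. -/
def root [Nontrivial A] : F.MinProj 0 := by
  refine ⟨1, ⟨⟨one_mul 1, star_one _⟩, Set.one_mem_center⟩, ?_, ?_⟩
  · intro h
    exact one_ne_zero (congrArg (fun x : F.alg 0 => (x : A)) h)
  · intro p hp _
    have hm : (p : A) ∈ (⊥ : StarSubalgebra ℂ A) := F.alg_zero ▸ p.2
    obtain ⟨l, hl⟩ := StarSubalgebra.mem_bot.1 hm
    have hpp : algebraMap ℂ A l * algebraMap ℂ A l = algebraMap ℂ A l := by
      rw [hl]
      exact congrArg (fun x : F.alg 0 => (x : A)) hp.1.isIdempotentElem.eq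
    rw [← map_mul] at hpp
    have h2 : l * l = l := (algebraMap ℂ A).injective hpp
    rcases eq_or_ne l 0 with h0 | h0
    · left
      apply Subtype.ext
      rw [← hl, h0, map_zero]
      rfl
    · right
      have : l = 1 := mul_left_cancel₀ h0 (by rw [h2, mul_one])
      apply Subtype.ext
      rw [← hl, this, map_one]
      rfl

namespace Admissible

variable {F} {β : ℝ} (hβ : F.Admissible β)

/-- The (unique) normal `(α, β)`-KMS state `τ_z` on the block `zA n`. -/
def tau {n : ℕ} (z : F.MinProj n) : F.alg n →ₗ[ℂ] ℂ := (hβ n z).choose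

theorem tau_spec {n : ℕ} (z : F.MinProj n) : F.IsBlockKMSState β n z (hβ.tau z) :=
  (hβ n z).choose_spec

theorem exists_condExp {n : ℕ} (a : F.alg n) :
    ∃ c : F.Center n, ∀ z, F.coeff c z = hβ.tau z (z.1 * a) := by
  refine F.exists_center_of_bounded _ ⟨2 * ‖(a : A)‖, fun z => ?_⟩
  refine (F.norm_apply_le (hβ.tau_spec z).1 _).trans ?_
  have h1 : ‖((z.1 : F.alg n) : A)‖ ≤ 1 := by
    have h2 : ((z.1 : F.alg n) : A) * ((z.1 : F.alg n) : A) = ((z.1 : F.alg n) : A) :=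
      congrArg (fun x : F.alg n => (x : A)) z.2.1.1.isIdempotentElem.eq
    have h3 : star ((z.1 : F.alg n) : A) = ((z.1 : F.alg n) : A) :=
      congrArg (fun x : F.alg n => (x : A)) z.2.1.1.isSelfAdjoint.star_eq
    have h4 := CStarRing.norm_star_mul_self (x := ((z.1 : F.alg n) : A))
    rw [h3, h2] at h4
    by_contra! h5
    nlinarith
  have h6 : ‖((z.1 * a : F.alg n) : A)‖ ≤ ‖((z.1 : F.alg n) : A)‖ * ‖(a : A)‖ :=
    norm_mul_le _ _
  nlinarith [norm_nonneg (a : A)]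

/-- The normal conditional expectation `E n a = ∑ z, τ_z(za) z` onto the center of `A n`, i.e.
`E n a` is the element of the center with `z (E n a) = τ_z(za) z` for all `z`. -/
def condExp (n : ℕ) : F.alg n →ₗ[ℂ] F.Center n where
  toFun a := (hβ.exists_condExp a).choose
  map_add' a b := by
    refine F.center_ext fun z => ?_
    rw [F.coeff_add, (hβ.exists_condExp _).choose_spec, (hβ.exists_condExp a).choose_spec,
      (hβ.exists_condExp b).choose_spec, mul_add, map_add]
  map_smul' l a := by
    refine F.center_ext fun z => ?_
    rw [RingHom.id_apply, F.coeff_smul, (hβ.exists_condExp _).choose_spec,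
      (hβ.exists_condExp a).choose_spec, mul_smul_comm, map_smul, smul_eq_mul]

theorem coeff_condExp {n : ℕ} (a : F.alg n) (z : F.MinProj n) :
    F.coeff (hβ.condExp n a) z = hβ.tau z (z.1 * a) := (hβ.exists_condExp a).choose_spec z

/-- The link `κ(z', z) = τ_{z'}(z'z)`; it vanishes if `z'z = 0`, i.e. off the edges of the
Bratteli diagram. -/
def link {n : ℕ} (z' : F.MinProj (n + 1)) (z : F.MinProj n) : ℝ :=
  (hβ.tau z' (z'.1 * F.incl n z.1)).re

/-- The normalized positive `κ`-harmonic functions on the vertices of the Bratteli diagram. -/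
def harmonic [Nontrivial A] : Set ((Σ n, F.MinProj n) → ℝ) :=
  {ν | (∀ v, 0 ≤ ν v) ∧ ν ⟨0, F.root⟩ = 1 ∧
    ∀ (n : ℕ) (z : F.MinProj n),
      HasSum (fun z' : F.MinProj (n + 1) => ν ⟨n + 1, z'⟩ * hβ.link z' z) (ν ⟨n, z⟩)}

/-! #### The representation operator system -/

/-- `Θ_{n+1,n}`: the restriction of `E (n+1)` to the center of `A n`. -/
def theta (n : ℕ) : F.Center n →ₗ[ℂ] F.Center (n + 1) :=
  hβ.condExp (n + 1) ∘ₗ (F.incl n).toAlgHom.toLinearMap ∘ₗ (F.Center n).subtype.toAlgHom.toLinearMap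

/-- `Θ_{m,n} = Θ_{m,m-1} ∘ ⋯ ∘ Θ_{n+1,n}`. -/
def thetaLE (n m : ℕ) (h : n ≤ m) : F.Center n →ₗ[ℂ] F.Center m :=
  Nat.leRec (motive := fun m _ => F.Center n →ₗ[ℂ] F.Center m) LinearMap.id
    (fun m _ g => hβ.theta m ∘ₗ g) h

theorem thetaLE_self (n : ℕ) : hβ.thetaLE n n le_rfl = LinearMap.id := by
  unfold thetaLE
  rw [Nat.leRec_self]

theorem thetaLE_succ {n m : ℕ} (h : n ≤ m) :
    hβ.thetaLE n (m + 1) (h.trans (Nat.le_succ m)) = hβ.theta m ∘ₗ hβ.thetaLE n m h := by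
  unfold thetaLE
  rw [Nat.leRec_succ]

theorem thetaLE_thetaLE {n m k : ℕ} (h : n ≤ m) (h' : m ≤ k) (f : F.Center n) :
    hβ.thetaLE m k h' (hβ.thetaLE n m h f) = hβ.thetaLE n k (h.trans h') f := by
  induction k, h' using Nat.le_induction with
  | base => rw [hβ.thetaLE_self]; rfl
  | succ k hk ih =>
    rw [hβ.thetaLE_succ hk, hβ.thetaLE_succ (h.trans hk), LinearMap.comp_apply, ih]
    rfl

/-- The inductive limit of the centers along the `Θ_{m,n}`: the representation system. -/
abbrev PreSystem : Type _ := Module.DirectLimit (fun n => F.Center n) hβ.thetaLE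

/-- The canonical map of the center of `A n` into the representation system. -/
def preTheta (n : ℕ) : F.Center n →ₗ[ℂ] hβ.PreSystem :=
  Module.DirectLimit.of ℂ ℕ (fun n => F.Center n) hβ.thetaLE n

theorem preTheta_thetaLE {n m : ℕ} (h : n ≤ m) (f : F.Center n) :
    hβ.preTheta m (hβ.thetaLE n m h f) = hβ.preTheta n f :=
  Module.DirectLimit.of_f

/-- The kernel of the Archimedeanization: the classes of those `f` with
`‖Θ_{m,n}(f)‖ → 0` as `m → ∞`. -/
def nullSpace : Submodule ℂ hβ.PreSystem where
  carrier := {x | ∃ (n : ℕ) (f : F.Center n), hβ.preTheta n f = x ∧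
    ∀ ε > 0, ∃ N, ∀ m (h : n ≤ m), N ≤ m → ‖((hβ.thetaLE n m h f : F.alg m) : A)‖ ≤ ε}
  zero_mem' := by
    refine ⟨0, 0, map_zero _, fun ε hε => ⟨0, fun m h _ => ?_⟩⟩
    rw [map_zero]
    simpa using hε.le
  add_mem' := by
    rintro _ _ ⟨n, f, rfl, hf⟩ ⟨k, g, rfl, hg⟩
    refine ⟨max n k, hβ.thetaLE n _ (le_max_left n k) f + hβ.thetaLE k _ (le_max_right n k) g,
      ?_, fun ε hε => ?_⟩
    · rw [map_add, preTheta_thetaLE, preTheta_thetaLE]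
    · obtain ⟨N₁, h₁⟩ := hf (ε / 2) (half_pos hε)
      obtain ⟨N₂, h₂⟩ := hg (ε / 2) (half_pos hε)
      refine ⟨max N₁ N₂, fun m h hN => ?_⟩
      rw [map_add, thetaLE_thetaLE, thetaLE_thetaLE]
      have e₁ := h₁ m ((le_max_left n k).trans h) ((le_max_left _ _).trans hN)
      have e₂ := h₂ m ((le_max_right n k).trans h) ((le_max_right _ _).trans hN)
      refine (norm_add_le _ _).trans ?_
      linarith
  smul_mem' := by
    rintro l _ ⟨n, f, rfl, hf⟩
    refine ⟨n, l • f, map_smul _ _ _, fun ε hε => ?_⟩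
    have hl : 0 < ‖l‖ + 1 := by positivity
    obtain ⟨N, hN⟩ := hf (ε / (‖l‖ + 1)) (div_pos hε hl)
    refine ⟨N, fun m h hm => ?_⟩
    rw [map_smul]
    have e : ‖((hβ.thetaLE n m h f : F.alg m) : A)‖ * (‖l‖ + 1) ≤ ε :=
      (le_div_iff₀ hl).1 (hN m h hm)
    have e' : ‖(((l • hβ.thetaLE n m h f : F.Center m) : F.alg m) : A)‖
        = ‖l‖ * ‖((hβ.thetaLE n m h f : F.alg m) : A)‖ := norm_smul l _
    rw [e']
    nlinarith [norm_nonneg ((hβ.thetaLE n m h f : F.alg m) : A)]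

/-- The representation operator system `S(α, β)`, as a vector space. -/
abbrev System : Type _ := hβ.PreSystem ⧸ hβ.nullSpace

/-- The canonical map `Θ_{∞,n}` of the center of `A n` into `S(α, β)`. -/
def thetaInf (n : ℕ) : F.Center n →ₗ[ℂ] hβ.System := hβ.nullSpace.mkQ ∘ₗ hβ.preTheta n

/-- The order unit of the representation system. -/
def preUnit : hβ.PreSystem := hβ.preTheta 0 1

/-- The order unit of `S(α, β)`. -/
def unit : hβ.System := hβ.thetaInf 0 1

/-- The matrix cones of the representation system: a `k × k` matrix is positive if it is the
image of a positive matrix `Yᴴ * Y` over the center of some `A n`. -/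
def preCone (k : ℕ) : Set (Matrix (Fin k) (Fin k) hβ.PreSystem) :=
  {X | ∃ (n : ℕ) (Y : Matrix (Fin k) (Fin k) (F.Center n)),
    X = (Y.conjTranspose * Y).map (hβ.preTheta n)}

/-- The matrix cones of the operator system `S(α, β)` (Archimedeanization): the class of `Y` is
positive if for every `r > 0` the matrix `Y + r e` is the sum of a positive matrix and a matrix
with entries in the kernel. -/
def cone (k : ℕ) : Set (Matrix (Fin k) (Fin k) hβ.System) :=
  {X | ∃ Y : Matrix (Fin k) (Fin k) hβ.PreSystem, X = Y.map hβ.nullSpace.mkQ ∧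
    ∀ r : ℝ, 0 < r → ∃ Z ∈ hβ.preCone k, ∃ N : Matrix (Fin k) (Fin k) hβ.PreSystem,
      (∀ i j, N i j ∈ hβ.nullSpace) ∧
      Y + Matrix.diagonal (fun _ => (r : ℂ) • hβ.preUnit) = Z + N}

/-- States on `S(α, β)`: unital positive linear functionals. -/
def IsState (ω : hβ.System →ₗ[ℂ] ℂ) : Prop :=
  ω hβ.unit = 1 ∧ ∀ x : hβ.System, (Matrix.of fun _ _ : Fin 1 => x) ∈ hβ.cone 1 → 0 ≤ ω x

/-- Locally normal functionals: for all large `n`, the functional `ω ∘ Θ_{∞,n}` belongs to the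
predual of the center of `A n`. -/
def IsLocallyNormal (ω : hβ.System →ₗ[ℂ] ℂ) : Prop :=
  ∃ m : ℕ, ∀ n ≥ m, ∃ η : F.Predual n, ω ∘ₗ hβ.thetaInf n = F.pairing η

/-- The locally normal states on `S(α, β)`. -/
def lnStates : Set (hβ.System →ₗ[ℂ] ℂ) := {ω | hβ.IsState ω ∧ hβ.IsLocallyNormal ω}

/-! #### The projective limit of the preduals and its embedding into the dual of the system -/

/-- `L(α, β)`: the bounded sequences `(ω_n)` in the preduals with `Φ_{n,n+1}(ω_{n+1}) = ω_n`,
where `Φ_{n,n+1}` is the predual map of `Θ_{n+1,n}`. -/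
def projLimit : Submodule ℂ (∀ n, F.Predual n) where
  carrier := {ω | (∀ n, F.pairing (ω (n + 1)) ∘ₗ hβ.theta n = F.pairing (ω n)) ∧
    ∃ C : ℝ, ∀ n, ‖ω n‖ ≤ C}
  zero_mem' := by
    have h0 : ∀ n, F.pairing (0 : F.Predual n) = 0 := by
      intro n
      ext f
      have := F.pairing_smul (0 : ℂ) (0 : F.Predual n) f
      simpa using this
    refine ⟨fun n => ?_, 0, fun n => by simp⟩
    change F.pairing (0 : F.Predual (n + 1)) ∘ₗ hβ.theta n = F.pairing (0 : F.Predual n)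
    rw [h0, h0, LinearMap.zero_comp]
  add_mem' := by
    rintro ω η ⟨h₁, C₁, b₁⟩ ⟨h₂, C₂, b₂⟩
    refine ⟨fun n => ?_, C₁ + C₂, fun n => (norm_add_le _ _).trans (add_le_add (b₁ n) (b₂ n))⟩
    ext f
    have e₁ := LinearMap.congr_fun (h₁ n) f
    have e₂ := LinearMap.congr_fun (h₂ n) f
    simp only [LinearMap.comp_apply, Pi.add_apply, pairing_add] at e₁ e₂ ⊢
    rw [e₁, e₂]
  smul_mem' := by
    rintro l ω ⟨h₁, C₁, b₁⟩
    refine ⟨fun n => ?_, ‖l‖ * C₁, fun n => ?_⟩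
    · ext f
      have e₁ := LinearMap.congr_fun (h₁ n) f
      simp only [LinearMap.comp_apply, Pi.smul_apply, pairing_smul] at e₁ ⊢
      rw [e₁]
    · rw [Pi.smul_apply, norm_smul]
      exact mul_le_mul_of_nonneg_left (b₁ n) (norm_nonneg _)

theorem pairing_thetaLE (ω : hβ.projLimit) {n m : ℕ} (h : n ≤ m) (f : F.Center n) :
    F.pairing (ω.1 m) (hβ.thetaLE n m h f) = F.pairing (ω.1 n) f := by
  induction m, h using Nat.le_induction with
  | base => rw [hβ.thetaLE_self]; rfl
  | succ m hm ih =>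
    rw [hβ.thetaLE_succ hm, ← ih]
    exact LinearMap.congr_fun (ω.2.1 m) _

/-- The functional `⟨ω_n, ·⟩` on the representation system induced by `ω` in `L(α, β)`. -/
def preIota (ω : hβ.projLimit) : hβ.PreSystem →ₗ[ℂ] ℂ :=
  Module.DirectLimit.lift ℂ ℕ (fun n => F.Center n) hβ.thetaLE (fun n => F.pairing (ω.1 n))
    (fun _ _ h f => hβ.pairing_thetaLE ω h f)

theorem preIota_preTheta (ω : hβ.projLimit) (n : ℕ) (f : F.Center n) :
    hβ.preIota ω (hβ.preTheta n f) = F.pairing (ω.1 n) f :=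
  Module.DirectLimit.lift_of _ _ _

theorem nullSpace_le_ker (ω : hβ.projLimit) : hβ.nullSpace ≤ LinearMap.ker (hβ.preIota ω) := by
  rintro _ ⟨n, f, rfl, hf⟩
  obtain ⟨C, hC⟩ := ω.2.2
  rw [LinearMap.mem_ker, preIota_preTheta]
  by_contra hne
  have hp : 0 < ‖F.pairing (ω.1 n) f‖ := norm_pos_iff.2 hne
  have hC0 : 0 ≤ C := (norm_nonneg _).trans (hC 0)
  have hC1 : 0 < C + 1 := by positivity
  obtain ⟨N, hN⟩ := hf (‖F.pairing (ω.1 n) f‖ / (2 * (C + 1))) (by positivity)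
  have h1 := hN (max n N) (le_max_left _ _) (le_max_right _ _)
  have h2 := F.norm_pairing_le (ω.1 (max n N)) (hβ.thetaLE n _ (le_max_left n N) f)
  rw [hβ.pairing_thetaLE] at h2
  have h3 := mul_le_mul ((hC (max n N)).trans (by linarith : C ≤ C + 1)) h1
    (norm_nonneg _) hC1.le
  have h4 : (C + 1) * (‖F.pairing (ω.1 n) f‖ / (2 * (C + 1))) = ‖F.pairing (ω.1 n) f‖ / 2 := by
    field_simp
  linarith

/-- The embedding `ι` of `L(α, β)` into the dual of `S(α, β)`, determined by
`ι(ω)(Θ_{∞,n}(f)) = ⟨ω_n, f⟩`. -/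
def iota (ω : hβ.projLimit) : hβ.System →ₗ[ℂ] ℂ :=
  hβ.nullSpace.liftQ (hβ.preIota ω) (hβ.nullSpace_le_ker ω)

theorem iota_thetaInf (ω : hβ.projLimit) (n : ℕ) (f : F.Center n) :
    hβ.iota ω (hβ.thetaInf n f) = F.pairing (ω.1 n) f :=
  hβ.preIota_preTheta ω n f

end Admissible

end LocallyAtomicFlow

end

/-! The heart of the matter is that a block `zA n`, a copy of some `B(H)`, carries only one normal
KMS functional up to a factor. Hence a normal KMS functional `φ` on `A n` satisfies `φ (z a) = φ z *
τ_z a`, and complete additivity over the minimal central projections gives `φ = ∑ φ(z) τ_z`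
(`hasSum_tau`): it is determined by its values at those projections. Applied to the restriction of
`τ_{z'}` to the previous level, this formula has coefficients `κ(z', z)`. It yields the description
of `Θ` by `κ` (`hasSum_coeff_theta`) and the compatibility `E_{n+1} = Θ_{n+1,n} ∘ E_n` on `A n`
(`condExp_incl`). Applied to a locally normal KMS state on `A`, it says that the values at the
projections are harmonic.

In the other direction, the rows of `κ` sum to `1`, so a normalized harmonic function is a
probability vector on every level. These vectors are compatible with `Θ` and define a locally normal
state of the system. Every such state arises in this way: normality on the high levels passes down
through `Θ` (`hasSum_vertexFun`). The mixtures `∑ ν(z) τ_z` are norm limits of finite mixtures,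
hence normal and KMS; they are compatible and uniformly bounded, so they extend to `A` by
Hahn–Banach.

For the uniqueness on `B(H)` with `β ≠ 0` (`exists_eq_mul_of_kms`), each `θ t` is conjugation by a
unitary `U t`, and the densities of both functionals commute with all `U t` because KMS functionals
are invariant. A spectral cut of a nonzero density gives a finite-dimensional subspace invariant
under the `U t`; on a minimal such subspace both densities compress to scalars `c` and `d`. For a
unit vector `v` there, the functions `t ↦ φ (|v⟩⟨y| θ t (|x⟩⟨v|))` and their analogues for `ψ` are
`c` and `d` times the same function. A bounded strip function vanishing on one boundary line
vanishes on the other, so the values at `|x⟩⟨y|` are proportional too. For `β = 0` both functionals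
are traces on finite-rank operators.

The three maps are continuous and compose to the identity around the triangle, so the inverse of
each is the composite of the other two. -/

noncomputable section

/-! ### Bounded analytic functions on a strip -/

/-- `G` is bounded and continuous on the closed strip between `Im z = 0` and `Im z = β` and
analytic in its interior. -/
structure IsStripFun (β : ℝ) (G : ℂ → ℂ) : Prop where
  cont : ContinuousOn G {w | w.im ∈ Set.uIcc 0 β}
  diff : DifferentiableOn ℂ G {w | w.im ∈ Set.uIoo 0 β}
  bdd : ∃ C : ℝ, ∀ w : ℂ, w.im ∈ Set.uIcc 0 β → ‖G w‖ ≤ C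

/-- `f` and `g` are the boundary values of a bounded analytic function on a strip. -/
def IsStripPair (β : ℝ) (f g : ℝ → ℂ) : Prop :=
  ∃ G : ℂ → ℂ, IsStripFun β G ∧ ∀ t : ℝ, G t = f t ∧ G (t + β * Complex.I) = g t

theorem isKMSOn_iff_isStripPair {M : Type*} [Mul M] {σ : ℝ → M → M} {β : ℝ} {B : Set M}
    {φ : M → ℂ} : IsKMSOn σ β B φ ↔ ∀ a ∈ B, ∀ b ∈ B,
      IsStripPair β (fun t => φ (a * σ t b)) (fun t => φ (σ t b * a)) := by
  refine forall₂_congr fun a _ => forall₂_congr fun b _ => exists_congr fun G => ?_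
  exact ⟨fun ⟨h1, h2, h3, h4⟩ => ⟨⟨h1, h2, h3⟩, h4⟩, fun ⟨⟨h1, h2, h3⟩, h4⟩ => ⟨h1, h2, h3, h4⟩⟩

namespace IsStripFun

variable {β : ℝ} {G K : ℂ → ℂ}

theorem add (hG : IsStripFun β G) (hK : IsStripFun β K) : IsStripFun β (fun w => G w + K w) := by
  obtain ⟨C, hC⟩ := hG.bdd
  obtain ⟨D, hD⟩ := hK.bdd
  exact ⟨hG.cont.add hK.cont, hG.diff.add hK.diff, C + D, fun w hw =>
    (norm_add_le _ _).trans (add_le_add (hC w hw) (hD w hw))⟩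

theorem const_mul (c : ℂ) (hG : IsStripFun β G) : IsStripFun β (fun w => c * G w) := by
  obtain ⟨C, hC⟩ := hG.bdd
  refine ⟨continuousOn_const.mul hG.cont, hG.diff.const_mul c, ‖c‖ * C, fun w hw => ?_⟩
  rw [norm_mul]
  exact mul_le_mul_of_nonneg_left (hC w hw) (norm_nonneg _)

theorem sub (hG : IsStripFun β G) (hK : IsStripFun β K) : IsStripFun β (fun w => G w - K w) := by
  simpa [sub_eq_add_neg] using hG.add (hK.const_mul (-1))

theorem cexp (hG : IsStripFun β G) : IsStripFun β (fun w => Complex.exp (G w)) := by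
  obtain ⟨C, hC⟩ := hG.bdd
  refine ⟨hG.cont.cexp, hG.diff.cexp, Real.exp C, fun w hw => ?_⟩
  rw [Complex.norm_exp]
  exact Real.exp_le_exp.2 ((Complex.re_le_norm _).trans (hC w hw))

theorem mul (hG : IsStripFun β G) (hK : IsStripFun β K) : IsStripFun β (fun w => G w * K w) := by
  obtain ⟨C, hC⟩ := hG.bdd
  obtain ⟨D, hD⟩ := hK.bdd
  refine ⟨hG.cont.mul hK.cont, hG.diff.mul hK.diff, C * D, fun w hw => ?_⟩
  rw [norm_mul]
  exact mul_le_mul (hC w hw) (hD w hw) (norm_nonneg _) ((norm_nonneg _).trans (hC w hw))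

/-- The three lines theorem in Phragmén–Lindelöf form; boundedness of `G` provides the growth
condition. For `β = 0` the strip is the real axis, which is treated separately. -/
theorem norm_le (hG : IsStripFun β G) {C : ℝ} (h0 : ∀ t : ℝ, ‖G t‖ ≤ C)
    (h1 : ∀ t : ℝ, ‖G (t + β * Complex.I)‖ ≤ C) {w : ℂ} (hw : w.im ∈ Set.uIcc 0 β) :
    ‖G w‖ ≤ C := by
  have e0 : ∀ z : ℂ, z.im = 0 → ‖G z‖ ≤ C := by
    intro z hz
    have : z = ((z.re : ℝ) : ℂ) := by apply Complex.ext <;> simp [hz]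
    rw [this]; exact h0 _
  have e1 : ∀ z : ℂ, z.im = β → ‖G z‖ ≤ C := by
    intro z hz
    have : z = ((z.re : ℝ) : ℂ) + β * Complex.I := by apply Complex.ext <;> simp [hz]
    rw [this]; exact h1 _
  obtain ⟨D, hD⟩ := hG.bdd
  rcases eq_or_ne β 0 with rfl | hβ
  · refine e0 w ?_
    simpa using hw
  have hlt : min 0 β < max 0 β := by simpa using hβ
  have hd : DiffContOnCl ℂ G (Complex.im ⁻¹' Set.Ioo (min 0 β) (max 0 β)) := by
    refine ⟨hG.diff, ?_⟩
    rw [Complex.closure_preimage_im, closure_Ioo hlt.ne]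
    exact hG.cont
  have hmin : ∀ z : ℂ, z.im = min 0 β → ‖G z‖ ≤ C := by
    intro z hz
    rcases min_choice 0 β with h | h
    · exact e0 z (hz.trans h)
    · exact e1 z (hz.trans h)
  have hmax : ∀ z : ℂ, z.im = max 0 β → ‖G z‖ ≤ C := by
    intro z hz
    rcases max_choice 0 β with h | h
    · exact e0 z (hz.trans h)
    · exact e1 z (hz.trans h)
  refine PhragmenLindelof.horizontal_strip hd ⟨0, ?_, 0, ?_⟩ hmin hmax hw.1 hw.2
  · exact div_pos Real.pi_pos (sub_pos.2 hlt)
  · refine Asymptotics.IsBigO.of_bound D ?_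
    filter_upwards [Filter.mem_inf_of_right (Filter.mem_principal_self _)] with z hz
    simpa using hD z ⟨hz.1.le, hz.2.le⟩

end IsStripFun

namespace IsStripPair

variable {β : ℝ} {f g f' g' : ℝ → ℂ}

theorem add (h : IsStripPair β f g) (h' : IsStripPair β f' g') :
    IsStripPair β (fun t => f t + f' t) (fun t => g t + g' t) := by
  obtain ⟨G, hG, e⟩ := h
  obtain ⟨K, hK, e'⟩ := h'
  exact ⟨_, hG.add hK, fun t => ⟨by rw [(e t).1, (e' t).1], by rw [(e t).2, (e' t).2]⟩⟩

theorem const_mul (c : ℂ) (h : IsStripPair β f g) :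
    IsStripPair β (fun t => c * f t) (fun t => c * g t) := by
  obtain ⟨G, hG, e⟩ := h
  exact ⟨_, hG.const_mul c, fun t => ⟨by rw [(e t).1], by rw [(e t).2]⟩⟩

theorem zero : IsStripPair β (fun _ => 0) (fun _ => 0) :=
  ⟨fun _ => 0, ⟨continuousOn_const, differentiableOn_const _, 0, by simp⟩, by simp⟩

theorem sum {ι : Type*} (s : Finset ι) {f g : ι → ℝ → ℂ}
    (h : ∀ i ∈ s, IsStripPair β (f i) (g i)) :
    IsStripPair β (fun t => ∑ i ∈ s, f i t) (fun t => ∑ i ∈ s, g i t) := by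
  classical
  induction s using Finset.induction_on with
  | empty => simpa using zero
  | insert i s hi ih =>
    simp only [Finset.sum_insert hi]
    exact (h i (Finset.mem_insert_self _ _)).add
      (ih fun j hj => h j (Finset.mem_insert_of_mem hj))

/-- Boundary values of strip functions are closed under uniform limits. -/
theorem of_approx (h : ∀ ε > 0, ∃ f' g' : ℝ → ℂ, IsStripPair β f' g' ∧
    ∀ t, ‖f t - f' t‖ ≤ ε ∧ ‖g t - g' t‖ ≤ ε) : IsStripPair β f g := by
  choose F F' hF hFε using fun n : ℕ => h (1 / (n + 1)) Nat.one_div_pos_of_nat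
  choose G hG hGb using hF
  -- Differences of strip functions are strip functions, so closeness on the two boundary lines
  -- gives closeness on the whole closed strip.
  have hd : ∀ n m : ℕ, ∀ w : ℂ, w.im ∈ Set.uIcc 0 β →
      ‖G n w - G m w‖ ≤ 1 / ((n : ℝ) + 1) + 1 / ((m : ℝ) + 1) := by
    intro n m w hw
    refine ((hG n).sub (hG m)).norm_le (fun t => ?_) (fun t => ?_) hw
    · rw [(hGb n t).1, (hGb m t).1, ← sub_sub_sub_cancel_left _ _ (f t), norm_sub_rev]
      exact (norm_sub_le _ _).trans (add_le_add (hFε n t).1 (hFε m t).1)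
    · rw [(hGb n t).2, (hGb m t).2, ← sub_sub_sub_cancel_left _ _ (g t), norm_sub_rev]
      exact (norm_sub_le _ _).trans (add_le_add (hFε n t).2 (hFε m t).2)
  have hz : Filter.Tendsto (fun n : ℕ => 1 / ((n : ℝ) + 1)) Filter.atTop (nhds 0) :=
    tendsto_one_div_add_atTop_nhds_zero_nat
  have hC : UniformCauchySeqOn G Filter.atTop {w : ℂ | w.im ∈ Set.uIcc 0 β} := by
    rw [Metric.uniformCauchySeqOn_iff]
    intro ε hε
    obtain ⟨N, hN⟩ := Filter.eventually_atTop.1 (hz.eventually (gt_mem_nhds (half_pos hε)))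
    refine ⟨N, fun m hm n hn w hw => ?_⟩
    rw [dist_eq_norm]
    have := hd m n w hw
    linarith [hN m hm, hN n hn]
  -- Only the values on the closed strip matter; elsewhere any number serves as the limit.
  have hlim : ∀ w : ℂ, ∃ l : ℂ, w.im ∈ Set.uIcc 0 β →
      Filter.Tendsto (fun n => G n w) Filter.atTop (nhds l) := by
    intro w
    by_cases hw : w.im ∈ Set.uIcc 0 β
    · obtain ⟨l, hl⟩ := cauchySeq_tendsto_of_complete (hC.cauchySeq hw)
      exact ⟨l, fun _ => hl⟩
    · exact ⟨0, fun h => absurd h hw⟩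
  choose L hL using hlim
  have hU : TendstoUniformlyOn G L Filter.atTop {w : ℂ | w.im ∈ Set.uIcc 0 β} :=
    hC.tendstoUniformlyOn_of_tendsto fun w hw => hL w hw
  have hsub : {w : ℂ | w.im ∈ Set.uIoo 0 β} ⊆ {w : ℂ | w.im ∈ Set.uIcc 0 β} :=
    fun w hw => ⟨hw.1.le, hw.2.le⟩
  refine ⟨L, ⟨hU.continuousOn (Filter.Frequently.of_forall fun n => (hG n).cont), ?_, ?_⟩,
    fun t => ⟨?_, ?_⟩⟩
  · refine (hU.mono hsub).tendstoLocallyUniformlyOn.differentiableOn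
      (Filter.Eventually.of_forall fun n => (hG n).diff) ?_
    exact isOpen_Ioo.preimage Complex.continuous_im
  · obtain ⟨C, hC0⟩ := (hG 0).bdd
    refine ⟨C + 2, fun w hw => ?_⟩
    refine le_of_tendsto (hL w hw).norm (Filter.Eventually.of_forall fun n => ?_)
    have h1 := hd n 0 w hw
    have h2 := norm_le_norm_add_norm_sub' (G n w) (G 0 w)
    have h3 : 1 / ((n : ℝ) + 1) ≤ 1 := by
      rw [div_le_one (by positivity)]
      linarith [(Nat.cast_nonneg n : (0 : ℝ) ≤ n)]
    have h4 := hC0 w hw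
    norm_num at h1
    norm_num at h3
    linarith
  · have hw : ((t : ℂ)).im ∈ Set.uIcc 0 β := by simp
    refine tendsto_nhds_unique (hL _ hw) ?_
    rw [tendsto_iff_norm_sub_tendsto_zero]
    refine squeeze_zero (fun _ => norm_nonneg _) (fun n => ?_) hz
    rw [(hGb n t).1, norm_sub_rev]
    exact (hFε n t).1
  · have hw : ((t : ℂ) + β * Complex.I).im ∈ Set.uIcc 0 β := by simp
    refine tendsto_nhds_unique (hL _ hw) ?_
    rw [tendsto_iff_norm_sub_tendsto_zero]
    refine squeeze_zero (fun _ => norm_nonneg _) (fun n => ?_) hz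
    rw [(hGb n t).2, norm_sub_rev]
    exact (hFε n t).2

theorem eq_of_zero (h : IsStripPair 0 f g) (t : ℝ) : f t = g t := by
  obtain ⟨G, -, e⟩ := h
  rw [← (e t).1, ← (e t).2]
  simp

/-- A strip function that vanishes on one boundary line vanishes on the other one. -/
theorem eq_zero (hβ : β ≠ 0) (h : IsStripPair β (fun _ => 0) g) (t : ℝ) : g t = 0 := by
  obtain ⟨G, hG, e⟩ := h
  obtain ⟨C, hC⟩ := hG.bdd
  have hC0 : 0 ≤ C := (norm_nonneg _).trans (hC 0 (by simp))
  -- in the interior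
  have hint : ∀ w : ℂ, w.im ∈ Set.uIoo 0 β → G w = 0 := by
    intro w hw
    have hpos : 0 < 1 - w.im / β := by
      rcases lt_or_gt_of_ne hβ with h | h
      · rw [Set.uIoo_of_gt h] at hw
        rw [sub_pos, div_lt_one_of_neg h]
        exact hw.1
      · rw [Set.uIoo_of_lt h] at hw
        rw [sub_pos, div_lt_one h]
        exact hw.2
    -- The factor `E` has modulus `1` on the line where `G` vanishes and `exp (-n)` on the other
    -- line. Bounding `G * E` by its boundary values and dividing by `E` gives an estimate that
    -- decays in `n` at every interior point.
    have hE : ∀ n : ℕ, ‖G w‖ ≤ C * Real.exp (-(1 - w.im / β)) ^ n := by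
      intro n
      let E : ℂ → ℂ := fun w => Complex.exp ((((n : ℝ) / β : ℝ) : ℂ) * (Complex.I * w))
      have hEn : ∀ w, ‖E w‖ = Real.exp (-(n * (w.im / β))) := by
        intro w
        simp only [E]
        rw [Complex.norm_exp]
        congr 1
        rw [Complex.re_ofReal_mul]
        simp
        ring
      have hES : IsStripFun β E := by
        have hdiff : Differentiable ℂ E := by
          intro w; fun_prop
        refine ⟨hdiff.continuous.continuousOn, hdiff.differentiableOn, 1, fun w hw => ?_⟩
        rw [hEn, Real.exp_le_one_iff, neg_nonpos]
        refine mul_nonneg (Nat.cast_nonneg _) ?_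
        rcases lt_or_gt_of_ne hβ with h | h
        · rw [Set.uIcc_of_ge h.le] at hw
          exact div_nonneg_of_nonpos hw.2 h.le
        · rw [Set.uIcc_of_le h.le] at hw
          exact div_nonneg hw.1 h.le
      have hb := (hG.mul hES).norm_le (C := C * Real.exp (-n)) (fun t => ?_) (fun t => ?_)
        (w := w) ⟨hw.1.le, hw.2.le⟩
      · rw [norm_mul, hEn] at hb
        have : ‖G w‖ = ‖G w‖ * Real.exp (-(n * (w.im / β))) * Real.exp (n * (w.im / β)) := by
          rw [mul_assoc, ← Real.exp_add]; simp
        rw [this, ← Real.exp_nat_mul]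
        refine (mul_le_mul_of_nonneg_right hb (Real.exp_pos _).le).trans (le_of_eq ?_)
        rw [mul_assoc, ← Real.exp_add]
        congr 2
        ring
      · rw [(e t).1, zero_mul, norm_zero]
        positivity
      · rw [norm_mul, hEn]
        have : ((t : ℂ) + β * Complex.I).im / β = 1 := by simp [hβ]
        rw [this, mul_one]
        exact mul_le_mul_of_nonneg_right (hC _ (by simp)) (Real.exp_pos _).le
    have hq : Filter.Tendsto (fun n : ℕ => C * Real.exp (-(1 - w.im / β)) ^ n) Filter.atTop
        (nhds (C * 0)) := by
      refine (tendsto_pow_atTop_nhds_zero_of_lt_one (Real.exp_pos _).le ?_).const_mul C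
      rw [Real.exp_lt_one_iff]
      linarith
    rw [mul_zero] at hq
    exact norm_le_zero_iff.1 (ge_of_tendsto' hq hE)
  have hlt : min 0 β < max 0 β := by simpa using hβ
  have hcl : closure {w : ℂ | w.im ∈ Set.uIoo 0 β} = {w : ℂ | w.im ∈ Set.uIcc 0 β} := by
    have := Complex.closure_preimage_im (Set.Ioo (min 0 β) (max 0 β))
    rw [closure_Ioo hlt.ne] at this
    exact this
  have hall : Set.EqOn G (fun _ => 0) {w : ℂ | w.im ∈ Set.uIcc 0 β} := by
    rw [← hcl]
    refine Set.EqOn.of_subset_closure (fun w hw => hint w hw) ?_ ?_ subset_closure subset_rfl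
    · rw [hcl]; exact hG.cont
    · exact continuousOn_const
  rw [← (e t).2]
  exact hall (by simp)

/-- A strip function with the same real boundary values on both lines is constant. -/
theorem eq_const (hβ : β ≠ 0) (h : IsStripPair β f f) (hf : ∀ t, (f t).im = 0) (t : ℝ) :
    f t = f 0 := by
  obtain ⟨G, hG, e⟩ := h
  -- On both boundary lines `G` is real, so `exp (i c G)` has modulus `1` there and at most `1`
  -- inside. Taking `c = 1` and `c = -1` forces `Im G = 0`, and an analytic function with constant
  -- imaginary part on a connected open set is constant.
  have hre : ∀ c : ℝ, ∀ w : ℂ, w.im ∈ Set.uIcc 0 β →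
      Real.exp (-(c * (G w).im)) ≤ 1 := by
    intro c w hw
    have hexp := (hG.const_mul ((c : ℂ) * Complex.I)).cexp
    have hn : ∀ w : ℂ, ‖Complex.exp ((c : ℂ) * Complex.I * G w)‖
        = Real.exp (-(c * (G w).im)) := by
      intro w
      rw [Complex.norm_exp, mul_assoc, Complex.re_ofReal_mul]
      simp
    rw [← hn]
    refine hexp.norm_le (fun t => ?_) (fun t => ?_) hw
    · rw [hn, (e t).1, hf]; simp
    · rw [hn, (e t).2, hf]; simp
  have him : ∀ w : ℂ, w.im ∈ Set.uIcc 0 β → (G w).im = 0 := by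
    intro w hw
    have h1 := Real.exp_le_one_iff.1 (hre 1 w hw)
    have h2 := Real.exp_le_one_iff.1 (hre (-1) w hw)
    linarith
  have hlt : min 0 β < max 0 β := by simpa using hβ
  have hopen : IsOpen {w : ℂ | w.im ∈ Set.uIoo 0 β} := isOpen_Ioo.preimage Complex.continuous_im
  have hconv : IsPreconnected {w : ℂ | w.im ∈ Set.uIoo 0 β} :=
    ((convex_Ioo (min 0 β) (max 0 β)).linear_preimage Complex.imLm).isPreconnected
  have hne : {w : ℂ | w.im ∈ Set.uIoo 0 β}.Nonempty := by
    obtain ⟨y, hy⟩ := Set.nonempty_Ioo.2 hlt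
    exact ⟨y * Complex.I, by simpa [Set.uIoo] using hy⟩
  obtain ⟨c, hc⟩ := (hG.diff.analyticOnNhd hopen).eq_const_of_im_eq_const (c₀ := 0)
    (fun w hw => him w ⟨hw.1.le, hw.2.le⟩) hopen ⟨hne, hconv⟩
  have hcl : closure {w : ℂ | w.im ∈ Set.uIoo 0 β} = {w : ℂ | w.im ∈ Set.uIcc 0 β} := by
    have := Complex.closure_preimage_im (Set.Ioo (min 0 β) (max 0 β))
    rw [closure_Ioo hlt.ne] at this
    exact this
  have hall : Set.EqOn G (fun _ => c) {w : ℂ | w.im ∈ Set.uIcc 0 β} := by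
    rw [← hcl]
    refine Set.EqOn.of_subset_closure (fun w hw => hc w hw) ?_ ?_ subset_closure subset_rfl
    · rw [hcl]; exact hG.cont
    · exact continuousOn_const
  rw [← (e t).1, ← (e 0).1, hall (by simp), hall (by simp)]

end IsStripPair

/-! ### Positive functionals on star algebras -/

section PositiveFunctional

variable {M : Type*} [Ring M] [StarRing M] [Algebra ℂ M] [StarModule ℂ M] {φ : M →ₗ[ℂ] ℂ}

/-- Polarization: the values at the squares of `1 + a` and `1 + i a` are real, and their imaginary
parts give the two coordinates of the identity. -/
theorem map_star_of_pos (hφ : ∀ a, 0 ≤ φ (star a * a)) (a : M) :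
    φ (star a) = starRingEnd ℂ (φ a) := by
  have h1 := hφ 1
  have h2 := hφ a
  have h3 := hφ (1 + a)
  have h4 := hφ (1 + Complex.I • a)
  have e3 : star (1 + a) * (1 + a) = star (1 : M) * 1 + a + star a + star a * a := by
    simp only [star_add, star_one]; noncomm_ring
  have e4 : star (1 + Complex.I • a) * (1 + Complex.I • a)
      = star (1 : M) * 1 + Complex.I • a + (-Complex.I) • star a + star a * a := by
    simp only [star_add, star_one, star_smul, add_mul, mul_add, smul_mul_smul_comm, mul_one,
      one_mul, Complex.star_def, Complex.conj_I]
    simp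
    abel
  rw [e3] at h3
  rw [e4] at h4
  simp only [map_add, map_smul, smul_eq_mul] at h3 h4
  rw [Complex.nonneg_iff] at h1 h2 h3 h4
  have i3 := h3.2
  have i4 := h4.2
  simp only [Complex.add_im, Complex.mul_im, Complex.I_re, Complex.I_im, Complex.neg_re,
    Complex.neg_im, ← h1.2, ← h2.2] at i3 i4
  apply Complex.ext
  · simp; linarith
  · simp; linarith

/-- The Cauchy–Schwarz inequality. -/
theorem norm_sq_le_of_pos (hφ : ∀ a, 0 ≤ φ (star a * a)) (a b : M) :
    ‖φ (star a * b)‖ ^ 2 ≤ (φ (star a * a)).re * (φ (star b * b)).re := by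
  let c : PreInnerProductSpace.Core ℂ M :=
    { inner := fun x y => φ (star x * y)
      conj_inner_symm := fun x y => by
        change starRingEnd ℂ (φ (star y * x)) = φ (star x * y)
        rw [← map_star_of_pos hφ, star_mul, star_star]
      re_inner_nonneg := fun x => (Complex.nonneg_iff.1 (hφ x)).1
      add_left := fun x y z => by
        change φ (star (x + y) * z) = φ (star x * z) + φ (star y * z)
        rw [star_add, add_mul, map_add]
      smul_left := fun x y r => by
        change φ (star (r • x) * y) = _ * φ (star x * y)
        rw [star_smul, smul_mul_assoc, map_smul]; rfl }
  have h := @InnerProductSpace.Core.inner_mul_inner_self_le ℂ M _ _ _ c a b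
  have e : ‖φ (star b * a)‖ = ‖φ (star a * b)‖ := by
    have : φ (star b * a) = starRingEnd ℂ (φ (star a * b)) := by
      rw [← map_star_of_pos hφ, star_mul, star_star]
    rw [this, RCLike.norm_conj]
  rw [sq]
  calc _ = ‖φ (star a * b)‖ * ‖φ (star b * a)‖ := by rw [e]
    _ ≤ _ := h

omit [Algebra ℂ M] [StarModule ℂ M] in
theorem star_one_sub_sum_mul_self {ι : Type*} {p : ι → M}
    (hsa : ∀ i, star (p i) = p i) (hid : ∀ i, p i * p i = p i)
    (hort : ∀ i j, i ≠ j → p i * p j = 0) (s : Finset ι) :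
    star (1 - ∑ i ∈ s, p i) * (1 - ∑ i ∈ s, p i) = 1 - ∑ i ∈ s, p i := by
  classical
  have h2 : (∑ i ∈ s, p i) * (∑ i ∈ s, p i) = ∑ i ∈ s, p i := by
    rw [Finset.sum_mul_sum]
    refine Finset.sum_congr rfl fun i hi => ?_
    rw [Finset.sum_eq_single i, hid]
    · intro j _ hji; exact hort i j (Ne.symm hji)
    · intro hn; exact absurd hi hn
  rw [star_sub, star_one, star_sum, Finset.sum_congr rfl fun i _ => hsa i, sub_mul, mul_sub,
    mul_sub, h2]
  simp

/-- If `φ` is completely additive on a family of orthogonal projections with sum `1`, then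
`φ a = ∑ φ (a p_i)`. -/
theorem hasSum_mul_of_hasSum (hφ : ∀ a, 0 ≤ φ (star a * a)) {ι : Type*} {p : ι → M}
    (hsa : ∀ i, star (p i) = p i) (hid : ∀ i, p i * p i = p i)
    (hort : ∀ i j, i ≠ j → p i * p j = 0) (h : HasSum (fun i => φ (p i)) (φ 1)) (a : M) :
    HasSum (fun i => φ (a * p i)) (φ a) := by
  classical
  rw [HasSum, SummationFilter.unconditional_filter] at h ⊢
  have hE : ∀ s : Finset ι, φ a - ∑ i ∈ s, φ (a * p i) = φ (a * (1 - ∑ i ∈ s, p i)) := by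
    intro s
    rw [mul_sub, mul_one, map_sub, Finset.mul_sum, map_sum]
  have hP := star_one_sub_sum_mul_self hsa hid hort
  -- The remainder `1 - ∑ p i` is a projection, so Cauchy–Schwarz bounds the error by the square
  -- root of a constant times `φ` of that remainder.
  have hb : ∀ s : Finset ι, ‖φ a - ∑ i ∈ s, φ (a * p i)‖
      ≤ Real.sqrt ((φ (a * star a)).re * ‖φ 1 - ∑ i ∈ s, φ (p i)‖) := by
    intro s
    rw [hE]
    refine Real.le_sqrt_of_sq_le ?_
    have := norm_sq_le_of_pos hφ (star a) (1 - ∑ i ∈ s, p i)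
    rw [star_star] at this
    refine this.trans (mul_le_mul_of_nonneg_left ?_ ?_)
    · rw [hP, map_sub, map_sum]
      exact Complex.re_le_norm _
    · have := (Complex.nonneg_iff.1 (hφ (star a))).1
      rwa [star_star] at this
  rw [tendsto_iff_norm_sub_tendsto_zero] at h ⊢
  have h' := ((h.const_mul (φ (a * star a)).re).sqrt)
  rw [mul_zero, Real.sqrt_zero] at h'
  refine squeeze_zero (fun _ => norm_nonneg _) (fun s => ?_) h'
  rw [norm_sub_rev, norm_sub_rev (∑ i ∈ s, φ (p i))]
  exact hb s

end PositiveFunctional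

/-! ### Normal KMS functionals on `B(H)` -/

section BoundedOperators

open InnerProductSpace

variable {H : Type*} [NormedAddCommGroup H] [InnerProductSpace ℂ H] [CompleteSpace H]

theorem nonneg_of_isPositive {φ : (H →L[ℂ] H) →ₗ[ℂ] ℂ} (hφ : ∀ a, 0 ≤ φ (star a * a))
    {T : H →L[ℂ] H} (hT : T.IsPositive) : 0 ≤ φ T := by
  obtain ⟨S, rfl⟩ := CStarAlgebra.nonneg_iff_eq_star_mul_self.1
    ((ContinuousLinearMap.nonneg_iff_isPositive T).2 hT)
  exact hφ S

omit [CompleteSpace H] in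
theorem rankOne_mul_rankOne (x y z w : H) :
    rankOne ℂ x y * rankOne ℂ z w = inner ℂ y z • rankOne ℂ x w := by
  ext u
  simp [smul_smul, mul_comm]

theorem star_rankOne (x y : H) : star (rankOne ℂ x y) = rankOne ℂ y x := by
  rw [ContinuousLinearMap.star_eq_adjoint, adjoint_rankOne]

/-- Bessel's inequality for positive functionals. -/
theorem sum_apply_rankOne_le {φ : (H →L[ℂ] H) →ₗ[ℂ] ℂ} (hφ : ∀ a, 0 ≤ φ (star a * a))
    {ι : Type*} [Fintype ι] {v : ι → H} (hv : Orthonormal ℂ v) :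
    ∑ i, (φ (rankOne ℂ (v i) (v i))).re ≤ (φ 1).re := by
  have hpos : (1 - ∑ i, rankOne ℂ (v i) (v i) : H →L[ℂ] H).IsPositive := by
    rw [ContinuousLinearMap.isPositive_iff_complex]
    intro x
    have e : inner ℂ ((1 - ∑ i, rankOne ℂ (v i) (v i) : H →L[ℂ] H) x) x
        = ((‖x‖ ^ 2 - ∑ i, ‖inner ℂ (v i) x‖ ^ 2 : ℝ) : ℂ) := by
      rw [sub_apply, inner_sub_left, sum_apply, sum_inner]
      push_cast
      congr 1
      · exact inner_self_eq_norm_sq_to_K x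
      · refine Finset.sum_congr rfl fun i _ => ?_
        rw [rankOne_apply, inner_smul_left]
        exact RCLike.conj_mul _
    rw [e]
    refine ⟨by rw [RCLike.re_to_complex, Complex.ofReal_re], ?_⟩
    have := hv.sum_inner_products_le x (s := Finset.univ)
    simp only [RCLike.re_to_complex, Complex.ofReal_re]
    linarith
  have h := (Complex.nonneg_iff.1 (nonneg_of_isPositive hφ hpos)).1
  rw [map_sub, map_sum, Complex.sub_re, Complex.re_sum] at h
  linarith

theorem apply_rankOne_self_le {φ : (H →L[ℂ] H) →ₗ[ℂ] ℂ} (hφ : ∀ a, 0 ≤ φ (star a * a)) (x : H) :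
    (φ (rankOne ℂ x x)).re ≤ (φ 1).re * ‖x‖ ^ 2 := by
  rcases eq_or_ne x 0 with rfl | hx
  · simp
  have hn : ‖x‖ ≠ 0 := norm_ne_zero_iff.2 hx
  have hv : Orthonormal ℂ (fun _ : Unit => ((‖x‖⁻¹ : ℝ) : ℂ) • x) := by
    refine ⟨fun _ => ?_, fun i j hij => absurd (Subsingleton.elim i j) hij⟩
    rw [norm_smul]
    simp [hn]
  have h := sum_apply_rankOne_le hφ hv
  simp only [Finset.univ_unique, Finset.sum_singleton] at h
  have e : rankOne ℂ x x = ((‖x‖ ^ 2 : ℝ) : ℂ) • rankOne ℂ (((‖x‖⁻¹ : ℝ) : ℂ) • x)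
      (((‖x‖⁻¹ : ℝ) : ℂ) • x) := by
    ext u
    simp only [rankOne_apply, inner_smul_left, smul_apply, smul_smul]
    congr 1
    have : (‖x‖ : ℂ) ≠ 0 := by exact_mod_cast hn
    simp
    field_simp
  rw [e, map_smul, smul_eq_mul, Complex.re_ofReal_mul, mul_comm]
  exact mul_le_mul_of_nonneg_right h (by positivity)

/-- For a unit vector `v` one has `|x⟩⟨y| = (|v⟩⟨x|)* |v⟩⟨y|`, so Cauchy–Schwarz reduces the bound
to the diagonal case. The normalization of `x` serves as `v`. -/
theorem norm_apply_rankOne_le {φ : (H →L[ℂ] H) →ₗ[ℂ] ℂ} (hφ : ∀ a, 0 ≤ φ (star a * a))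
    (x y : H) : ‖φ (rankOne ℂ x y)‖ ≤ (φ 1).re * ‖x‖ * ‖y‖ := by
  rcases eq_or_ne x 0 with rfl | hx
  · simp
  have hn : ‖x‖ ≠ 0 := norm_ne_zero_iff.2 hx
  have h1 : 0 ≤ (φ 1).re := by
    have := (Complex.nonneg_iff.1 (hφ 1)).1
    simpa using this
  set v : H := ((‖x‖⁻¹ : ℝ) : ℂ) • x with hv
  have hv1 : inner ℂ v v = (1 : ℂ) := by
    rw [inner_self_eq_norm_sq_to_K, hv, norm_smul]
    simp [hn]
  have h := norm_sq_le_of_pos hφ (rankOne ℂ v x) (rankOne ℂ v y)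
  simp only [star_rankOne, rankOne_mul_rankOne, hv1, one_smul] at h
  have h2 : ‖φ (rankOne ℂ x y)‖ ^ 2 ≤ ((φ 1).re * ‖x‖ * ‖y‖) ^ 2 := by
    refine h.trans ?_
    calc _ ≤ ((φ 1).re * ‖x‖ ^ 2) * ((φ 1).re * ‖y‖ ^ 2) := by
          refine mul_le_mul (apply_rankOne_self_le hφ x) (apply_rankOne_self_le hφ y) ?_
            (by positivity)
          exact (Complex.nonneg_iff.1
            (nonneg_of_isPositive hφ (isPositive_rankOne_self y))).1
      _ = _ := by ring
  exact le_of_sq_le_sq h2 (by positivity)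

/-- The density operator of a positive functional on `B(H)`. -/
theorem exists_density {φ : (H →L[ℂ] H) →ₗ[ℂ] ℂ} (hφ : ∀ a, 0 ≤ φ (star a * a)) :
    ∃ R : H →L[ℂ] H, R.IsPositive ∧ ∀ x y, inner ℂ (R x) y = φ (rankOne ℂ y x) := by
  -- The form `(x, y) ↦ φ (|y⟩⟨x|)` is sesquilinear and bounded, hence represented by an operator.
  -- Its trace class property is never stated; Bessel's inequality replaces it.
  let B : H →L⋆[ℂ] H →L[ℂ] ℂ := LinearMap.mkContinuous₂
    (LinearMap.mk₂'ₛₗ (starRingEnd ℂ) (RingHom.id ℂ) (fun x y => φ (rankOne ℂ y x))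
      (fun x x' y => by rw [map_add, map_add]) (fun c x y => by
        rw [map_smulₛₗ, map_smul])
      (fun x y y' => by rw [map_add, add_apply, map_add])
      (fun c x y => by rw [map_smul, smul_apply, map_smul]; rfl))
    (φ 1).re (fun x y => by
      have := norm_apply_rankOne_le hφ y x
      refine this.trans (le_of_eq ?_)
      ring)
  have hB : ∀ x y, inner ℂ (continuousLinearMapOfBilin B x) y = φ (rankOne ℂ y x) := by
    intro x y
    rw [continuousLinearMapOfBilin_apply]
    rfl
  refine ⟨continuousLinearMapOfBilin B, ?_, hB⟩
  rw [ContinuousLinearMap.isPositive_iff_complex]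
  intro x
  rw [hB]
  have := nonneg_of_isPositive hφ (isPositive_rankOne_self x)
  rw [Complex.nonneg_iff] at this
  refine ⟨?_, this.1⟩
  apply Complex.ext <;> simp [← this.2]

/-- A nonzero finite-dimensional subspace that is invariant under the commutant of the density
operator of a nonzero positive functional. -/
theorem exists_finiteDimensional_invariant {φ : (H →L[ℂ] H) →ₗ[ℂ] ℂ}
    (hφ : ∀ a, 0 ≤ φ (star a * a)) {R : H →L[ℂ] H} (hR : R.IsPositive)
    (hRφ : ∀ x y, inner ℂ (R x) y = φ (rankOne ℂ y x)) (hne : R ≠ 0) :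
    ∃ V : Submodule ℂ H, FiniteDimensional ℂ V ∧ V ≠ ⊥ ∧
      ∀ U : H →L[ℂ] H, Commute R U → ∀ x ∈ V, U x ∈ V := by
  have hsa : IsSelfAdjoint R := hR.isSelfAdjoint
  have hR0 : 0 ≤ R := (ContinuousLinearMap.nonneg_iff_isPositive R).2 hR
  have hl : 0 < ‖R‖ := norm_pos_iff.2 hne
  -- Any cut strictly between `0` and `‖R‖` would do: since `‖R‖` lies in the spectrum of `R ≥ 0`,
  -- the operator `(R - l)₊` is nonzero. Its range plays the role of a spectral subspace for large
  -- eigenvalues.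
  set l : ℝ := ‖R‖ / 2 with hldef
  have hl0 : 0 < l := half_pos hl
  let g : ℝ → ℝ := fun t => max 0 (t - l)
  have hg : Continuous g := by fun_prop
  set T : H →L[ℂ] H := cfc g R with hT
  have hTsa : IsSelfAdjoint T := cfc_predicate g R
  have hT0 : T ≠ 0 := by
    have : Nontrivial (H →L[ℂ] H) := ⟨R, 0, hne⟩
    have hmem : ‖R‖ ∈ spectrum ℝ R := CStarAlgebra.norm_mem_spectrum_of_nonneg hR0
    have hmem' : g ‖R‖ ∈ spectrum ℝ T := by
      rw [hT, cfc_map_spectrum g R]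
      exact ⟨_, hmem, rfl⟩
    intro h0
    rw [h0, spectrum.zero_eq] at hmem'
    have : g ‖R‖ = 0 := hmem'
    have h2 : 0 < g ‖R‖ := lt_max_of_lt_right (by linarith)
    linarith
  -- In the functional calculus this is `g(t)² (t - l) ≥ 0`. It says that `R ≥ l` on the range of
  -- `T`.
  have hpos : 0 ≤ T * R * T - l • (T * T) := by
    have e : T * R * T - l • (T * T) = cfc (fun t => g t * t * g t - l * (g t * g t)) R := by
      rw [cfc_sub (fun t => g t * t * g t) (fun t => l * (g t * g t)) R,
        cfc_const_mul l (fun t => g t * g t) R, cfc_mul (fun t => g t * t) g R,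
        cfc_mul g (fun t => t) R, cfc_mul g g R, cfc_id' ℝ R]
    rw [e]
    refine cfc_nonneg fun t _ => ?_
    have : g t * t * g t - l * (g t * g t) = (g t * g t) * (t - l) := by ring
    rw [this]
    rcases le_total t l with h | h
    · have : g t = 0 := max_eq_left (by linarith)
      simp [this]
    · exact mul_nonneg (mul_self_nonneg _) (by linarith)
  have hlow : ∀ y ∈ T.range, l * ‖y‖ ^ 2 ≤ (inner ℂ (R y) y : ℂ).re := by
    rintro _ ⟨x, rfl⟩
    have h := ((ContinuousLinearMap.nonneg_iff_isPositive _).1 hpos).re_inner_nonneg_left x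
    have hadj : ∀ u v, inner ℂ (T u) v = inner ℂ u (T v) := by
      intro u v
      have := ContinuousLinearMap.adjoint_inner_left T v u
      rwa [← ContinuousLinearMap.star_eq_adjoint, hTsa.star_eq] at this
    rw [sub_apply, inner_sub_left] at h
    have h1 : inner ℂ ((T * R * T) x) x = inner ℂ (R (T x)) (T x) := hadj _ _
    have h2 : inner ℂ ((l • (T * T)) x) x = ((l * ‖T x‖ ^ 2 : ℝ) : ℂ) := by
      have : (l • (T * T)) x = (l : ℂ) • T (T x) := rfl
      rw [this, inner_smul_left, hadj, inner_self_eq_norm_sq_to_K]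
      simp
    rw [h1, h2] at h
    simp only [RCLike.re_to_complex, Complex.sub_re, Complex.ofReal_re] at h
    change l * ‖T x‖ ^ 2 ≤ (inner ℂ (R (T x)) (T x) : ℂ).re
    linarith
  refine ⟨T.range, ?_, ?_, ?_⟩
  · obtain ⟨N, hN⟩ := exists_nat_ge ((φ 1).re / l)
    have hrank : Module.rank ℂ T.range ≤ N := by
      -- Orthonormalizing `s` gives orthonormal vectors in the range, each with `φ`-mass at least
      -- `l`. By Bessel there are at most `φ(1) / l` of them.
      refine rank_le fun s hs => ?_
      let W : Submodule ℂ T.range := Submodule.span ℂ (s : Set T.range)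
      let b := stdOrthonormalBasis ℂ W
      have hW : Module.finrank ℂ W = s.card := by
        exact finrank_span_finset_eq_card hs
      let v : Fin (Module.finrank ℂ W) → H := fun i => ((b i : T.range) : H)
      have hv : Orthonormal ℂ v := by
        have h1 := b.orthonormal.comp_linearIsometry W.subtypeₗᵢ
        exact h1.comp_linearIsometry (Submodule.subtypeₗᵢ T.range)
      have h := sum_apply_rankOne_le hφ hv
      have h2 : ∀ i, l ≤ (φ (rankOne ℂ (v i) (v i))).re := by
        intro i
        have := hlow (v i) (b i : T.range).2
        rw [hv.1 i, hRφ] at this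
        simpa using this
      have h3 : (s.card : ℝ) * l ≤ (φ 1).re := by
        refine le_trans ?_ h
        have := Finset.card_nsmul_le_sum Finset.univ
          (fun i => (φ (rankOne ℂ (v i) (v i))).re) l fun i _ => h2 i
        rw [Finset.card_univ, Fintype.card_fin] at this
        rw [← hW]
        simpa using this
      have h4 : (s.card : ℝ) ≤ N := ((le_div_iff₀ hl0).2 h3).trans hN
      exact_mod_cast h4
    exact Module.rank_lt_aleph0_iff.1 (hrank.trans_lt (Cardinal.natCast_lt_aleph0))
  · intro h
    refine hT0 (ContinuousLinearMap.ext fun x => ?_)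
    have : T x ∈ T.range := ⟨x, rfl⟩
    rw [h] at this
    simpa using this
  · rintro U hU _ ⟨x, rfl⟩
    refine ⟨U x, ?_⟩
    have : T * U = U * T := (hU.cfc_real g).eq
    exact congrArg (fun S : H →L[ℂ] H => S x) this

omit [CompleteSpace H] in
/-- On a minimal invariant subspace of a family of unitaries, a commuting operator compresses
to a scalar. -/
theorem exists_compression_eq {ι : Type*} {U : ι → H ≃ₗᵢ[ℂ] H} {V : Submodule ℂ H}
    [FiniteDimensional ℂ V] (hV : V ≠ ⊥) (hUV : ∀ t, ∀ x ∈ V, U t x ∈ V)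
    (hmin : ∀ W : Submodule ℂ H, W ≤ V → W ≠ ⊥ → (∀ t, ∀ x ∈ W, U t x ∈ W) → W = V)
    {R : H →L[ℂ] H} (hRU : ∀ t x, R (U t x) = U t (R x)) :
    ∃ c : ℂ, ∀ x ∈ V, ∀ y ∈ V, inner ℂ y (R x) = c * inner ℂ y x := by
  have : Nontrivial V := Submodule.nontrivial_iff_ne_bot.2 hV
  let T : V →ₗ[ℂ] V := (V.orthogonalProjectionOnto ∘L R ∘L V.subtypeL).toLinearMap
  have hT : ∀ x y : V, inner ℂ (y : H) (T x : H) = inner ℂ (y : H) (R x) := by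
    intro x y
    have := Submodule.inner_orthogonalProjectionOnto_eq_of_mem_left y (R x)
    rw [← this]
    rfl
  obtain ⟨c, hc⟩ := Module.End.exists_eigenvalue T
  obtain ⟨x₀, hx₀⟩ := hc.exists_hasEigenvector
  -- `W` is the eigenspace of the compression of `R` to `V` for an eigenvalue `c`. It is invariant
  -- under the unitaries, so minimality forces `W = V`. The operator `R` itself need not preserve
  -- `V`.
  let W : Submodule ℂ H :=
    { carrier := {x | x ∈ V ∧ ∀ y ∈ V, inner ℂ y (R x) = c * inner ℂ y x}
      zero_mem' := ⟨V.zero_mem, by simp⟩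
      add_mem' := by
        rintro a b ⟨ha, ha'⟩ ⟨hb, hb'⟩
        refine ⟨V.add_mem ha hb, fun y hy => ?_⟩
        rw [map_add, inner_add_right, inner_add_right, ha' y hy, hb' y hy, mul_add]
      smul_mem' := by
        rintro k a ⟨ha, ha'⟩
        refine ⟨V.smul_mem k ha, fun y hy => ?_⟩
        rw [map_smul, inner_smul_right, inner_smul_right, ha' y hy]
        ring }
  have hWV : W = V := by
    refine hmin W (fun x hx => hx.1) ?_ ?_
    · intro h
      have hmem : (x₀ : H) ∈ W := by
        refine ⟨x₀.2, fun y hy => ?_⟩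
        rw [← hT x₀ ⟨y, hy⟩, hx₀.apply_eq_smul]
        simp
      rw [h] at hmem
      exact hx₀.2 (Subtype.ext ((Submodule.mem_bot ℂ).1 hmem))
    · rintro t x ⟨hx, hx'⟩
      refine ⟨hUV t x hx, fun y hy => ?_⟩
      -- In finite dimension the injective `U t` maps `V` onto `V`, so every test vector has the
      -- form `U t z` with `z` in `V`. No inverse of `U t` in the family is needed.
      have hmap : V.map ((U t).toLinearEquiv : H →ₗ[ℂ] H) = V := by
        refine Submodule.eq_of_le_of_finrank_eq ?_ ?_
        · rintro _ ⟨z, hz, rfl⟩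
          exact hUV t z hz
        · exact LinearEquiv.finrank_map_eq _ _
      rw [← hmap] at hy
      obtain ⟨z, hz, rfl⟩ := hy
      have hz' := hx' z hz
      change inner ℂ (U t z) (R (U t x)) = c * inner ℂ (U t z) (U t x)
      rw [hRU, (U t).inner_map_map, (U t).inner_map_map, hz']
  refine ⟨c, fun x hx y hy => ?_⟩
  rw [← hWV] at hx
  exact hx.2 y hy

-- A nonzero invariant subspace of least dimension is minimal.
omit [CompleteSpace H] in
theorem exists_minimal_invariant {ι : Type*} {U : ι → H ≃ₗᵢ[ℂ] H}
    (h : ∃ V : Submodule ℂ H, FiniteDimensional ℂ V ∧ V ≠ ⊥ ∧ ∀ t, ∀ x ∈ V, U t x ∈ V) :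
    ∃ V : Submodule ℂ H, FiniteDimensional ℂ V ∧ V ≠ ⊥ ∧ (∀ t, ∀ x ∈ V, U t x ∈ V) ∧
      ∀ W : Submodule ℂ H, W ≤ V → W ≠ ⊥ → (∀ t, ∀ x ∈ W, U t x ∈ W) → W = V := by
  classical
  have hex : ∃ n : ℕ, ∃ V : Submodule ℂ H, FiniteDimensional ℂ V ∧ V ≠ ⊥ ∧
      (∀ t, ∀ x ∈ V, U t x ∈ V) ∧ Module.finrank ℂ V = n := by
    obtain ⟨V, h1, h2, h3⟩ := h
    exact ⟨_, V, h1, h2, h3, rfl⟩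
  obtain ⟨V, h1, h2, h3, h4⟩ := Nat.find_spec hex
  refine ⟨V, h1, h2, h3, fun W hWV hW hWU => ?_⟩
  have hWf : FiniteDimensional ℂ W := Submodule.finiteDimensional_of_le hWV
  refine Submodule.eq_of_le_of_finrank_le hWV ?_
  rw [h4]
  exact Nat.find_min' hex ⟨W, hWf, hW, hWU, rfl⟩

end BoundedOperators

/-! ### Uniqueness of normal KMS functionals on `B(H)`. -/

section BoundedOperators

open InnerProductSpace

variable {H : Type*} [NormedAddCommGroup H] [InnerProductSpace ℂ H] [CompleteSpace H]

theorem starAlgEquiv_rankOne {θ : (H →L[ℂ] H) ≃⋆ₐ[ℂ] (H →L[ℂ] H)} {U : H ≃ₗᵢ[ℂ] H}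
    (hU : θ = U.conjStarAlgEquiv) (x y : H) :
    θ (rankOne ℂ x y) = rankOne ℂ (U x) (U y) := by
  subst hU
  ext u
  rw [LinearIsometryEquiv.conjStarAlgEquiv_apply_apply, rankOne_apply, rankOne_apply, map_smul]
  congr 1
  rw [← U.inner_map_map, U.apply_symm_apply]

/-- KMS functionals at `β ≠ 0` are invariant. -/
theorem apply_flow_eq_of_kms {M : Type*} [Ring M] [StarRing M] [Algebra ℂ M] [StarModule ℂ M]
    {θ : ℝ → M ≃⋆ₐ[ℂ] M} (h0 : ∀ T, θ 0 T = T) {β : ℝ} (hβ : β ≠ 0)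
    {φ : M →ₗ[ℂ] ℂ} (hφ : ∀ a, 0 ≤ φ (star a * a))
    (hK : ∀ a b, IsStripPair β (fun t => φ (a * θ t b)) (fun t => φ (θ t b * a))) (t : ℝ) (T : M) :
    φ (θ t T) = φ T := by
  -- With `a = 1` the two boundary functions agree, and for self-adjoint `S` they are real, so the
  -- strip function is constant. General `T` follows by splitting into self-adjoint parts.
  have hs : ∀ S : M, star S = S → φ (θ t S) = φ S := by
    intro S hS
    have h := hK 1 S
    simp only [one_mul, mul_one] at h
    have := h.eq_const hβ (fun t => ?_) t
    · rwa [h0] at this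
    · have e : φ (θ t S) = starRingEnd ℂ (φ (θ t S)) := by
        rw [← map_star_of_pos hφ, ← map_star, hS]
      exact Complex.conj_eq_iff_im.1 e.symm
  have hdec : T = (1 / 2 : ℂ) • (T + star T)
      + (-Complex.I / 2) • (Complex.I • (T - star T)) := by
    rw [smul_smul]
    have : -Complex.I / 2 * Complex.I = 1 / 2 := by
      linear_combination (-1 / 2 : ℂ) * Complex.I_mul_I
    rw [this, ← smul_add]
    have : T + star T + (T - star T) = (2 : ℂ) • T := by rw [two_smul]; abel
    rw [this, smul_smul]
    norm_num
  rw [hdec]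
  simp only [map_add (θ t), map_smul (θ t), map_add φ, map_smul φ]
  have e1 := hs (T + star T) (by rw [star_add, star_star, add_comm])
  have e2 := hs (Complex.I • (T - star T)) (by
    rw [star_smul, star_sub, star_star, Complex.star_def, Complex.conj_I, neg_smul, ← smul_neg,
      neg_sub])
  simp only [map_add (θ t), map_smul (θ t), map_add φ, map_smul φ] at e1 e2
  rw [e1, e2]

/-- The products `|v⟩⟨y| · θ t (|x⟩⟨v|)` at real `t` see the densities only through their
compression to an invariant subspace containing `v`, where both are scalar. The other boundary line
then transfers the proportionality to `|x⟩⟨v| |v⟩⟨y| = |x⟩⟨y|`. -/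
theorem exists_eq_mul_of_kms {θ : ℝ → (H →L[ℂ] H) ≃⋆ₐ[ℂ] (H →L[ℂ] H)} (h0 : ∀ T, θ 0 T = T)
    {β : ℝ} {φ ψ : (H →L[ℂ] H) →ₗ[ℂ] ℂ} (hφ : ∀ a, 0 ≤ φ (star a * a))
    (hψ : ∀ a, 0 ≤ ψ (star a * a))
    (hKφ : ∀ a b, IsStripPair β (fun t => φ (a * θ t b)) (fun t => φ (θ t b * a)))
    (hKψ : ∀ a b, IsStripPair β (fun t => ψ (a * θ t b)) (fun t => ψ (θ t b * a)))
    (hne : ∃ x y, ψ (rankOne ℂ x y) ≠ 0) :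
    ∃ c : ℂ, ∀ x y, φ (rankOne ℂ x y) = c * ψ (rankOne ℂ x y) := by
  obtain ⟨x₀, y₀, hxy₀⟩ := hne
  have hx₀ : x₀ ≠ 0 := by
    rintro rfl
    simp at hxy₀
  have hunit : ∀ V : Submodule ℂ H, V ≠ ⊥ → ∃ v ∈ V, inner ℂ v v = (1 : ℂ) := by
    intro V hV
    obtain ⟨w, hw, hw0⟩ := Submodule.exists_mem_ne_zero_of_ne_bot hV
    refine ⟨((‖w‖⁻¹ : ℝ) : ℂ) • w, V.smul_mem _ hw, ?_⟩
    rw [inner_self_eq_norm_sq_to_K, norm_smul]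
    simp [norm_ne_zero_iff.2 hw0]
  rcases eq_or_ne β 0 with rfl | hβ
  · obtain ⟨v, -, hv⟩ := hunit ⊤ (fun h => hx₀ (by
      have : x₀ ∈ (⊤ : Submodule ℂ H) := trivial
      rw [h] at this
      simpa using this))
    have htr : ∀ χ : (H →L[ℂ] H) →ₗ[ℂ] ℂ,
        (∀ a b, IsStripPair 0 (fun t => χ (a * θ t b)) (fun t => χ (θ t b * a))) →
        ∀ x y, χ (rankOne ℂ x y) = χ (rankOne ℂ v v) * inner ℂ y x := by
      intro χ hχ x y
      have h := (hχ (rankOne ℂ v y) (rankOne ℂ x v)).eq_of_zero 0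
      simp only [h0, rankOne_mul_rankOne, hv, one_smul, map_smul, smul_eq_mul] at h
      rw [← h, mul_comm]
    have hd : ψ (rankOne ℂ v v) ≠ 0 := by
      intro h
      refine hxy₀ ?_
      rw [htr ψ hKψ, h, zero_mul]
    refine ⟨φ (rankOne ℂ v v) / ψ (rankOne ℂ v v), fun x y => ?_⟩
    rw [htr φ hKφ, htr ψ hKψ x y]
    field_simp
  -- it suffices to have proportional functionals `φ (x ⊗ y)` on the real axis
  suffices key : ∃ c d : ℂ, ∃ k : H → H → ℝ → ℂ, ∃ a b : H → H → (H →L[ℂ] H),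
      (∀ x y, b x y * a x y = rankOne ℂ x y) ∧
      (∀ x y t, φ (a x y * θ t (b x y)) = c * k x y t) ∧
      (∀ x y t, ψ (a x y * θ t (b x y)) = d * k x y t) by
    obtain ⟨c, d, k, a, b, hab, hφk, hψk⟩ := key
    have hz : ∀ χ : (H →L[ℂ] H) →ₗ[ℂ] ℂ,
        (∀ a b, IsStripPair β (fun t => χ (a * θ t b)) (fun t => χ (θ t b * a))) →
        ∀ x y, (∀ t, χ (a x y * θ t (b x y)) = 0) → χ (rankOne ℂ x y) = 0 := by
      intro χ hχ x y h
      have hp := hχ (a x y) (b x y)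
      simp only [h] at hp
      rw [← hab]
      have := hp.eq_zero hβ 0
      rwa [h0] at this
    -- If `d` were zero, `ψ` would vanish along the real line for all `x` and `y`, hence on all rank
    -- one operators.
    have hd : d ≠ 0 := by
      rintro rfl
      refine hxy₀ (hz ψ hKψ x₀ y₀ fun t => ?_)
      rw [hψk, zero_mul]
    refine ⟨c / d, fun x y => ?_⟩
    have h := hz (φ - (c / d) • ψ) (fun a b => ?_) x y fun t => ?_
    · simpa [sub_eq_zero] using h
    · have := (hKφ a b).add ((hKψ a b).const_mul (-(c / d)))
      simpa [sub_eq_add_neg] using this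
    · simp only [LinearMap.sub_apply, LinearMap.smul_apply, smul_eq_mul, hφk, hψk]
      field_simp
      ring
  have hcont : ∀ t, Continuous (θ t) := fun t => map_continuous (θ t)
  -- The unitaries are chosen for each `t` separately, so neither a group law nor continuity in `t`
  -- is available; neither is needed.
  choose U hU using fun t => (θ t).eq_linearIsometryEquivConjStarAlgEquiv (hcont t)
  have hUR : ∀ χ : (H →L[ℂ] H) →ₗ[ℂ] ℂ, (∀ a, 0 ≤ χ (star a * a)) →
      (∀ a b, IsStripPair β (fun t => χ (a * θ t b)) (fun t => χ (θ t b * a))) →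
      ∀ R : H →L[ℂ] H, (∀ x y, inner ℂ (R x) y = χ (rankOne ℂ y x)) →
      ∀ t x, R (U t x) = U t (R x) := by
    intro χ hχ hKχ R hR t x
    refine ext_inner_right ℂ fun y => ?_
    obtain ⟨y, rfl⟩ := (U t).surjective y
    rw [(U t).inner_map_map, hR, hR, ← starAlgEquiv_rankOne (hU t),
      apply_flow_eq_of_kms h0 hβ hχ hKχ]
  obtain ⟨R, hRpos, hR⟩ := exists_density hφ
  obtain ⟨S, hSpos, hS⟩ := exists_density hψ
  have hSne : S ≠ 0 := by
    rintro rfl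
    exact hxy₀ (by rw [← hS]; simp)
  obtain ⟨V, hVf, hV, hUV, hmin⟩ := exists_minimal_invariant (U := U) (by
    obtain ⟨V, h1, h2, h3⟩ := exists_finiteDimensional_invariant hψ hSpos hS hSne
    refine ⟨V, h1, h2, fun t x hx => ?_⟩
    refine h3 ((U t).toContinuousLinearEquiv : H →L[ℂ] H) ?_ x hx
    ext u
    exact hUR ψ hψ hKψ S hS t u)
  -- The subspace was built from the density of `ψ` alone, but it is minimal for the unitaries, and
  -- the density of `φ` commutes with the same unitaries.
  obtain ⟨c, hc⟩ := exists_compression_eq hV hUV hmin (hUR φ hφ hKφ R hR)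
  obtain ⟨d, hd⟩ := exists_compression_eq hV hUV hmin (hUR ψ hψ hKψ S hS)
  obtain ⟨v, hvV, hv⟩ := hunit V hV
  have hcomp : ∀ χ : (H →L[ℂ] H) →ₗ[ℂ] ℂ, ∀ R : H →L[ℂ] H, R.IsPositive →
      (∀ x y, inner ℂ (R x) y = χ (rankOne ℂ y x)) →
      ∀ c : ℂ, (∀ x ∈ V, ∀ y ∈ V, inner ℂ y (R x) = c * inner ℂ y x) →
      ∀ x y t, χ (rankOne ℂ v y * θ t (rankOne ℂ x v))
        = c * (inner ℂ y (U t x) * inner ℂ (U t v) v) := by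
    intro χ R hRp hR c hc x y t
    rw [starAlgEquiv_rankOne (hU t), rankOne_mul_rankOne, map_smul, smul_eq_mul, ← hR,
      hRp.inner_left_eq_inner_right, hc v hvV _ (hUV t v hvV)]
    ring
  refine ⟨c, d, fun x y t => inner ℂ y (U t x) * inner ℂ (U t v) v,
    fun x y => rankOne ℂ v y, fun x y => rankOne ℂ x v, fun x y => ?_,
    hcomp φ R hRpos hR c hc, hcomp ψ S hSpos hS d hd⟩
  rw [rankOne_mul_rankOne, hv, one_smul]

/-- Normal KMS functionals on `B(H)` are unique up to a factor. -/
theorem eq_mul_of_kms {θ : ℝ → (H →L[ℂ] H) ≃⋆ₐ[ℂ] (H →L[ℂ] H)} (h0 : ∀ T, θ 0 T = T)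
    {β : ℝ} {φ ψ : (H →L[ℂ] H) →ₗ[ℂ] ℂ} (hφ : ∀ a, 0 ≤ φ (star a * a))
    (hψ : ∀ a, 0 ≤ ψ (star a * a))
    (hKφ : ∀ a b, IsStripPair β (fun t => φ (a * θ t b)) (fun t => φ (θ t b * a)))
    (hKψ : ∀ a b, IsStripPair β (fun t => ψ (a * θ t b)) (fun t => ψ (θ t b * a)))
    {ι : Type*} {b : ι → H} (hb : Orthonormal ℂ b)
    (hNφ : HasSum (fun i => φ (rankOne ℂ (b i) (b i))) (φ 1))
    (hNψ : HasSum (fun i => ψ (rankOne ℂ (b i) (b i))) (ψ 1)) (hψ1 : ψ 1 = 1) (T : H →L[ℂ] H) :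
    φ T = φ 1 * ψ T := by
  -- Normality enters only here: additivity on one family of rank one projections expresses `χ`
  -- through its values on rank one operators.
  have hsum : ∀ χ : (H →L[ℂ] H) →ₗ[ℂ] ℂ, (∀ a, 0 ≤ χ (star a * a)) →
      HasSum (fun i => χ (rankOne ℂ (b i) (b i))) (χ 1) → ∀ T,
      HasSum (fun i => χ (rankOne ℂ (T (b i)) (b i))) (χ T) := by
    intro χ hχ hN T
    have := hasSum_mul_of_hasSum hχ (fun i => star_rankOne (b i) (b i)) (fun i => ?_)
      (fun i j hij => ?_) hN T
    · convert this using 2 with i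
      rw [ContinuousLinearMap.mul_def, comp_rankOne]
    · rw [rankOne_mul_rankOne, inner_self_eq_norm_sq_to_K, hb.1 i]; simp
    · rw [rankOne_mul_rankOne, hb.2 hij, zero_smul]
  obtain ⟨c, hc⟩ := exists_eq_mul_of_kms h0 hφ hψ hKφ hKψ (by
    by_contra! h
    have h1 := hsum ψ hψ hNψ 1
    simp only [h] at h1
    have := h1.unique hasSum_zero
    rw [hψ1] at this
    exact one_ne_zero this)
  have hT : ∀ T, φ T = c * ψ T := by
    intro T
    have h1 := hsum φ hφ hNφ T
    simp only [hc] at h1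
    exact h1.unique ((hsum ψ hψ hNψ T).mul_left c)
  rw [hT 1, hψ1, mul_one, hT]

end BoundedOperators

/-! ### Scott continuous positive functionals -/

section Scott

variable {M : Type*} [AddCommGroup M] [PartialOrder M] [IsOrderedAddMonoid M] [Module ℂ M]

theorem apply_mono_of_pos {φ : M →ₗ[ℂ] ℂ} (hφ : ∀ a, 0 ≤ a → 0 ≤ φ a) {a b : M} (h : a ≤ b) :
    φ a ≤ φ b := by
  have := hφ _ (sub_nonneg.2 h)
  rwa [map_sub, sub_nonneg] at this

/-- In the order of `ℂ` comparable numbers have equal imaginary parts. A positive functional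
therefore preserves a directed supremum exactly when the real deficits `φ (a - x)` become
arbitrarily small. This form is stable under sums and norm limits. -/
theorem scottContinuous_iff_of_pos {φ : M →ₗ[ℂ] ℂ} (hφ : ∀ a, 0 ≤ a → 0 ≤ φ a) :
    ScottContinuous φ ↔ ∀ d : Set M, d.Nonempty → DirectedOn (· ≤ ·) d → ∀ a, IsLUB d a →
      ∀ ε > 0, ∃ x ∈ d, (φ (a - x)).re ≤ ε := by
  constructor
  · intro h d hd hdir a ha ε hε
    by_contra! hc
    have hlub := h hd hdir ha
    have hub : φ a - (ε : ℂ) ∈ upperBounds (φ '' d) := by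
      rintro _ ⟨x, hx, rfl⟩
      have h1 := hc x hx
      have h2 := (Complex.nonneg_iff.1 (hφ _ (sub_nonneg.2 (ha.1 hx)))).2
      rw [map_sub] at h1 h2
      rw [Complex.le_def]
      simp only [Complex.sub_re, Complex.sub_im, Complex.ofReal_re, Complex.ofReal_im] at h1 h2 ⊢
      exact ⟨by linarith, by linarith⟩
    have := (Complex.le_def.1 (hlub.2 hub)).1
    simp only [Complex.sub_re, Complex.ofReal_re] at this
    linarith
  · intro h d hd hdir a ha
    refine ⟨?_, fun u hu => ?_⟩
    · rintro _ ⟨x, hx, rfl⟩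
      exact apply_mono_of_pos hφ (ha.1 hx)
    · have hx : ∀ x ∈ d, (φ x).re ≤ u.re ∧ u.im = (φ a).im := by
        intro x hx
        have h1 := Complex.le_def.1 (hu ⟨x, hx, rfl⟩)
        have h2 := Complex.le_def.1 (apply_mono_of_pos hφ (ha.1 hx))
        exact ⟨h1.1, h1.2.symm.trans h2.2⟩
      obtain ⟨x₀, hx₀⟩ := hd
      rw [Complex.le_def]
      refine ⟨?_, (hx x₀ hx₀).2.symm⟩
      refine le_of_forall_pos_le_add fun ε hε => ?_
      obtain ⟨x, hxd, hxε⟩ := h d ⟨x₀, hx₀⟩ hdir a ha ε hε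
      rw [map_sub, Complex.sub_re] at hxε
      linarith [(hx x hxd).1]

theorem ScottContinuous.add_smul_of_pos {φ ψ : M →ₗ[ℂ] ℂ} (hφ : ∀ a, 0 ≤ a → 0 ≤ φ a)
    (hψ : ∀ a, 0 ≤ a → 0 ≤ ψ a) (h : ScottContinuous φ) (h' : ScottContinuous ψ)
    {s t : ℝ} (hs : 0 ≤ s) (ht : 0 ≤ t) :
    ScottContinuous ((s : ℂ) • φ + (t : ℂ) • ψ : M →ₗ[ℂ] ℂ) := by
  have hpos : ∀ a, 0 ≤ a → 0 ≤ ((s : ℂ) • φ + (t : ℂ) • ψ : M →ₗ[ℂ] ℂ) a := by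
    intro a ha
    simp only [LinearMap.add_apply, LinearMap.smul_apply, smul_eq_mul]
    exact add_nonneg (mul_nonneg (by exact_mod_cast hs) (hφ a ha))
      (mul_nonneg (by exact_mod_cast ht) (hψ a ha))
  rw [scottContinuous_iff_of_pos hpos]
  rw [scottContinuous_iff_of_pos hφ] at h
  rw [scottContinuous_iff_of_pos hψ] at h'
  intro d hd hdir a ha ε hε
  have hc : 0 < s + t + 1 := by positivity
  obtain ⟨x, hx, hxε⟩ := h d hd hdir a ha (ε / (s + t + 1)) (by positivity)
  obtain ⟨y, hy, hyε⟩ := h' d hd hdir a ha (ε / (s + t + 1)) (by positivity)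
  obtain ⟨w, hw, hxw, hyw⟩ := hdir x hx y hy
  refine ⟨w, hw, ?_⟩
  have h1 := (Complex.le_def.1 (apply_mono_of_pos hφ (sub_le_sub_left hxw a))).1
  have h2 := (Complex.le_def.1 (apply_mono_of_pos hψ (sub_le_sub_left hyw a))).1
  simp only [LinearMap.add_apply, LinearMap.smul_apply, smul_eq_mul, Complex.add_re,
    Complex.re_ofReal_mul]
  have h3 := mul_le_mul_of_nonneg_left (h1.trans hxε) hs
  have h4 := mul_le_mul_of_nonneg_left (h2.trans hyε) ht
  have h5 : s * (ε / (s + t + 1)) + t * (ε / (s + t + 1)) ≤ ε := by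
    rw [← add_mul, ← mul_div_assoc, div_le_iff₀ hc]
    nlinarith
  linarith

theorem ScottContinuous.sum_smul_of_pos {ι : Type*} (s : Finset ι) {φ : ι → M →ₗ[ℂ] ℂ}
    (hφ : ∀ i, ∀ a, 0 ≤ a → 0 ≤ φ i a) (h : ∀ i, ScottContinuous (φ i)) {r : ι → ℝ}
    (hr : ∀ i, 0 ≤ r i) :
    (∀ a, 0 ≤ a → 0 ≤ (∑ i ∈ s, ((r i : ℝ) : ℂ) • φ i : M →ₗ[ℂ] ℂ) a) ∧
      ScottContinuous (∑ i ∈ s, ((r i : ℝ) : ℂ) • φ i : M →ₗ[ℂ] ℂ) := by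
  classical
  induction s using Finset.induction_on with
  | empty =>
    have h0 : ∀ a : M, 0 ≤ a → 0 ≤ (0 : M →ₗ[ℂ] ℂ) a := fun a _ => le_refl _
    simp only [Finset.sum_empty]
    refine ⟨h0, (scottContinuous_iff_of_pos h0).2 fun d hd _ a _ ε hε => ?_⟩
    obtain ⟨x, hx⟩ := hd
    exact ⟨x, hx, by simpa using hε.le⟩
  | insert i s hi ih =>
    simp only [Finset.sum_insert hi]
    constructor
    · intro a ha
      rw [LinearMap.add_apply, LinearMap.smul_apply, smul_eq_mul]
      exact add_nonneg (mul_nonneg (by exact_mod_cast hr i) (hφ i a ha)) (ih.1 a ha)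
    · have := (h i).add_smul_of_pos (hφ i) ih.1 ih.2 (hr i) zero_le_one
      simpa using this

/-- Scott continuous positive functionals are completely additive. -/
theorem ScottContinuous.hasSum_of_isLUB {φ : M →ₗ[ℂ] ℂ} (hφ : ∀ a, 0 ≤ a → 0 ≤ φ a)
    (h : ScottContinuous φ) {ι : Type*} {p : ι → M} (hp : ∀ i, 0 ≤ p i) {a : M}
    (ha : IsLUB (Set.range fun s : Finset ι => ∑ i ∈ s, p i) a) :
    HasSum (fun i => φ (p i)) (φ a) := by
  classical
  have hmono : Monotone fun s : Finset ι => ∑ i ∈ s, p i :=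
    fun s t hst => Finset.sum_le_sum_of_subset_of_nonneg hst fun i _ _ => hp i
  rw [HasSum, SummationFilter.unconditional_filter, Metric.tendsto_atTop]
  intro ε hε
  obtain ⟨_, ⟨s, rfl⟩, hs⟩ := (scottContinuous_iff_of_pos hφ).1 h _ (Set.range_nonempty _)
    (Monotone.directed_le hmono |>.directedOn_range) a ha (ε / 2) (half_pos hε)
  refine ⟨s, fun t hst => ?_⟩
  have hpos := hφ _ (sub_nonneg.2 (ha.1 ⟨t, rfl⟩))
  have h1 := (Complex.le_def.1 (apply_mono_of_pos hφ (sub_le_sub_left (hmono hst) a))).1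
  rw [dist_comm, dist_eq_norm, ← map_sum, ← map_sub]
  simp only at hpos h1 hs
  have e : ‖φ (a - ∑ i ∈ t, p i)‖ = (φ (a - ∑ i ∈ t, p i)).re := by
    rw [Complex.nonneg_iff] at hpos
    have : φ (a - ∑ i ∈ t, p i) = ((φ (a - ∑ i ∈ t, p i)).re : ℂ) :=
      Complex.ext rfl (by simpa using hpos.2.symm)
    rw [this, Complex.norm_real, Complex.ofReal_re, Real.norm_of_nonneg hpos.1]
  rw [e]
  linarith

end Scott

/-! ### The structure of atomic `W*`-algebras -/

/-- The product is a central projection below `z`, so minimality decides. -/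
theorem IsMinimalCentralProjection.mul_eq_zero_or_eq {M : Type*} [Ring M] [StarRing M] {z u : M}
    (hz : IsMinimalCentralProjection z) (hu : IsCentralProjection u) : z * u = 0 ∨ z * u = z := by
  have hcz := Semigroup.mem_center_iff.1 hz.1.2
  have hcu := Semigroup.mem_center_iff.1 hu.2
  refine hz.2.2 _ ⟨⟨?_, ?_⟩, Set.mul_mem_center hz.1.2 hu.2⟩ ?_
  · change z * u * (z * u) = z * u
    rw [mul_assoc, ← mul_assoc u z u, ← hcu z, mul_assoc z u u, hu.1.isIdempotentElem.eq,
      ← mul_assoc, hz.1.1.isIdempotentElem.eq]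
  · change star (z * u) = z * u
    rw [star_mul, hz.1.1.isSelfAdjoint.star_eq, hu.1.isSelfAdjoint.star_eq, hcu]
  · rw [mul_assoc, ← hcu, ← mul_assoc, hz.1.1.isIdempotentElem.eq]

theorem IsMinimalCentralProjection.mul_eq_zero {M : Type*} [Ring M] [StarRing M] {z u : M}
    (hz : IsMinimalCentralProjection z) (hu : IsMinimalCentralProjection u) (h : z ≠ u) :
    z * u = 0 := by
  rcases hz.mul_eq_zero_or_eq hu.1 with h1 | h1
  · exact h1
  rcases hu.mul_eq_zero_or_eq hz.1 with h2 | h2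
  · rw [Semigroup.mem_center_iff.1 hu.1.2, h2]
  · rw [Semigroup.mem_center_iff.1 hz.1.2, h1] at h2
    exact absurd h2 h

/-! ### Components, blocks, and the comparison of the order of `A` with that of the components. -/

section Blocks

open InnerProductSpace

variable {A : Type*} [CStarAlgebra A]
variable {S : StarSubalgebra ℂ A} {I : Type*} {H : I → Type*} [∀ i, NormedAddCommGroup (H i)]
variable [∀ i, InnerProductSpace ℂ (H i)] [∀ i, CompleteSpace (H i)]

/-- An identification of a star algebra with the bounded families of operators in the algebras
`B(H i)`. -/
structure BlockDecomposition (S : Type*) [Ring S] [StarRing S] [Algebra ℂ S] {I : Type*}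
    (H : I → Type*) [∀ i, NormedAddCommGroup (H i)] [∀ i, InnerProductSpace ℂ (H i)]
    [∀ i, CompleteSpace (H i)] where
  /-- The components of an element. -/
  comp : ∀ i, S →⋆ₐ[ℂ] (H i →L[ℂ] H i)
  ext : ∀ a b, (∀ i, comp i a = comp i b) → a = b
  bdd : ∀ a, ∃ C : ℝ, ∀ i, ‖comp i a‖ ≤ C
  surj : ∀ T : ∀ i, H i →L[ℂ] H i, (∃ C : ℝ, ∀ i, ‖T i‖ ≤ C) → ∃ a, ∀ i, comp i a = T i

/-- The block decomposition of an algebra that is isomorphic to an `ℓ^∞`-direct sum. -/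
def BlockDecomposition.ofEquiv [∀ i, Nontrivial (H i)] {S : Type*} [Ring S] [StarRing S]
    [Algebra ℂ S] (e : S ≃⋆ₐ[ℂ] lp (fun i => H i →L[ℂ] H i) ⊤) :
    BlockDecomposition S H where
  comp i :=
    { toFun := fun a => (e a : ∀ i, H i →L[ℂ] H i) i
      map_one' := by rw [map_one, lp.infty_coeFn_one]; rfl
      map_mul' := fun a b => by rw [map_mul, lp.infty_coeFn_mul]; rfl
      map_zero' := by rw [map_zero, lp.coeFn_zero]; rfl
      map_add' := fun a b => by rw [map_add, lp.coeFn_add]; rfl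
      commutes' := fun c => by
        have h := congrFun (congrArg Subtype.val (e.map_smul' c 1)) i
        have h1 : ((e 1 : lp (fun i => H i →L[ℂ] H i) ⊤) : ∀ i, H i →L[ℂ] H i) i = 1 := by
          rw [map_one, lp.infty_coeFn_one]; rfl
        rw [Algebra.algebraMap_eq_smul_one, Algebra.algebraMap_eq_smul_one, ← h1]
        exact h
      map_star' := fun a => by rw [map_star, lp.coeFn_star]; rfl }
  ext a b h := e.injective (lp.ext (funext h))
  bdd a := by
    obtain ⟨C, hC⟩ := memℓp_infty_iff.1 (lp.memℓp (e a))
    exact ⟨C, fun i => hC ⟨i, rfl⟩⟩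
  surj T := by
    rintro ⟨C, hC⟩
    have hmem : Memℓp T ⊤ := memℓp_infty ⟨C, by rintro _ ⟨i, rfl⟩; exact hC i⟩
    exact ⟨e.symm ⟨T, hmem⟩, fun i =>
      congrFun (congrArg Subtype.val (e.apply_symm_apply ⟨T, hmem⟩)) i⟩

variable (e : BlockDecomposition S H) [DecidableEq I]

theorem BlockDecomposition.exists_single (i : I) (T : H i →L[ℂ] H i) :
    ∃ a, ∀ j, e.comp j a = (Pi.single i T : ∀ i, H i →L[ℂ] H i) j := by
  refine e.surj _ ⟨‖T‖, fun j => ?_⟩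
  by_cases h : j = i
  · subst h; simp
  · simp [h]

/-- The element with a single nonzero component. -/
def blockSingle (i : I) (T : H i →L[ℂ] H i) : S := (e.exists_single i T).choose

theorem blockComp_blockSingle (i j : I) (T : H i →L[ℂ] H i) :
    e.comp j (blockSingle e i T) = (Pi.single i T : ∀ i, H i →L[ℂ] H i) j :=
  (e.exists_single i T).choose_spec j

/-- The inclusion of a block. -/
def blockEmb (i : I) : (H i →L[ℂ] H i) →⋆ₙₐ[ℂ] S where
  toFun T := blockSingle e i T
  map_smul' c T := by
    refine e.ext _ _ fun j => ?_
    simp only [map_smul, blockComp_blockSingle, MonoidHom.id_apply]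
    by_cases h : j = i
    · subst h; simp
    · simp [h]
  map_zero' := by
    refine e.ext _ _ fun j => ?_
    simp only [map_zero, blockComp_blockSingle, Pi.single_zero]; rfl
  map_add' T R := by
    refine e.ext _ _ fun j => ?_
    simp only [map_add, blockComp_blockSingle, Pi.single_add]; rfl
  map_mul' T R := by
    refine e.ext _ _ fun j => ?_
    simp only [map_mul, blockComp_blockSingle]
    by_cases h : j = i
    · subst h; simp
    · simp [h]
  map_star' T := by
    refine e.ext _ _ fun j => ?_
    simp only [map_star, blockComp_blockSingle]
    by_cases h : j = i
    · subst h; simp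
    · simp [h]

theorem blockComp_blockEmb_self (i : I) (T : H i →L[ℂ] H i) :
    e.comp i (blockEmb e i T) = T :=
  (blockComp_blockSingle e i i T).trans (Pi.single_eq_same _ _)

theorem blockComp_blockEmb_ne {i j : I} (h : j ≠ i) (T : H i →L[ℂ] H i) :
    e.comp j (blockEmb e i T) = 0 :=
  (blockComp_blockSingle e i j T).trans (Pi.single_eq_of_ne h _)

theorem blockEmb_one_mul (i : I) (a : S) :
    blockEmb e i 1 * a = blockEmb e i (e.comp i a) := by
  refine e.ext _ _ fun j => ?_
  rw [map_mul]
  by_cases h : j = i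
  · subst h; simp [blockComp_blockEmb_self]
  · simp [blockComp_blockEmb_ne e h]

theorem isCentralProjection_blockEmb_one (i : I) : IsCentralProjection (blockEmb e i 1) := by
  refine ⟨⟨?_, ?_⟩, ?_⟩
  · change blockEmb e i 1 * blockEmb e i 1 = _
    rw [← map_mul, one_mul]
  · change star (blockEmb e i 1) = _
    rw [← map_star, star_one]
  · rw [Semigroup.mem_center_iff]
    intro a
    refine e.ext _ _ fun j => ?_
    rw [map_mul, map_mul]
    by_cases h : j = i
    · subst h; simp [blockComp_blockEmb_self]
    · simp [blockComp_blockEmb_ne e h]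

/-- A minimal projection meeting the block lies below its unit. Its component there is central in
`B(H i)`, hence a scalar, and the scalar must be `1`. -/
theorem IsMinimalCentralProjection.eq_blockEmb_one {z : S} (hz : IsMinimalCentralProjection z)
    {i : I} (h : z * blockEmb e i 1 ≠ 0) : z = blockEmb e i 1 := by
  have h1 := (hz.mul_eq_zero_or_eq (isCentralProjection_blockEmb_one e i)).resolve_left h
  have hc := Semigroup.mem_center_iff.1 hz.1.2
  have h2 : blockEmb e i (e.comp i z) = z := by
    rw [← blockEmb_one_mul, hc, h1]
  obtain ⟨c, hcz⟩ := exists_eq_smul_one_of_commute (e.comp i z) fun R => by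
    have := congrArg (e.comp i) (hc (blockEmb e i R))
    simpa only [map_mul, blockComp_blockEmb_self] using this
  rw [hcz, map_smul] at h2
  have h3 : c • z = z := by
    conv_lhs => rw [← h1]
    rw [← mul_smul_comm, h2, hz.1.1.isIdempotentElem.eq]
  have hc1 : c = 1 := by
    have : (c - 1) • z = 0 := by rw [sub_smul, h3, one_smul, sub_self]
    rcases smul_eq_zero.1 this with h | h
    · exact sub_eq_zero.1 h
    · exact absurd h hz.2.1
  rw [← h2, hc1, one_smul]

theorem IsMinimalCentralProjection.exists_eq_blockEmb_one {z : S}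
    (hz : IsMinimalCentralProjection z) : ∃ i, z = blockEmb e i 1 := by
  have : ∃ i, z * blockEmb e i 1 ≠ 0 := by
    by_contra! h
    refine hz.2.1 (e.ext _ _ fun i => ?_)
    have := congrArg (e.comp i) (h i)
    simpa only [map_mul, blockComp_blockEmb_self, mul_one] using this
  obtain ⟨i, hi⟩ := this
  exact ⟨i, hz.eq_blockEmb_one e hi⟩

theorem blockEmb_one_ne_zero [∀ i, Nontrivial (H i)] (i : I) : blockEmb e i 1 ≠ 0 := by
  intro h
  have := congrArg (e.comp i) h
  rw [blockComp_blockEmb_self, map_zero] at this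
  exact one_ne_zero this

/-- A minimal projection that meets the block equals the block unit. If the unit were not minimal,
all minimal projections would annihilate it; but they separate points. -/
theorem isMinimalCentralProjection_blockEmb_one [∀ i, Nontrivial (H i)] (hS : IsAtomicWStar S)
    (i : I) : IsMinimalCentralProjection (blockEmb e i 1) := by
  by_contra h
  refine blockEmb_one_ne_zero e i (hS.center_structure.2.1 _ fun z hz => ?_)
  by_contra h'
  rw [hz.eq_blockEmb_one e h'] at hz
  exact h hz

variable [PartialOrder A] [StarOrderedRing A]

theorem star_mul_self_nonneg' (a : S) : 0 ≤ star a * a :=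
  show (0 : A) ≤ star (a : A) * (a : A) from star_mul_self_nonneg _

theorem blockEmb_nonneg (i : I) {T : H i →L[ℂ] H i} (hT : 0 ≤ T) : 0 ≤ blockEmb e i T := by
  obtain ⟨R, rfl⟩ := CStarAlgebra.nonneg_iff_eq_star_mul_self.1 hT
  rw [map_mul, map_star]
  exact star_mul_self_nonneg' _

-- The square roots of the components are uniformly bounded, so they assemble to an element of `S`
-- whose square is `a`.
omit [DecidableEq I] in
theorem nonneg_of_blockComp_nonneg {a : S} (h : ∀ i, 0 ≤ e.comp i a) : 0 ≤ a := by
  choose R hR using fun i => CStarAlgebra.nonneg_iff_eq_star_mul_self.1 (h i)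
  obtain ⟨C, hC⟩ := e.bdd a
  obtain ⟨b, hb⟩ := e.surj R ⟨Real.sqrt C, fun i => by
    refine Real.le_sqrt_of_sq_le ?_
    rw [sq, ← CStarRing.norm_star_mul_self, ← hR]
    exact hC i⟩
  have : a = star b * b := e.ext _ _ fun i => by rw [map_mul, map_star, hR, hb]
  rw [this]
  exact star_mul_self_nonneg' _

/-- The positive square root of `a` in `A` is not known to lie in `S`, so positivity is tested by
compression: for the rank one element `p` at `x` one has `p a p = ⟨a x, x⟩ p`, which is positive in
`A`, and `p` is positive and nonzero. -/
theorem blockComp_nonneg {a : S} (ha : 0 ≤ a) (i : I) : 0 ≤ e.comp i a := by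
  rw [ContinuousLinearMap.nonneg_iff_isPositive, ContinuousLinearMap.isPositive_iff_complex]
  intro x
  rcases eq_or_ne x 0 with rfl | hx
  · simp
  set p : S := blockEmb e i (rankOne ℂ x x) with hp
  set c : ℂ := inner ℂ (e.comp i a x) x with hc
  have hp0 : 0 ≤ p :=
    blockEmb_nonneg e i
      ((ContinuousLinearMap.nonneg_iff_isPositive _).2 (isPositive_rankOne_self x))
  have hpne : p ≠ 0 := by
    intro h
    have := congrArg (e.comp i) h
    rw [blockComp_blockEmb_self, map_zero] at this
    exact rankOne_ne_zero hx hx this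
  have hstar : star p = p := by rw [hp, ← map_star, star_rankOne]
  have hpap : p * star a * p = c • p := by
    refine e.ext _ _ fun j => ?_
    rw [map_mul, map_mul, map_smul]
    by_cases h : j = i
    · subst h
      rw [hp, blockComp_blockEmb_self, map_star]
      ext y
      have : inner ℂ x ((star (e.comp j a)) x) = c := by
        rw [ContinuousLinearMap.star_eq_adjoint, ContinuousLinearMap.adjoint_inner_right]
      rw [mul_assoc]
      change inner ℂ x (star (e.comp j a) (inner ℂ x y • x)) • x = c • inner ℂ x y • x
      rw [map_smul, inner_smul_right, this, smul_smul, mul_comm]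
    · rw [hp, blockComp_blockEmb_ne e h]; simp
  have hsa : star a = a := by
    refine Subtype.ext ?_
    exact (IsSelfAdjoint.of_nonneg (show (0 : A) ≤ (a : A) from ha)).star_eq
  have hcp : 0 ≤ c • p := by
    rw [← hpap, hsa]
    have h := star_left_conjugate_nonneg (show (0 : A) ≤ (a : A) from ha) (p : A)
    have h' : star (p : A) = (p : A) := congrArg Subtype.val hstar
    rw [h'] at h
    exact h
  have hcr : starRingEnd ℂ c = c := by
    have h1 : star (c • p) = c • p := by
      refine Subtype.ext ?_
      exact (IsSelfAdjoint.of_nonneg (show (0 : A) ≤ ((c • p : S) : A) from hcp)).star_eq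
    rw [star_smul, hstar] at h1
    have h2 : (star c - c) • p = 0 := by rw [sub_smul, h1, sub_self]
    exact sub_eq_zero.1 ((smul_eq_zero.1 h2).resolve_right hpne)
  have hce : ((c.re : ℝ) : ℂ) = c := Complex.conj_eq_iff_re.1 hcr
  refine ⟨hce, ?_⟩
  by_contra! hneg
  have h1 : (0 : A) ≤ ((-c.re : ℝ) : ℝ) • (p : A) :=
    smul_nonneg (by
      simp only [RCLike.re_to_complex] at hneg
      linarith) hp0
  have h2 : (0 : A) ≤ c.re • (p : A) := by
    have : c.re • (p : A) = ((c • p : S) : A) := by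
      conv_rhs => rw [← hce]
      exact (Complex.coe_smul c.re (p : A)).symm
    rw [this]
    exact hcp
  rw [neg_smul, Left.nonneg_neg_iff] at h1
  have h3 := le_antisymm h1 h2
  rcases smul_eq_zero.1 h3 with h | h
  · simp only [RCLike.re_to_complex] at hneg
    change c.re < 0 at hneg
    linarith
  · exact hpne (Subtype.ext h)

end Blocks

/-! ### Projections summing to a unit, and uniqueness of KMS functionals on a block. -/

section Blocks

open InnerProductSpace

variable {A : Type*} [CStarAlgebra A] [PartialOrder A] [StarOrderedRing A]
variable {S : StarSubalgebra ℂ A}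

theorem IsAtomicWStar.exists_decomposition {M : Type*} [Ring M] [StarRing M] [Algebra ℂ M]
    (hM : IsAtomicWStar M) : ∃ (I : Type) (H : I → Type) (_ : ∀ i, NormedAddCommGroup (H i))
    (_ : ∀ i, InnerProductSpace ℂ (H i)) (_ : ∀ i, CompleteSpace (H i))
    (_ : ∀ i, Nontrivial (H i)), Nonempty (BlockDecomposition M H) := by
  obtain ⟨I, _, H, h1, h2, h3, h4, _, ⟨e⟩⟩ := hM
  exact ⟨I, H, h1, h2, h3, h4, ⟨BlockDecomposition.ofEquiv e⟩⟩

/-- The minimal central projections of an atomic `W*`-algebra sum to the unit. -/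
theorem IsAtomicWStar.isLUB_one (hS : IsAtomicWStar S) :
    IsLUB (Set.range fun s : Finset {z : S // IsMinimalCentralProjection z} => ∑ z ∈ s, (z : S))
      1 := by
  classical
  obtain ⟨I, H, _, _, _, _, ⟨e⟩⟩ := hS.exists_decomposition
  refine ⟨?_, fun b hb => ?_⟩
  · rintro _ ⟨s, rfl⟩
    rw [← sub_nonneg, ← star_one_sub_sum_mul_self
      (p := fun z : {z : S // IsMinimalCentralProjection z} => (z : S))
      (fun z => z.2.1.1.isSelfAdjoint.star_eq) (fun z => z.2.1.1.isIdempotentElem.eq)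
      (fun z u h => z.2.mul_eq_zero u.2 fun h' => h (Subtype.ext h'))]
    exact star_mul_self_nonneg' _
  · rw [← sub_nonneg]
    refine nonneg_of_blockComp_nonneg e fun i => ?_
    -- An upper bound dominates each single block unit, hence dominates `1` in every component.
    have h := hb ⟨{⟨_, isMinimalCentralProjection_blockEmb_one e hS i⟩}, rfl⟩
    simp only [Finset.sum_singleton] at h
    have h' := blockComp_nonneg e (sub_nonneg.2 h) i
    rwa [map_sub, blockComp_blockEmb_self, ← map_one (e.comp i), ← map_sub] at h'

theorem isLUB_blockEmb_one {I : Type*} {H : I → Type*} [∀ i, NormedAddCommGroup (H i)]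
    [∀ i, InnerProductSpace ℂ (H i)] [∀ i, CompleteSpace (H i)] [DecidableEq I]
    (e : BlockDecomposition S H) (i : I) {ι : Type*} (b : HilbertBasis ι ℂ (H i)) :
    IsLUB (Set.range fun s : Finset ι => ∑ k ∈ s, blockEmb e i (rankOne ℂ (b k) (b k)))
      (blockEmb e i 1) := by
  have hb := b.orthonormal
  refine ⟨?_, fun c hc => ?_⟩
  · rintro _ ⟨s, rfl⟩
    rw [← sub_nonneg]
    simp only
    rw [← map_sum, ← map_sub, ← star_one_sub_sum_mul_self (fun k => star_rankOne (b k) (b k)),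
      map_mul,
      map_star]
    · exact star_mul_self_nonneg' _
    · intro k
      rw [rankOne_mul_rankOne, inner_self_eq_norm_sq_to_K, hb.1 k]; simp
    · intro k l hkl
      rw [rankOne_mul_rankOne, hb.2 hkl, zero_smul]
  · rw [← sub_nonneg]
    refine nonneg_of_blockComp_nonneg e fun j => ?_
    by_cases hj : j = i
    · subst hj
      rw [map_sub, blockComp_blockEmb_self, ContinuousLinearMap.nonneg_iff_isPositive,
        ContinuousLinearMap.isPositive_iff_complex]
      intro x
      have hs : ∀ s : Finset ι,
          0 ≤ inner ℂ ((e.comp j c) x) x - ∑ k ∈ s, inner ℂ x (b k) * inner ℂ (b k) x := by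
        intro s
        have h := blockComp_nonneg e (sub_nonneg.2 (hc ⟨s, rfl⟩)) j
        simp only [map_sub, map_sum, blockComp_blockEmb_self] at h
        rw [ContinuousLinearMap.nonneg_iff_isPositive] at h
        have h1 := h.inner_nonneg_left x
        rw [sub_apply, inner_sub_left, sum_apply, sum_inner] at h1
        simpa only [rankOne_apply, inner_smul_left, inner_conj_symm] using h1
      have hlim := (tendsto_const_nhds (x := inner ℂ ((e.comp j c) x) x)).sub
        (b.hasSum_inner_mul_inner x x)
      have h0 : 0 ≤ inner ℂ ((e.comp j c) x) x - inner ℂ x x :=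
        ge_of_tendsto' hlim hs
      have he : inner ℂ ((e.comp j c - 1) x) x = inner ℂ ((e.comp j c) x) x - inner ℂ x x := by
        rw [sub_apply, inner_sub_left]; rfl
      rw [he]
      rw [Complex.nonneg_iff] at h0
      exact ⟨Complex.ext rfl h0.2, h0.1⟩
    -- Outside block `i` only `c ≥ 0` is needed, which is the case of the empty sum.
    · have h := blockComp_nonneg e (sub_nonneg.2 (hc ⟨∅, rfl⟩)) j
      rw [map_sub, blockComp_blockEmb_ne e hj]
      simpa using h

/-- The block of a minimal central projection is a copy of some `B(H)`. -/
theorem IsAtomicWStar.exists_block (hS : IsAtomicWStar S) {z : S}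
    (hz : IsMinimalCentralProjection z) :
    ∃ (H : Type) (_ : NormedAddCommGroup H) (_ : InnerProductSpace ℂ H) (_ : CompleteSpace H)
      (j : (H →L[ℂ] H) →⋆ₙₐ[ℂ] S) (π : S →⋆ₐ[ℂ] (H →L[ℂ] H)),
      (∀ T, π (j T) = T) ∧ (∀ a, z * a = j (π a)) ∧ ∃ (ι : Type) (b : ι → H), Orthonormal ℂ b ∧
        ∀ φ : S →ₗ[ℂ] ℂ, (∀ a, 0 ≤ a → 0 ≤ φ a) → ScottContinuous φ →
          HasSum (fun k => φ (j (rankOne ℂ (b k) (b k)))) (φ z) := by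
  classical
  obtain ⟨I, H, _, _, _, _, ⟨e⟩⟩ := hS.exists_decomposition
  obtain ⟨i, rfl⟩ := hz.exists_eq_blockEmb_one e
  obtain ⟨w, b, -⟩ := exists_hilbertBasis ℂ (H i)
  refine ⟨H i, inferInstance, inferInstance, inferInstance, blockEmb e i, e.comp i,
    blockComp_blockEmb_self e i, blockEmb_one_mul e i, w, b, b.orthonormal, fun φ hφ hN => ?_⟩
  exact hN.hasSum_of_isLUB hφ (fun k => blockEmb_nonneg e i
    ((ContinuousLinearMap.nonneg_iff_isPositive _).2 (isPositive_rankOne_self _)))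
    (isLUB_blockEmb_one e i b)

/-- Normality gives additivity on `1 = ∑ z`; Cauchy–Schwarz extends it to all `a`. -/
theorem ScottContinuous.hasSum_mul_minimal (hS : IsAtomicWStar S) {φ : S →ₗ[ℂ] ℂ}
    (hφ : ∀ a, 0 ≤ a → 0 ≤ φ a) (hN : ScottContinuous φ) (a : S) :
    HasSum (fun z : {z : S // IsMinimalCentralProjection z} => φ (z * a)) (φ a) := by
  have h := hasSum_mul_of_hasSum (p := fun z : {z : S // IsMinimalCentralProjection z} => (z : S))
    (fun a => hφ _ (star_mul_self_nonneg' a))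
    (fun z => z.2.1.1.isSelfAdjoint.star_eq) (fun z => z.2.1.1.isIdempotentElem.eq)
    (fun z u h => z.2.mul_eq_zero u.2 fun h' => h (Subtype.ext h'))
    (hN.hasSum_of_isLUB hφ (fun z => ?_) hS.isLUB_one) a
  · simpa only [(Semigroup.mem_center_iff.1 (Subtype.prop _ : IsMinimalCentralProjection _).1.2 a)]
      using h
  · have := star_mul_self_nonneg' (z : S)
    rwa [z.2.1.1.isSelfAdjoint.star_eq, z.2.1.1.isIdempotentElem.eq] at this

/-- Normal KMS functionals on a block are unique up to a factor. -/
theorem IsAtomicWStar.eq_mul_of_kms (hS : IsAtomicWStar S) {z : S}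
    (hz : IsMinimalCentralProjection z) {θ : ℝ → S ≃⋆ₐ[ℂ] S} (h0 : ∀ a, θ 0 a = a)
    (hθz : ∀ t, θ t z = z) {β : ℝ} {φ ψ : S →ₗ[ℂ] ℂ} (hφ : ∀ a, 0 ≤ a → 0 ≤ φ a)
    (hψ : ∀ a, 0 ≤ a → 0 ≤ ψ a) (hNφ : ScottContinuous φ) (hNψ : ScottContinuous ψ)
    (hKφ : ∀ a b, z * a = a → z * b = b →
      IsStripPair β (fun t => φ (a * θ t b)) (fun t => φ (θ t b * a)))
    (hKψ : ∀ a b, z * a = a → z * b = b →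
      IsStripPair β (fun t => ψ (a * θ t b)) (fun t => ψ (θ t b * a)))
    (hψz : ψ z = 1) (a : S) : φ (z * a) = φ z * ψ (z * a) := by
  obtain ⟨H, _, _, _, j, π, hπj, hjπ, ι, b, hb, hsum⟩ := hS.exists_block hz
  have hzj : ∀ T, z * j T = j T := fun T => by rw [hjπ, hπj]
  have hj1 : j 1 = z := by rw [← map_one π, ← hjπ, mul_one]
  have hinv : ∀ t T, z * θ t (j T) = θ t (j T) := by
    intro t T
    conv_lhs => rw [← hθz t]
    rw [← map_mul, hzj]
  have hθz' : ∀ t, (θ t).symm z = z := fun t => by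
    rw [← hθz t, StarAlgEquiv.symm_apply_apply, hθz t]
  have hinv' : ∀ t T, z * (θ t).symm (j T) = (θ t).symm (j T) := by
    intro t T
    conv_lhs => rw [← hθz' t]
    rw [← map_mul, hzj]
  -- The flow fixes `z`, so it preserves the block and transports to automorphisms of `B(H)`.
  let σ : ℝ → (H →L[ℂ] H) ≃⋆ₐ[ℂ] (H →L[ℂ] H) := fun t =>
    { toFun := fun T => π (θ t (j T))
      invFun := fun T => π ((θ t).symm (j T))
      left_inv := fun T => by
        beta_reduce
        rw [← hjπ, hinv, StarAlgEquiv.symm_apply_apply, hπj]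
      right_inv := fun T => by
        beta_reduce
        rw [← hjπ, hinv', StarAlgEquiv.apply_symm_apply, hπj]
      map_mul' := fun T R => by simp only [map_mul]
      map_add' := fun T R => by simp only [map_add]
      map_star' := fun T => by simp only [map_star]
      map_smul' := fun c T => by simp only [map_smul] }
  have hσ : ∀ t T, j (σ t T) = θ t (j T) := fun t T => by
    change j (π (θ t (j T))) = _
    rw [← hjπ, hinv]
  let J : (S →ₗ[ℂ] ℂ) → ((H →L[ℂ] H) →ₗ[ℂ] ℂ) := fun χ =>
    { toFun := fun T => χ (j T)
      map_add' := fun T R => by rw [map_add, map_add]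
      map_smul' := fun c T => by rw [map_smul, map_smul]; rfl }
  have hpos : ∀ χ : S →ₗ[ℂ] ℂ, (∀ a, 0 ≤ a → 0 ≤ χ a) → ∀ T, 0 ≤ J χ (star T * T) := by
    intro χ hχ T
    change 0 ≤ χ (j (star T * T))
    rw [map_mul, map_star]
    exact hχ _ (star_mul_self_nonneg' _)
  have hK : ∀ χ : S →ₗ[ℂ] ℂ, (∀ a b, z * a = a → z * b = b →
      IsStripPair β (fun t => χ (a * θ t b)) (fun t => χ (θ t b * a))) → ∀ T R,
      IsStripPair β (fun t => J χ (T * σ t R)) (fun t => J χ (σ t R * T)) := by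
    intro χ hχ T R
    have h := hχ (j T) (j R) (hzj T) (hzj R)
    simp only [← hσ, ← map_mul] at h
    exact h
  have hN : ∀ χ : S →ₗ[ℂ] ℂ, (∀ a, 0 ≤ a → 0 ≤ χ a) → ScottContinuous χ →
      HasSum (fun k => J χ (rankOne ℂ (b k) (b k))) (J χ 1) := by
    intro χ hχ hχN
    have h := hsum χ hχ hχN
    rw [← hj1] at h
    exact h
  have h := _root_.eq_mul_of_kms (θ := σ) (fun T => by
    refine Function.LeftInverse.injective hπj ?_
    rw [hσ, h0]) (hpos φ hφ) (hpos ψ hψ) (hK φ hKφ) (hK ψ hKψ) hb (hN φ hφ hNφ) (hN ψ hψ hNψ)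
    (by change ψ (j 1) = 1; rw [hj1, hψz]) (π a)
  change φ (j (π a)) = φ (j 1) * ψ (j (π a)) at h
  rwa [← hjπ, hj1] at h

end Blocks

/-! ### Central projections under automorphisms. -/

section

variable {M N : Type*} [Ring M] [StarRing M] [Algebra ℂ M] [Ring N] [StarRing N] [Algebra ℂ N]

theorem IsCentralProjection.map (f : M ≃⋆ₐ[ℂ] N) {p : M} (hp : IsCentralProjection p) :
    IsCentralProjection (f p) := by
  refine ⟨⟨?_, ?_⟩, ?_⟩
  · change f p * f p = f p
    rw [← map_mul, hp.1.isIdempotentElem.eq]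
  · change star (f p) = f p
    rw [← map_star, hp.1.isSelfAdjoint.star_eq]
  · rw [Semigroup.mem_center_iff]
    intro b
    rw [← f.apply_symm_apply b, ← map_mul, Semigroup.mem_center_iff.1 hp.2, map_mul]

theorem IsMinimalCentralProjection.map (f : M ≃⋆ₐ[ℂ] N) {z : M}
    (hz : IsMinimalCentralProjection z) : IsMinimalCentralProjection (f z) := by
  refine ⟨hz.1.map f, fun h => hz.2.1 ((map_eq_zero_iff f f.injective).1 h), fun p hp hpz => ?_⟩
  have h := hz.2.2 (f.symm p) (hp.map f.symm) (by
    conv_lhs => rw [← f.symm_apply_apply z]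
    rw [← map_mul, hpz])
  rcases h with h | h
  · left
    rw [← f.apply_symm_apply p, h, map_zero]
  · right
    rw [← h, f.apply_symm_apply]

end

/-- A state is concentrated on any projection to which it gives the value `1`. -/
theorem apply_mul_of_apply_eq_one {M : Type*} [Ring M] [StarRing M] [Algebra ℂ M] [StarModule ℂ M]
    {φ : M →ₗ[ℂ] ℂ} (hφ : ∀ a, 0 ≤ φ (star a * a)) {p : M} (hp : IsStarProjection p)
    (h : φ p = φ 1) (a : M) : φ (p * a) = φ a := by
  have h1 := norm_sq_le_of_pos hφ (1 - p) a
  have h2 : star (1 - p) = 1 - p := by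
    rw [star_sub, star_one, hp.isSelfAdjoint.star_eq]
  have h3 : (1 - p) * (1 - p) = 1 - p := by
    rw [sub_mul, mul_sub, mul_sub, hp.isIdempotentElem.eq]; simp
  rw [h2, h3, map_sub, h, sub_self, Complex.zero_re, zero_mul, sub_mul, one_mul, map_sub] at h1
  have h4 : φ a - φ (p * a) = 0 := by
    have := le_antisymm h1 (sq_nonneg _)
    simpa using this
  exact (sub_eq_zero.1 h4).symm

/-! ### The flow on `A n`, the states `τ_z`, the links and the conditional expectations. -/

namespace LocallyAtomicFlow

variable {A : Type*} [CStarAlgebra A] [PartialOrder A] [StarOrderedRing A]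
variable (F : LocallyAtomicFlow A)

/-- The flow on `A n` by automorphisms. -/
def flowEquiv (n : ℕ) (t : ℝ) : F.alg n ≃⋆ₐ[ℂ] F.alg n where
  toFun := F.flowOn n t
  invFun := F.flowOn n (-t)
  left_inv a := Subtype.ext (by
    change F.flow (-t) (F.flow t a) = a
    rw [← F.flow_add, neg_add_cancel, F.flow_zero])
  right_inv a := Subtype.ext (by
    change F.flow t (F.flow (-t) a) = a
    rw [← F.flow_add, add_neg_cancel, F.flow_zero])
  map_mul' a b := Subtype.ext (map_mul (F.flow t) (a : A) b)
  map_add' a b := Subtype.ext (map_add (F.flow t) (a : A) b)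
  map_star' a := Subtype.ext (map_star (F.flow t) (a : A))
  map_smul' c a := Subtype.ext (map_smul (F.flow t) c (a : A))

theorem flowEquiv_zero (n : ℕ) (a : F.alg n) : F.flowEquiv n 0 a = a :=
  Subtype.ext (F.flow_zero a)

theorem flowEquiv_add (n : ℕ) (s t : ℝ) (a : F.alg n) :
    F.flowEquiv n (s + t) a = F.flowEquiv n s (F.flowEquiv n t a) :=
  Subtype.ext (F.flow_add s t a)

theorem minProj_mul_comm {n : ℕ} (z : F.MinProj n) (a : F.alg n) : z.1 * a = a * z.1 :=
  (Semigroup.mem_center_iff.1 z.2.1.2 a).symm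

theorem minProj_mul_self {n : ℕ} (z : F.MinProj n) : z.1 * z.1 = z.1 :=
  z.2.1.1.isIdempotentElem.eq

theorem star_minProj {n : ℕ} (z : F.MinProj n) : star z.1 = z.1 :=
  z.2.1.1.isSelfAdjoint.star_eq

theorem minProj_nonneg {n : ℕ} (z : F.MinProj n) : 0 ≤ z.1 := by
  have := star_mul_self_nonneg' z.1
  rwa [F.star_minProj, F.minProj_mul_self] at this

theorem norm_minProj_le {n : ℕ} (z : F.MinProj n) : ‖(z.1 : A)‖ ≤ 1 := by
  have h := CStarRing.norm_star_mul_self (x := (z.1 : A))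
  have h1 : star (z.1 : A) * (z.1 : A) = z.1 :=
    congrArg Subtype.val (show star z.1 * z.1 = z.1 by rw [F.star_minProj, F.minProj_mul_self])
  rw [h1] at h
  by_contra! h5
  nlinarith

/-- Normal positive functionals on `A n` that satisfy the KMS condition. -/
structure IsNormalKMS (β : ℝ) (n : ℕ) (φ : F.alg n →ₗ[ℂ] ℂ) : Prop where
  nonneg : ∀ a, 0 ≤ a → 0 ≤ φ a
  normal : ScottContinuous φ
  kms : ∀ a b, IsStripPair β (fun t => φ (a * F.flowEquiv n t b))
    (fun t => φ (F.flowEquiv n t b * a))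

variable {F} {β : ℝ}

theorem IsNormalKMS.nonneg_star {n : ℕ} {φ : F.alg n →ₗ[ℂ] ℂ} (h : F.IsNormalKMS β n φ)
    (a : F.alg n) : 0 ≤ φ (star a * a) := h.nonneg _ (star_mul_self_nonneg' a)

theorem IsNormalKMS.restrict {n : ℕ} {φ : F.alg (n + 1) →ₗ[ℂ] ℂ}
    (h : F.IsNormalKMS β (n + 1) φ) :
    F.IsNormalKMS β n (φ ∘ₗ (F.incl n).toAlgHom.toLinearMap) :=
  ⟨fun _ ha => h.nonneg _ ha, (F.normal_inclusion n).comp h.normal,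
    fun a b => h.kms (F.incl n a) (F.incl n b)⟩

/-- The restriction of a functional on `A` to `A n`. -/
def restrictTo (F : LocallyAtomicFlow A) (n : ℕ) (ω : WeakDual ℂ A) : F.alg n →ₗ[ℂ] ℂ :=
  (WeakDual.toStrongDual ω).toLinearMap ∘ₗ (F.alg n).subtype.toAlgHom.toLinearMap

theorem isNormalKMS_restrictTo {ω : WeakDual ℂ A} (h : ω ∈ F.lnKMS β) (n : ℕ) :
    F.IsNormalKMS β n (F.restrictTo n ω) := by
  obtain ⟨h1, -, h3, h4⟩ := h
  refine ⟨fun a ha => h1 _ ha, h4 n, fun a b => ?_⟩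
  exact isKMSOn_iff_isStripPair.1 h3 (a : A) trivial (b : A) trivial

namespace Admissible

variable (hβ : F.Admissible β)

theorem tau_isNormalState {n : ℕ} (z : F.MinProj n) : IsNormalState (hβ.tau z) := (hβ.tau_spec z).1

theorem tau_self {n : ℕ} (z : F.MinProj n) : hβ.tau z z.1 = 1 := (hβ.tau_spec z).2.1

theorem tau_mul {n : ℕ} (z : F.MinProj n) (a : F.alg n) : hβ.tau z (z.1 * a) = hβ.tau z a :=
  apply_mul_of_apply_eq_one
    (fun a => (hβ.tau_isNormalState z).nonneg _ (star_mul_self_nonneg' a)) z.2.1.1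
    (by rw [hβ.tau_self, (hβ.tau_isNormalState z).unital]) a

theorem tau_of_ne {n : ℕ} {z z' : F.MinProj n} (h : z ≠ z') : hβ.tau z z'.1 = 0 := by
  rw [← hβ.tau_mul, z.2.mul_eq_zero z'.2 fun h' => h (Subtype.ext h'), map_zero]

include hβ in
/-- The flow fixes the minimal projections of the centers. -/
theorem flowEquiv_minProj {n : ℕ} (z : F.MinProj n) (t : ℝ) : F.flowEquiv n t z.1 = z.1 := by
  -- An automorphism permutes the minimal central projections, and `τ_z` is `1` at `z` and `0` at
  -- the others. For small `t` norm continuity keeps its value at the image of `z` within `1/2` of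
  -- `1`, so the image is `z`.
  have hsmall : ∀ᶠ t in nhds (0 : ℝ), F.flowEquiv n t z.1 = z.1 := by
    filter_upwards [F.flow_continuous n (hβ.tau z) (hβ.tau_isNormalState z) 0 (1 / 2)
      (by norm_num)] with t ht
    have h := ht z.1 (F.flowEquiv n t z.1) z.1 rfl (F.flow_zero _).symm
    by_contra hne
    have h2 : hβ.tau z (F.flowEquiv n t z.1) = 0 :=
      hβ.tau_of_ne (z' := ⟨_, z.2.map (F.flowEquiv n t)⟩) fun h' =>
        hne (congrArg Subtype.val h').symm
    rw [h2, hβ.tau_self, zero_sub, norm_neg, norm_one] at h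
    have := F.norm_minProj_le z
    linarith
  -- Every `t` is a multiple of the arbitrarily small time `t / (k + 1)`.
  have hnat : ∀ (k : ℕ) (s : ℝ), F.flowEquiv n s z.1 = z.1 → F.flowEquiv n (k * s) z.1 = z.1 := by
    intro k s hs
    induction k with
    | zero => rw [Nat.cast_zero, zero_mul, F.flowEquiv_zero]
    | succ k ih => rw [Nat.cast_succ, add_mul, one_mul, F.flowEquiv_add, hs, ih]
  have hlim : Filter.Tendsto (fun k : ℕ => t / ((k : ℝ) + 1)) Filter.atTop (nhds 0) := by
    have := (tendsto_one_div_add_atTop_nhds_zero_nat (𝕜 := ℝ)).const_mul t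
    simpa [div_eq_mul_inv] using this
  obtain ⟨k, hk⟩ := (hlim.eventually hsmall).exists
  have h := hnat (k + 1) _ hk
  have e : ((k + 1 : ℕ) : ℝ) * (t / ((k : ℝ) + 1)) = t := by
    push_cast
    field_simp
  rwa [e] at h

/-- Since the flow fixes `z` and `τ_z` ignores the other blocks, cutting both arguments down to the
block changes nothing; the KMS condition on the block is the condition on `A n`. -/
theorem isNormalKMS_tau {n : ℕ} (z : F.MinProj n) : F.IsNormalKMS β n (hβ.tau z) := by
  refine ⟨(hβ.tau_isNormalState z).nonneg, (hβ.tau_isNormalState z).normal, fun a b => ?_⟩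
  have h := isKMSOn_iff_isStripPair.1 (hβ.tau_spec z).2.2 (z.1 * a)
    (show z.1 * (z.1 * a) = z.1 * a by rw [← mul_assoc, F.minProj_mul_self]) (z.1 * b)
    (show z.1 * (z.1 * b) = z.1 * b by rw [← mul_assoc, F.minProj_mul_self])
  have e : ∀ t, F.flowOn n t (z.1 * b) = z.1 * F.flowEquiv n t b := fun t => by
    change F.flowEquiv n t (z.1 * b) = _
    rw [map_mul, hβ.flowEquiv_minProj]
  have e1 : ∀ x y : F.alg n, hβ.tau z (z.1 * x * (z.1 * y)) = hβ.tau z (x * y) := fun x y => by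
    rw [mul_assoc, hβ.tau_mul, ← mul_assoc, ← F.minProj_mul_comm, mul_assoc, hβ.tau_mul]
  simpa only [e, e1] using h

/-- A normal KMS functional restricts to a multiple of `τ_z` on every block. -/
theorem apply_minProj_mul {n : ℕ} {φ : F.alg n →ₗ[ℂ] ℂ} (hφ : F.IsNormalKMS β n φ)
    (z : F.MinProj n) (a : F.alg n) : φ (z.1 * a) = φ z.1 * hβ.tau z a := by
  rw [← hβ.tau_mul z a]
  have hτ := hβ.isNormalKMS_tau z
  exact (F.atomic n).eq_mul_of_kms z.2 (F.flowEquiv_zero n) (hβ.flowEquiv_minProj z) hφ.nonneg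
    hτ.nonneg hφ.normal hτ.normal (fun a b _ _ => hφ.kms a b) (fun a b _ _ => hτ.kms a b)
    (hβ.tau_self z) a

/-- The formula behind the whole theorem: normality splits `φ` over the blocks, and uniqueness
identifies each piece with a multiple of `τ_z`. -/
theorem hasSum_tau {n : ℕ} {φ : F.alg n →ₗ[ℂ] ℂ} (hφ : F.IsNormalKMS β n φ) (a : F.alg n) :
    HasSum (fun z : F.MinProj n => φ z.1 * hβ.tau z a) (φ a) := by
  simpa only [hβ.apply_minProj_mul hφ] using
    ScottContinuous.hasSum_mul_minimal (F.atomic n) hφ.nonneg hφ.normal a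

theorem coeff_condExp_eq {n : ℕ} (a : F.alg n) (z : F.MinProj n) :
    F.coeff (hβ.condExp n a) z = hβ.tau z a := by rw [hβ.coeff_condExp, hβ.tau_mul]

theorem tau_center {n : ℕ} (f : F.Center n) (z : F.MinProj n) :
    hβ.tau z (f : F.alg n) = F.coeff f z := by
  rw [← hβ.tau_mul, F.mul_eq_coeff_smul, map_smul, hβ.tau_self, smul_eq_mul, mul_one]

theorem coe_link {n : ℕ} (z' : F.MinProj (n + 1)) (z : F.MinProj n) :
    (hβ.link z' z : ℂ) = hβ.tau z' (F.incl n z.1) := by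
  unfold link
  rw [hβ.tau_mul]
  have h : 0 ≤ hβ.tau z' (F.incl n z.1) := (hβ.isNormalKMS_tau z').nonneg _ (F.minProj_nonneg z)
  rw [Complex.nonneg_iff] at h
  exact Complex.ext rfl h.2

theorem link_nonneg {n : ℕ} (z' : F.MinProj (n + 1)) (z : F.MinProj n) : 0 ≤ hβ.link z' z := by
  have h : 0 ≤ hβ.tau z' (F.incl n z.1) := (hβ.isNormalKMS_tau z').nonneg _ (F.minProj_nonneg z)
  rw [← hβ.coe_link] at h
  exact_mod_cast h

theorem hasSum_link_mul_tau {n : ℕ} (z' : F.MinProj (n + 1)) (a : F.alg n) :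
    HasSum (fun z : F.MinProj n => (hβ.link z' z : ℂ) * hβ.tau z a) (hβ.tau z' (F.incl n a)) := by
  simp only [coe_link]
  exact hβ.hasSum_tau (hβ.isNormalKMS_tau z').restrict a

/-- The rows of `κ` are probability vectors: evaluate the decomposition of the restricted `τ_{z'}`
at the unit. -/
theorem hasSum_link {n : ℕ} (z' : F.MinProj (n + 1)) :
    HasSum (fun z : F.MinProj n => hβ.link z' z) 1 := by
  have h := hβ.hasSum_link_mul_tau z' 1
  rw [map_one, (hβ.tau_isNormalState z').unital] at h
  simp only [(hβ.tau_isNormalState _).unital, mul_one] at h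
  rw [← Complex.ofReal_one] at h
  exact Complex.hasSum_ofReal.1 h

theorem theta_apply {n : ℕ} (f : F.Center n) :
    hβ.theta n f = hβ.condExp (n + 1) (F.incl n (f : F.alg n)) := rfl

theorem coeff_theta {n : ℕ} (f : F.Center n) (z' : F.MinProj (n + 1)) :
    F.coeff (hβ.theta n f) z' = hβ.tau z' (F.incl n (f : F.alg n)) := by
  rw [hβ.theta_apply, hβ.coeff_condExp_eq]

theorem hasSum_coeff_theta {n : ℕ} (f : F.Center n) (z' : F.MinProj (n + 1)) :
    HasSum (fun z : F.MinProj n => (hβ.link z' z : ℂ) * F.coeff f z)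
      (F.coeff (hβ.theta n f) z') := by
  rw [hβ.coeff_theta]
  simpa only [hβ.tau_center] using hβ.hasSum_link_mul_tau z' (f : F.alg n)

/-- The conditional expectations intertwine the inclusions with the maps `Θ_{n+1,n}`. -/
theorem condExp_incl {n : ℕ} (a : F.alg n) :
    hβ.condExp (n + 1) (F.incl n a) = hβ.theta n (hβ.condExp n a) := by
  refine F.center_ext fun z' => ?_
  rw [hβ.coeff_condExp_eq]
  -- Both coefficients at `z'` are the sum of `κ(z', z) τ_z(a)` over `z`.
  refine (hβ.hasSum_link_mul_tau z' a).unique ?_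
  simpa only [hβ.coeff_condExp_eq] using hβ.hasSum_coeff_theta (hβ.condExp n a) z'

end Admissible

end LocallyAtomicFlow

/-! ### Interchange of sums; harmonic functions and locally normal states of the system. -/

theorem summable_prod_of_hasSum {α β : Type*} {k : α → β → ℝ} (hk : ∀ a b, 0 ≤ k a b) {g : β → ℝ}
    (hg : ∀ b, HasSum (fun a => k a b) (g b)) (hgs : Summable g) :
    Summable fun p : α × β => k p.1 p.2 := by
  have h : Summable fun p : β × α => k p.2 p.1 := by
    rw [summable_prod_of_nonneg fun p => hk _ _]
    exact ⟨fun b => (hg b).summable, by simpa only [(hg _).tsum_eq] using hgs⟩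
  exact (Equiv.prodComm β α).summable_iff.1 h

/-- Interchange of summation for a nonnegative kernel and a bounded function. -/
theorem hasSum_swap {α β : Type*} {k : α → β → ℝ} (hk : ∀ a b, 0 ≤ k a b) {g : β → ℝ}
    (hg : ∀ b, HasSum (fun a => k a b) (g b)) (hgs : Summable g) {f : β → ℂ} {C : ℝ}
    (hf : ∀ b, ‖f b‖ ≤ C) {h : α → ℂ} (hh : ∀ a, HasSum (fun b => (k a b : ℂ) * f b) (h a)) :
    HasSum h (∑' b, (g b : ℂ) * f b) := by
  have hs : Summable fun p : α × β => (k p.1 p.2 : ℂ) * f p.2 := by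
    refine Summable.of_norm_bounded ((summable_prod_of_hasSum hk hg hgs).mul_right C) fun p => ?_
    rw [norm_mul, Complex.norm_real, Real.norm_of_nonneg (hk _ _)]
    exact mul_le_mul_of_nonneg_left (hf _) (hk _ _)
  have h1 := hs.hasSum.prod_fiberwise hh
  have hs' : HasSum (fun p : β × α => (k p.2 p.1 : ℂ) * f p.1)
      (∑' p : α × β, (k p.1 p.2 : ℂ) * f p.2) := (Equiv.prodComm β α).hasSum_iff.2 hs.hasSum
  have h2 := hs'.prod_fiberwise (g := fun b => (g b : ℂ) * f b)
    fun b => (Complex.hasSum_ofReal.2 (hg b)).mul_right (f b)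
  rwa [h2.tsum_eq]

namespace LocallyAtomicFlow

variable {A : Type*} [CStarAlgebra A] [PartialOrder A] [StarOrderedRing A]
variable (F : LocallyAtomicFlow A)

/-- A minimal projection as an element of the center. -/
def centerOf {n : ℕ} (z : F.MinProj n) : F.Center n := ⟨z.1, F.mem_center_iff.2 z.2.1.2⟩

theorem coeff_centerOf_self {n : ℕ} (z : F.MinProj n) : F.coeff (F.centerOf z) z = 1 := by
  rw [F.coeff_eq_iff, one_smul]
  exact F.minProj_mul_self z

theorem coeff_centerOf_ne {n : ℕ} {z z' : F.MinProj n} (h : z' ≠ z) :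
    F.coeff (F.centerOf z) z' = 0 := by
  rw [F.coeff_eq_iff, zero_smul]
  exact z'.2.mul_eq_zero z.2 fun h' => h (Subtype.ext h')

theorem coeff_one {n : ℕ} (z : F.MinProj n) : F.coeff (1 : F.Center n) z = 1 := by
  rw [F.coeff_eq_iff, one_smul]
  exact mul_one _

theorem coeff_mul {n : ℕ} (f g : F.Center n) (z : F.MinProj n) :
    F.coeff (f * g) z = F.coeff f z * F.coeff g z := by
  rw [F.coeff_eq_iff, mul_smul, ← F.mul_eq_coeff_smul g, ← smul_mul_assoc,
    ← F.mul_eq_coeff_smul f, mul_assoc]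
  rfl

theorem coeff_star {n : ℕ} (f : F.Center n) (z : F.MinProj n) :
    F.coeff (star f) z = starRingEnd ℂ (F.coeff f z) := by
  rw [F.coeff_eq_iff]
  have h := congrArg star (F.mul_eq_coeff_smul f z)
  rw [star_mul, star_smul, F.star_minProj, ← F.minProj_mul_comm] at h
  exact h

theorem coeff_sum {n : ℕ} {ι : Type*} (s : Finset ι) (f : ι → F.Center n) (z : F.MinProj n) :
    F.coeff (∑ i ∈ s, f i) z = ∑ i ∈ s, F.coeff (f i) z := by
  classical
  induction s using Finset.induction_on with
  | empty =>
    rw [Finset.sum_empty, Finset.sum_empty, F.coeff_eq_iff, zero_smul]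
    exact mul_zero _
  | insert i s hi ih => rw [Finset.sum_insert hi, Finset.sum_insert hi, F.coeff_add, ih]

/-- Square roots are taken coefficientwise. This turns positivity of coefficients into the squares
that define the cones. -/
theorem exists_eq_star_mul_self {n : ℕ} {f : F.Center n} (hf : ∀ z, 0 ≤ F.coeff f z) :
    ∃ y : F.Center n, f = star y * y := by
  obtain ⟨y, hy⟩ := F.exists_center_of_bounded
    (fun z : F.MinProj n => ((Real.sqrt (F.coeff f z).re : ℝ) : ℂ))
    ⟨Real.sqrt ‖((f : F.alg n) : A)‖, fun z => by
      rw [Complex.norm_real, Real.norm_of_nonneg (Real.sqrt_nonneg _)]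
      exact Real.sqrt_le_sqrt ((Complex.re_le_norm _).trans (F.norm_coeff_le f z))⟩
  refine ⟨y, F.center_ext fun z => ?_⟩
  have h := Complex.nonneg_iff.1 (hf z)
  rw [F.coeff_mul, F.coeff_star, hy, Complex.conj_ofReal, ← Complex.ofReal_mul,
    Real.mul_self_sqrt h.1]
  exact Complex.ext rfl h.2.symm

theorem eq_root [Nontrivial A] (z : F.MinProj 0) : z = F.root := by
  have h := F.root.2.2.2 z.1 z.2.1 (mul_one _)
  exact Subtype.ext (h.resolve_left z.2.2.1)

theorem centerOf_root [Nontrivial A] : F.centerOf F.root = 1 := rfl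

namespace Admissible

variable {F} {β : ℝ} (hβ : F.Admissible β)

theorem thetaLE_succ_self (n : ℕ) : hβ.thetaLE n (n + 1) n.le_succ = hβ.theta n := by
  rw [hβ.thetaLE_succ le_rfl, hβ.thetaLE_self, LinearMap.comp_id]

theorem preTheta_theta (n : ℕ) (f : F.Center n) :
    hβ.preTheta (n + 1) (hβ.theta n f) = hβ.preTheta n f := by
  rw [← hβ.thetaLE_succ_self, hβ.preTheta_thetaLE]

theorem thetaInf_theta (n : ℕ) (f : F.Center n) :
    hβ.thetaInf (n + 1) (hβ.theta n f) = hβ.thetaInf n f :=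
  congrArg hβ.nullSpace.mkQ (hβ.preTheta_theta n f)

theorem theta_one (n : ℕ) : hβ.theta n 1 = 1 := by
  refine F.center_ext fun z => ?_
  rw [hβ.coeff_theta, F.coeff_one]
  exact (hβ.tau_isNormalState z).unital

theorem preTheta_one (n : ℕ) : hβ.preTheta n 1 = hβ.preUnit := by
  induction n with
  | zero => rfl
  | succ n ih => rw [← ih, ← hβ.preTheta_theta n, hβ.theta_one]

theorem thetaInf_one (n : ℕ) : hβ.thetaInf n 1 = hβ.unit :=
  congrArg hβ.nullSpace.mkQ (hβ.preTheta_one n)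

theorem exists_thetaInf (x : hβ.System) : ∃ (n : ℕ) (f : F.Center n), hβ.thetaInf n f = x := by
  obtain ⟨y, rfl⟩ := hβ.nullSpace.mkQ_surjective x
  obtain ⟨n, f, rfl⟩ := Module.DirectLimit.exists_of y
  exact ⟨n, f, rfl⟩

theorem system_hom_ext {ω η : hβ.System →ₗ[ℂ] ℂ}
    (h : ∀ n f, ω (hβ.thetaInf n f) = η (hβ.thetaInf n f)) : ω = η := by
  refine LinearMap.ext fun x => ?_
  obtain ⟨n, f, rfl⟩ := hβ.exists_thetaInf x
  exact h n f

theorem thetaInf_mem_cone {n : ℕ} {f : F.Center n} (hf : ∀ z, 0 ≤ F.coeff f z) :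
    (Matrix.of fun _ _ : Fin 1 => hβ.thetaInf n f) ∈ hβ.cone 1 := by
  refine ⟨Matrix.of fun _ _ => hβ.preTheta n f, rfl, fun r hr => ?_⟩
  obtain ⟨y, hy⟩ := F.exists_eq_star_mul_self (f := f + (r : ℂ) • 1) fun z => by
    rw [F.coeff_add, F.coeff_smul, F.coeff_one, mul_one]
    exact add_nonneg (hf z) (by exact_mod_cast hr.le)
  refine ⟨_, ⟨n, Matrix.of fun _ _ => y, rfl⟩, 0, fun _ _ => hβ.nullSpace.zero_mem, ?_⟩
  ext i j
  have hij : i = j := Subsingleton.elim i j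
  subst hij
  simp only [Matrix.add_apply, Matrix.of_apply, Matrix.diagonal_apply_eq, Matrix.map_apply,
    Matrix.mul_apply, Matrix.conjTranspose_apply, Finset.univ_unique, Finset.sum_singleton,
    Matrix.zero_apply, add_zero]
  rw [← hy, map_add, map_smul, hβ.preTheta_one]

/-- Positivity of functionals on the system, tested on the images of positive central elements. -/
theorem isState_iff (ω : hβ.System →ₗ[ℂ] ℂ) : hβ.IsState ω ↔ ω hβ.unit = 1 ∧
    ∀ n (f : F.Center n), (∀ z, 0 ≤ F.coeff f z) → 0 ≤ ω (hβ.thetaInf n f) := by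
  refine ⟨fun h => ⟨h.1, fun n f hf => h.2 _ (hβ.thetaInf_mem_cone hf)⟩, fun h => ⟨h.1, ?_⟩⟩
  rintro x ⟨Y, hY, hr⟩
  have hx : x = hβ.nullSpace.mkQ (Y 0 0) := congrFun (congrFun hY 0) 0
  have key : ∀ r : ℝ, 0 < r → 0 ≤ ω x + r := by
    intro r hrpos
    obtain ⟨_, ⟨n, W, rfl⟩, N, hN, hE⟩ := hr r hrpos
    have h00 := congrFun (congrFun hE 0) 0
    simp only [Matrix.add_apply, Matrix.diagonal_apply_eq, Matrix.map_apply, Matrix.mul_apply,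
      Matrix.conjTranspose_apply, Finset.univ_unique, Finset.sum_singleton] at h00
    have h1 := congrArg (fun v => ω (hβ.nullSpace.mkQ v)) h00
    simp only [map_add, map_smul] at h1
    have hN0 : hβ.nullSpace.mkQ (N 0 0) = 0 := by
      rw [← LinearMap.mem_ker, Submodule.ker_mkQ]
      exact hN 0 0
    have hu : ω (hβ.nullSpace.mkQ hβ.preUnit) = 1 := h.1
    rw [hN0, map_zero, add_zero, hu, ← hx, smul_eq_mul, mul_one] at h1
    rw [h1]
    refine h.2 n _ fun z => ?_
    rw [F.coeff_mul, F.coeff_star, mul_comm, Complex.mul_conj]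
    exact_mod_cast Complex.normSq_nonneg _
  rw [Complex.nonneg_iff]
  constructor
  · refine le_of_forall_pos_le_add fun r hr => ?_
    have := (Complex.nonneg_iff.1 (key r hr)).1
    simpa using this
  -- A real shift does not change the imaginary part, so one value of `r` suffices here, while the
  -- real part needs `r → 0`.
  · have := (Complex.nonneg_iff.1 (key 1 one_pos)).2
    simpa using this

section Harmonic

variable [Nontrivial A]

/-- Mass is conserved from level to level because the rows of `κ` sum to `1`; nonnegativity permits
exchanging the two sums. The root carries the whole mass of level `0`. -/
theorem harmonic_hasSum_one (ν : hβ.harmonic) (n : ℕ) :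
    HasSum (fun z : F.MinProj n => ν.1 ⟨n, z⟩) 1 := by
  induction n with
  | zero =>
    have h := hasSum_single (f := fun z : F.MinProj 0 => ν.1 ⟨0, z⟩) F.root
      fun z h => absurd (F.eq_root z) h
    rwa [show ν.1 ⟨0, F.root⟩ = 1 from ν.2.2.1] at h
  | succ n ih =>
    have h := hasSum_swap (fun z' z => mul_nonneg (ν.2.1 ⟨n + 1, z'⟩) (hβ.link_nonneg z' z))
      (ν.2.2.2 n) ih.summable (f := fun _ => 1) (C := 1) (by simp)
      (h := fun z' => (ν.1 ⟨n + 1, z'⟩ : ℂ)) fun z' => by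
        have := Complex.hasSum_ofReal.2 ((hβ.hasSum_link z').mul_left (ν.1 ⟨n + 1, z'⟩))
        simpa using this
    simp only [mul_one] at h
    rw [← Complex.ofReal_tsum, ih.tsum_eq] at h
    exact Complex.hasSum_ofReal.1 h

/-- The restrictions `ν_•` of a harmonic function to the levels of the Bratteli diagram. -/
def dotLevel (ν : hβ.harmonic) (n : ℕ) : F.Predual n :=
  ⟨fun z => (ν.1 ⟨n, z⟩ : ℂ), memℓp_gen (by
    have := (hβ.harmonic_hasSum_one ν n).summable.norm
    simpa using this)⟩

theorem dotLevel_apply (ν : hβ.harmonic) (n : ℕ) (z : F.MinProj n) :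
    hβ.dotLevel ν n z = (ν.1 ⟨n, z⟩ : ℂ) := rfl

theorem hasSum_pairing_dotLevel (ν : hβ.harmonic) (n : ℕ) (f : F.Center n) :
    HasSum (fun z : F.MinProj n => (ν.1 ⟨n, z⟩ : ℂ) * F.coeff f z)
      (F.pairing (hβ.dotLevel ν n) f) :=
  (F.summable_pairing (hβ.dotLevel ν n) f).hasSum

theorem norm_dotLevel (ν : hβ.harmonic) (n : ℕ) : ‖hβ.dotLevel ν n‖ = 1 := by
  have h := lp.norm_eq_tsum_rpow (p := 1) (by norm_num) (hβ.dotLevel ν n)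
  rw [h]
  have : ∀ z : F.MinProj n, ‖hβ.dotLevel ν n z‖ = ν.1 ⟨n, z⟩ := fun z => by
    rw [hβ.dotLevel_apply, Complex.norm_real, Real.norm_of_nonneg (ν.2.1 _)]
  simp only [this, ENNReal.toReal_one, Real.rpow_one, (hβ.harmonic_hasSum_one ν n).tsum_eq]
  norm_num

/-- The map `ν ↦ ν_•` from the harmonic functions to `L(α, β)`. -/
def dot (ν : hβ.harmonic) : hβ.projLimit :=
  ⟨hβ.dotLevel ν, fun n => by
    ext f
    have h := hasSum_swap (fun z' z => mul_nonneg (ν.2.1 ⟨n + 1, z'⟩) (hβ.link_nonneg z' z))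
      (ν.2.2.2 n) (hβ.harmonic_hasSum_one ν n).summable (fun z => F.norm_coeff_le f z)
      (h := fun z' => (ν.1 ⟨n + 1, z'⟩ : ℂ) * F.coeff (hβ.theta n f) z') fun z' => by
        have := (hβ.hasSum_coeff_theta f z').mul_left (ν.1 ⟨n + 1, z'⟩ : ℂ)
        simpa [mul_assoc] using this
    exact (hβ.hasSum_pairing_dotLevel ν (n + 1) (hβ.theta n f)).unique h,
    1, fun n => (hβ.norm_dotLevel ν n).le⟩

theorem hasSum_iota_dot (ν : hβ.harmonic) (n : ℕ) (f : F.Center n) :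
    HasSum (fun z : F.MinProj n => (ν.1 ⟨n, z⟩ : ℂ) * F.coeff f z)
      (hβ.iota (hβ.dot ν) (hβ.thetaInf n f)) := by
  rw [hβ.iota_thetaInf]
  exact hβ.hasSum_pairing_dotLevel ν n f

theorem iota_dot_mem (ν : hβ.harmonic) : hβ.iota (hβ.dot ν) ∈ hβ.lnStates := by
  refine ⟨(hβ.isState_iff _).2 ⟨?_, fun n f hf => ?_⟩, 0, fun n _ => ⟨hβ.dotLevel ν n, ?_⟩⟩
  · refine (hβ.hasSum_iota_dot ν 0 1).unique ?_
    simp only [F.coeff_one, mul_one]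
    rw [← Complex.ofReal_one]
    exact Complex.hasSum_ofReal.2 (hβ.harmonic_hasSum_one ν 0)
  · exact (hβ.hasSum_iota_dot ν n f).nonneg fun z =>
      mul_nonneg (by exact_mod_cast ν.2.1 _) (hf z)
  · ext f
    exact hβ.iota_thetaInf _ n f

/-- The function on the Bratteli diagram given by a functional on the system. -/
def vertexFun (ω : hβ.System →ₗ[ℂ] ℂ) (v : Σ n, F.MinProj n) : ℝ :=
  (ω (hβ.thetaInf v.1 (F.centerOf v.2))).re

omit [Nontrivial A] in
theorem vertexFun_eq {ω : hβ.System →ₗ[ℂ] ℂ} (hω : hβ.IsState ω) {n : ℕ} (z : F.MinProj n) :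
    0 ≤ hβ.vertexFun ω ⟨n, z⟩ ∧
      (hβ.vertexFun ω ⟨n, z⟩ : ℂ) = ω (hβ.thetaInf n (F.centerOf z)) := by
  classical
  have h := ((hβ.isState_iff ω).1 hω).2 n (F.centerOf z) fun z' => by
    by_cases h : z' = z
    · subst h; rw [F.coeff_centerOf_self]; exact zero_le_one
    · rw [F.coeff_centerOf_ne h]
  rw [Complex.nonneg_iff] at h
  exact ⟨h.1, Complex.ext rfl h.2⟩

-- For a finite set of minimal projections, `1` minus their sum is positive, so the partial sums are
-- at most `1`.
omit [Nontrivial A] in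
theorem summable_vertexFun {ω : hβ.System →ₗ[ℂ] ℂ} (hω : hβ.IsState ω) (n : ℕ) :
    Summable fun z : F.MinProj n => hβ.vertexFun ω ⟨n, z⟩ := by
  classical
  refine summable_of_sum_le (c := 1) (fun z => (hβ.vertexFun_eq hω z).1) fun s => ?_
  have h := ((hβ.isState_iff ω).1 hω).2 n (1 + (-1 : ℂ) • ∑ z ∈ s, F.centerOf z) fun z' => by
    rw [F.coeff_add, F.coeff_smul, F.coeff_one, F.coeff_sum]
    by_cases hz : z' ∈ s
    · rw [Finset.sum_eq_single z' (fun b _ hb => F.coeff_centerOf_ne hb.symm)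
        (fun h => absurd hz h), F.coeff_centerOf_self]
      simp
    · rw [Finset.sum_eq_zero fun b hb =>
        F.coeff_centerOf_ne fun h : z' = b => hz (by rw [h]; exact hb)]
      simp
  rw [map_add, map_smul, map_sum, map_add, map_smul, map_sum, hβ.thetaInf_one, hω.1,
    ← Finset.sum_congr rfl fun z _ => (hβ.vertexFun_eq hω z).2] at h
  have := (Complex.nonneg_iff.1 h).1
  simp only [Complex.add_re, Complex.one_re, smul_eq_mul, neg_mul, one_mul, Complex.neg_re,
    Complex.re_sum, Complex.ofReal_re] at this
  linarith

omit [Nontrivial A] in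
/-- A locally normal state is normal on every level. -/
theorem hasSum_vertexFun {ω : hβ.System →ₗ[ℂ] ℂ} (hω : ω ∈ hβ.lnStates) (n : ℕ) (f : F.Center n) :
    HasSum (fun z : F.MinProj n => (hβ.vertexFun ω ⟨n, z⟩ : ℂ) * F.coeff f z)
      (ω (hβ.thetaInf n f)) := by
  classical
  obtain ⟨hs, m, hm⟩ := hω
  -- On the levels where normality is assumed, evaluation at `z` identifies the weights with the
  -- coordinates of the predual element.
  have hup : ∀ n ≥ m, ∀ f : F.Center n,
      HasSum (fun z : F.MinProj n => (hβ.vertexFun ω ⟨n, z⟩ : ℂ) * F.coeff f z)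
        (ω (hβ.thetaInf n f)) := by
    intro n hn f
    obtain ⟨η, hη⟩ := hm n hn
    have hη' : ∀ g, ω (hβ.thetaInf n g) = F.pairing η g := fun g => LinearMap.congr_fun hη g
    have hz : ∀ z : F.MinProj n, (hβ.vertexFun ω ⟨n, z⟩ : ℂ) = η z := by
      intro z
      rw [(hβ.vertexFun_eq hs z).2, hη']
      refine (tsum_eq_single z fun z' h => ?_).trans ?_
      · rw [F.coeff_centerOf_ne h, mul_zero]
      · rw [F.coeff_centerOf_self, mul_one]
    simp only [hz, hη']
    exact (F.summable_pairing η f).hasSum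
  -- The functional on level `n` is the one on level `n + 1` composed with `Θ`. Expanding `Θ`
  -- through `κ` and exchanging sums gives normality one level down.
  have hdown : ∀ n, (∀ f : F.Center (n + 1),
      HasSum (fun z : F.MinProj (n + 1) => (hβ.vertexFun ω ⟨n + 1, z⟩ : ℂ) * F.coeff f z)
        (ω (hβ.thetaInf (n + 1) f))) → ∀ f : F.Center n,
      HasSum (fun z : F.MinProj n => (hβ.vertexFun ω ⟨n, z⟩ : ℂ) * F.coeff f z)
        (ω (hβ.thetaInf n f)) := by
    intro n ih f
    have hsum : Summable fun z : F.MinProj n => (hβ.vertexFun ω ⟨n, z⟩ : ℂ) * F.coeff f z := by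
      refine Summable.of_norm_bounded
        ((hβ.summable_vertexFun hs n).mul_right ‖((f : F.alg n) : A)‖) fun z => ?_
      rw [norm_mul, Complex.norm_real, Real.norm_of_nonneg (hβ.vertexFun_eq hs z).1]
      exact mul_le_mul_of_nonneg_left (F.norm_coeff_le f z) (hβ.vertexFun_eq hs z).1
    have h := hasSum_swap
      (fun (z' : F.MinProj (n + 1)) (z : F.MinProj n) =>
        mul_nonneg (hβ.vertexFun_eq hs z').1 (hβ.link_nonneg z' z))
      (g := fun z => hβ.vertexFun ω ⟨n, z⟩) (fun z => by
        have h1 := ih (hβ.theta n (F.centerOf z))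
        rw [hβ.thetaInf_theta, ← (hβ.vertexFun_eq hs z).2] at h1
        refine Complex.hasSum_ofReal.1 ?_
        convert h1 using 2 with z'
        rw [hβ.coeff_theta, Complex.ofReal_mul, hβ.coe_link]
        rfl)
      (hβ.summable_vertexFun hs n) (fun z => F.norm_coeff_le f z)
      (h := fun z' => (hβ.vertexFun ω ⟨n + 1, z'⟩ : ℂ) * F.coeff (hβ.theta n f) z') fun z' => by
        have := (hβ.hasSum_coeff_theta f z').mul_left (hβ.vertexFun ω ⟨n + 1, z'⟩ : ℂ)
        simpa [mul_assoc] using this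
    have h2 := ih (hβ.theta n f)
    rw [hβ.thetaInf_theta] at h2
    rw [h2.unique h]
    exact hsum.hasSum
  by_cases hn : m ≤ n
  · exact hup n hn f
  · have : ∀ k, ∀ n, n + k = m → ∀ f : F.Center n,
        HasSum (fun z : F.MinProj n => (hβ.vertexFun ω ⟨n, z⟩ : ℂ) * F.coeff f z)
          (ω (hβ.thetaInf n f)) := by
      intro k
      induction k with
      | zero => intro n h; exact hup n (by omega)
      | succ k ih => intro n h; exact hdown n (ih (n + 1) (by omega))
    exact this (m - n) n (by omega) f

/-- Harmonicity at `z` is normality on the next level evaluated at `Θ(z)`, whose coefficients are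
the links `κ(z', z)`. -/
theorem vertexFun_mem {ω : hβ.System →ₗ[ℂ] ℂ} (hω : ω ∈ hβ.lnStates) :
    hβ.vertexFun ω ∈ hβ.harmonic := by
  refine ⟨fun v => (hβ.vertexFun_eq hω.1 v.2).1, ?_, fun n z => ?_⟩
  · have h := (hβ.vertexFun_eq hω.1 F.root).2
    rw [F.centerOf_root, hβ.thetaInf_one, hω.1.1] at h
    exact_mod_cast h
  · have h1 := hβ.hasSum_vertexFun hω (n + 1) (hβ.theta n (F.centerOf z))
    rw [hβ.thetaInf_theta, ← (hβ.vertexFun_eq hω.1 z).2] at h1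
    refine Complex.hasSum_ofReal.1 ?_
    convert h1 using 2 with z'
    rw [hβ.coeff_theta, Complex.ofReal_mul, hβ.coe_link]
    rfl

theorem iota_dot_vertexFun {ω : hβ.System →ₗ[ℂ] ℂ} (hω : ω ∈ hβ.lnStates) :
    hβ.iota (hβ.dot ⟨_, hβ.vertexFun_mem hω⟩) = ω :=
  hβ.system_hom_ext fun n f =>
    (hβ.hasSum_iota_dot ⟨_, hβ.vertexFun_mem hω⟩ n f).unique (hβ.hasSum_vertexFun hω n f)

theorem iota_dot_centerOf (ν : hβ.harmonic) {n : ℕ} (z : F.MinProj n) :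
    hβ.iota (hβ.dot ν) (hβ.thetaInf n (F.centerOf z)) = (ν.1 ⟨n, z⟩ : ℂ) := by
  refine (hβ.hasSum_iota_dot ν n (F.centerOf z)).unique ?_
  have h := hasSum_single (f := fun z' : F.MinProj n =>
    (ν.1 ⟨n, z'⟩ : ℂ) * F.coeff (F.centerOf z) z') z fun z' h => by
      rw [F.coeff_centerOf_ne h, mul_zero]
  rwa [F.coeff_centerOf_self, mul_one] at h

end Harmonic

end Admissible

end LocallyAtomicFlow

/-! ### Tail estimates, norm limits of KMS functionals, and passage between the `A n` and `A`. -/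

theorem norm_sub_sum_le_of_hasSum {ι : Type*} {ν : ι → ℝ} (hν : ∀ i, 0 ≤ ν i) {S : ℝ}
    (hS : HasSum ν S) {f : ι → ℂ} {C : ℝ} (hf : ∀ i, ‖f i‖ ≤ C) {h : ℂ}
    (hh : HasSum (fun i => (ν i : ℂ) * f i) h) (s : Finset ι) :
    ‖h - ∑ i ∈ s, (ν i : ℂ) * f i‖ ≤ C * (S - ∑ i ∈ s, ν i) := by
  rw [← sub_add_cancel S (∑ i ∈ s, ν i)] at hS
  rw [← sub_add_cancel h (∑ i ∈ s, (ν i : ℂ) * f i)] at hh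
  refine ((Finset.hasSum_compl_iff s).2 hh).norm_le_of_bounded
    (((Finset.hasSum_compl_iff s).2 hS).mul_left C) fun i => ?_
  rw [norm_mul, Complex.norm_real, Real.norm_of_nonneg (hν _), mul_comm]
  exact mul_le_mul_of_nonneg_right (hf _) (hν _)

theorem exists_sub_sum_lt {ι : Type*} {ν : ι → ℝ} {S : ℝ} (hS : HasSum ν S) {ε : ℝ} (hε : 0 < ε) :
    ∃ s : Finset ι, S - ∑ i ∈ s, ν i < ε := by
  have h : ∀ᶠ s in Filter.atTop, dist (∑ i ∈ s, ν i) S < ε := by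
    have := Metric.tendsto_nhds.1 hS ε hε
    rwa [SummationFilter.unconditional_filter] at this
  obtain ⟨s, hs⟩ := h.exists
  rw [dist_comm, Real.dist_eq] at hs
  exact ⟨s, (le_abs_self _).trans_lt hs⟩

/-- Pointwise convergence of probability vectors implies convergence of the expectations of
bounded functions. -/
theorem continuous_of_hasSum_prob {X ι : Type*} [TopologicalSpace X] {g : X → ι → ℝ}
    (hg : ∀ i, Continuous fun x => g x i) (h0 : ∀ x i, 0 ≤ g x i) (h1 : ∀ x, HasSum (g x) 1)
    {f : ι → ℂ} {C : ℝ} (hf : ∀ i, ‖f i‖ ≤ C) {h : X → ℂ}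
    (hh : ∀ x, HasSum (fun i => (g x i : ℂ) * f i) (h x)) : Continuous h := by
  rw [continuous_iff_continuousAt]
  intro x
  refine continuousAt_of_locally_uniform_approx_of_continuousAt fun u hu => ?_
  obtain ⟨ε, hε, hεu⟩ := Metric.mem_uniformity_dist.1 hu
  have hC : 0 < |C| + 1 := by positivity
  obtain ⟨s, hs⟩ := exists_sub_sum_lt (h1 x) (div_pos hε hC)
  -- No mass can escape to infinity: the total is always `1`, so the mass outside the finite set `s`
  -- is itself continuous in `y` and stays small near `x`. Finite sums thus approximate `h`
  -- uniformly near `x`.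
  have hr : Continuous fun y => 1 - ∑ i ∈ s, g y i :=
    continuous_const.sub (continuous_finsetSum s fun i _ => hg i)
  refine ⟨_, hr.continuousAt.eventually (gt_mem_nhds hs), fun y => ∑ i ∈ s, (g y i : ℂ) * f i,
    (continuous_finsetSum s fun i _ =>
      (Complex.continuous_ofReal.comp (hg i)).mul continuous_const).continuousAt, fun y hy => ?_⟩
  refine hεu ?_
  rw [dist_eq_norm]
  refine (norm_sub_sum_le_of_hasSum (h0 y) (h1 y) hf (hh y) s).trans_lt ?_
  have hy' : 1 - ∑ i ∈ s, g y i < ε / (|C| + 1) := hy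
  have hy0 : 0 ≤ 1 - ∑ i ∈ s, g y i :=
    sub_nonneg.2 (sum_le_hasSum s (fun i _ => h0 y i) (h1 y))
  rw [lt_div_iff₀ hC] at hy'
  have := mul_le_mul_of_nonneg_right (le_abs_self C) hy0
  linarith

namespace LocallyAtomicFlow

variable {A : Type*} [CStarAlgebra A] [PartialOrder A] [StarOrderedRing A]
variable {F : LocallyAtomicFlow A} {β : ℝ}

theorem norm_flowEquiv (n : ℕ) (t : ℝ) (a : F.alg n) : ‖(F.flowEquiv n t a : A)‖ = ‖(a : A)‖ :=
  StarAlgEquiv.norm_map (F.flow t) (a : A)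

theorem IsNormalKMS.add_smul {n : ℕ} {φ ψ : F.alg n →ₗ[ℂ] ℂ} (hφ : F.IsNormalKMS β n φ)
    (hψ : F.IsNormalKMS β n ψ) {s t : ℝ} (hs : 0 ≤ s) (ht : 0 ≤ t) :
    F.IsNormalKMS β n ((s : ℂ) • φ + (t : ℂ) • ψ) := by
  refine ⟨fun a ha => ?_, hφ.normal.add_smul_of_pos hφ.nonneg hψ.nonneg hψ.normal hs ht,
    fun a b => ((hφ.kms a b).const_mul s).add ((hψ.kms a b).const_mul t)⟩
  exact add_nonneg (mul_nonneg (by exact_mod_cast hs) (hφ.nonneg a ha))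
    (mul_nonneg (by exact_mod_cast ht) (hψ.nonneg a ha))

theorem IsNormalKMS.sum_smul {n : ℕ} {ι : Type*} (s : Finset ι) {φ : ι → F.alg n →ₗ[ℂ] ℂ}
    (hφ : ∀ i, F.IsNormalKMS β n (φ i)) {r : ι → ℝ} (hr : ∀ i, 0 ≤ r i) :
    F.IsNormalKMS β n (∑ i ∈ s, (r i : ℂ) • φ i) := by
  have h := ScottContinuous.sum_smul_of_pos s (fun i => (hφ i).nonneg) (fun i => (hφ i).normal) hr
  refine ⟨h.1, h.2, fun a b => ?_⟩
  simpa using IsStripPair.sum s fun i _ => ((hφ i).kms a b).const_mul (r i : ℂ)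

/-- The normal KMS functionals are closed in norm. -/
theorem IsNormalKMS.of_approx {n : ℕ} {φ : F.alg n →ₗ[ℂ] ℂ}
    (h : ∀ ε > 0, ∃ ψ : F.alg n →ₗ[ℂ] ℂ, F.IsNormalKMS β n ψ ∧
      ∀ a : F.alg n, ‖φ a - ψ a‖ ≤ ε * ‖(a : A)‖) : F.IsNormalKMS β n φ := by
  have hpos : ∀ a, 0 ≤ a → 0 ≤ φ a := by
    intro a ha
    have hcl : φ a ∈ closure (Set.Ici (0 : ℂ)) := by
      refine Metric.mem_closure_iff.2 fun ε hε => ?_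
      have hc : 0 < ‖(a : A)‖ + 1 := by positivity
      obtain ⟨ψ, hψ, hb⟩ := h (ε / (‖(a : A)‖ + 1)) (div_pos hε hc)
      refine ⟨ψ a, hψ.nonneg a ha, ?_⟩
      rw [dist_eq_norm]
      refine (hb a).trans_lt ?_
      rw [div_mul_eq_mul_div, div_lt_iff₀ hc]
      nlinarith
    rwa [isClosed_Ici.closure_eq] at hcl
  refine ⟨hpos, (scottContinuous_iff_of_pos hpos).2 fun d hd hdir a ha ε hε => ?_, fun a b => ?_⟩
  · obtain ⟨x₀, hx₀⟩ := hd
    have hc : 0 < ‖(a : A) - x₀‖ + 1 := by positivity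
    obtain ⟨ψ, hψ, hb⟩ := h (ε / 2 / (‖(a : A) - x₀‖ + 1)) (div_pos (half_pos hε) hc)
    obtain ⟨x₁, hx₁, hle⟩ := (scottContinuous_iff_of_pos hψ.nonneg).1 hψ.normal d ⟨x₀, hx₀⟩ hdir
      a ha (ε / 2) (half_pos hε)
    -- Going above the fixed element `x₀` bounds `‖a - x‖` in advance, so the tolerance for `ψ` can
    -- be fixed before `x` is known.
    obtain ⟨x, hx, h0x, h1x⟩ := hdir x₀ hx₀ x₁ hx₁
    refine ⟨x, hx, ?_⟩
    have h1 := (Complex.le_def.1 (apply_mono_of_pos hψ.nonneg (sub_le_sub_left h1x a))).1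
    have h2 : ‖((a - x : F.alg n) : A)‖ ≤ ‖(a : A) - x₀‖ :=
      CStarAlgebra.norm_le_norm_of_nonneg_of_le (sub_nonneg.2 (ha.1 hx)) (sub_le_sub_left h0x a)
    have h3 := (Complex.re_le_norm _).trans (hb (a - x))
    rw [Complex.sub_re] at h3
    have h4 : ε / 2 / (‖(a : A) - x₀‖ + 1) * ‖((a - x : F.alg n) : A)‖ ≤ ε / 2 := by
      rw [div_mul_eq_mul_div, div_le_iff₀ hc]
      nlinarith
    linarith
  · refine IsStripPair.of_approx fun ε hε => ?_
    have hc : 0 < ‖(a : A)‖ * ‖(b : A)‖ + 1 := by positivity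
    obtain ⟨ψ, hψ, hb⟩ := h (ε / (‖(a : A)‖ * ‖(b : A)‖ + 1)) (div_pos hε hc)
    have key : ∀ x : F.alg n, ‖(x : A)‖ ≤ ‖(a : A)‖ * ‖(b : A)‖ → ‖φ x - ψ x‖ ≤ ε := by
      intro x hx
      refine (hb x).trans ?_
      rw [div_mul_eq_mul_div, div_le_iff₀ hc]
      nlinarith
    refine ⟨_, _, hψ.kms a b, fun t => ⟨key _ ?_, key _ ?_⟩⟩
    · refine (norm_mul_le (a : A) (F.flowEquiv n t b : A)).trans ?_
      rw [norm_flowEquiv]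
    · refine (norm_mul_le (F.flowEquiv n t b : A) (a : A)).trans ?_
      rw [norm_flowEquiv, mul_comm]

/-- Mixtures of the states `τ_z` are normal KMS functionals. -/
theorem Admissible.isNormalKMS_of_hasSum (hβ : F.Admissible β) {n : ℕ} {ν : F.MinProj n → ℝ}
    (hν : ∀ z, 0 ≤ ν z) (hs : Summable ν) {φ : F.alg n →ₗ[ℂ] ℂ}
    (hφ : ∀ a, HasSum (fun z => (ν z : ℂ) * hβ.tau z a) (φ a)) : F.IsNormalKMS β n φ := by
  refine IsNormalKMS.of_approx fun ε hε => ?_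
  -- Half of `ε` compensates the constant `2` in the norm bound for states.
  obtain ⟨s, hs'⟩ := exists_sub_sum_lt hs.hasSum (half_pos hε)
  refine ⟨∑ z ∈ s, (ν z : ℂ) • hβ.tau z, IsNormalKMS.sum_smul s hβ.isNormalKMS_tau hν,
    fun a => ?_⟩
  have h := norm_sub_sum_le_of_hasSum hν hs.hasSum
    (fun z => F.norm_apply_le (hβ.tau_isNormalState z) a) (hφ a) s
  rw [LinearMap.sum_apply]
  refine h.trans ?_
  nlinarith [norm_nonneg (a : A)]

theorem alg_mono (F : LocallyAtomicFlow A) : Monotone F.alg := monotone_nat_of_le_succ F.alg_le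

/-- The union of the algebras `A n`. -/
def unionSubmodule (F : LocallyAtomicFlow A) : Submodule ℂ A where
  carrier := ⋃ n, (F.alg n : Set A)
  zero_mem' := Set.mem_iUnion.2 ⟨0, (F.alg 0).zero_mem⟩
  add_mem' {a b} ha hb := by
    obtain ⟨n, hn⟩ := Set.mem_iUnion.1 ha
    obtain ⟨m, hm⟩ := Set.mem_iUnion.1 hb
    exact Set.mem_iUnion.2 ⟨max n m, (F.alg _).add_mem (F.alg_mono (le_max_left n m) hn)
      (F.alg_mono (le_max_right n m) hm)⟩
  smul_mem' c a ha := by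
    obtain ⟨n, hn⟩ := Set.mem_iUnion.1 ha
    exact Set.mem_iUnion.2 ⟨n, (F.alg n).smul_mem hn c⟩

/-- A compatible and bounded sequence of functionals on the algebras `A n` is the sequence of
restrictions of a functional on `A`. -/
theorem exists_extension {φ : ∀ n, F.alg n →ₗ[ℂ] ℂ}
    (hφ : ∀ n a, φ (n + 1) (F.incl n a) = φ n a) {C : ℝ} (hC : ∀ n a, ‖φ n a‖ ≤ C * ‖(a : A)‖) :
    ∃ ω : WeakDual ℂ A, ∀ (n : ℕ) (a : F.alg n), ω (a : A) = φ n a := by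
  have hle : ∀ n m (h : n ≤ m) (a : F.alg n), φ m ⟨a, F.alg_mono h a.2⟩ = φ n a := by
    intro n m h a
    induction m, h using Nat.le_induction with
    | base => rfl
    | succ m hm ih => exact (hφ m ⟨a, F.alg_mono hm a.2⟩).trans ih
  have heq : ∀ n m (a : A) (hn : a ∈ F.alg n) (hm : a ∈ F.alg m), φ n ⟨a, hn⟩ = φ m ⟨a, hm⟩ := by
    intro n m a hn hm
    rw [← hle n _ (le_max_left n m), ← hle m _ (le_max_right n m)]
  have hmem : ∀ x : F.unionSubmodule, ∃ n, (x : A) ∈ F.alg n := fun x => Set.mem_iUnion.1 x.2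
  choose N hN using hmem
  let f : F.unionSubmodule →ₗ[ℂ] ℂ :=
    { toFun := fun x => φ (N x) ⟨x, hN x⟩
      map_add' := fun x y => by
        have hx := F.alg_mono (le_max_left (N x) (N y)) (hN x)
        have hy := F.alg_mono (le_max_right (N x) (N y)) (hN y)
        rw [heq (N x) _ x (hN x) hx, heq (N y) _ y (hN y) hy, ← map_add]
        exact heq _ _ _ _ _
      map_smul' := fun c x => by
        rw [RingHom.id_apply, ← map_smul]
        exact heq _ _ _ _ _ }
  -- Hahn–Banach extends the bounded functional from the union of the `A n` to `A`.
  obtain ⟨g, hg, -⟩ := exists_extension_norm_eq F.unionSubmodule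
    (f.mkContinuous C fun x => hC (N x) ⟨x, hN x⟩)
  refine ⟨StrongDual.toWeakDual g, fun n a => ?_⟩
  exact (hg ⟨a, Set.mem_iUnion.2 ⟨n, a.2⟩⟩).trans (heq _ _ _ _ _)

theorem weakDual_ext (F : LocallyAtomicFlow A) {ω η : WeakDual ℂ A}
    (h : ∀ (n : ℕ) (a : F.alg n), ω (a : A) = η (a : A)) : ω = η := by
  refine DFunLike.ext _ _ fun a => ?_
  refine F.dense_iUnion.induction (P := fun a => ω a = η a) (fun x hx => ?_)
    (isClosed_eq (map_continuous ω) (map_continuous η)) a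
  obtain ⟨n, hn⟩ := Set.mem_iUnion.1 hx
  exact h n ⟨x, hn⟩

theorem isNormalState_restrictTo {ω : WeakDual ℂ A} (hω : ω ∈ F.lnKMS β) (n : ℕ) :
    IsNormalState (F.restrictTo n ω) :=
  ⟨(isNormalKMS_restrictTo hω n).nonneg, hω.2.1, (isNormalKMS_restrictTo hω n).normal⟩

/-- The bound is uniform over the KMS states, which makes approximation by elements of the dense
union uniform in the state. -/
theorem norm_apply_le_of_mem_lnKMS {ω : WeakDual ℂ A} (hω : ω ∈ F.lnKMS β) (a : A) :
    ‖ω a‖ ≤ 2 * ‖a‖ := by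
  refine F.dense_iUnion.induction (P := fun a => ‖ω a‖ ≤ 2 * ‖a‖) (fun x hx => ?_)
    (isClosed_le (map_continuous ω).norm (continuous_const.mul continuous_norm)) a
  obtain ⟨n, hn⟩ := Set.mem_iUnion.1 hx
  exact F.norm_apply_le (isNormalState_restrictTo hω n) ⟨x, hn⟩

/-- Positivity and the KMS condition pass from the dense union to `A` by norm approximation: squares
depend continuously on their roots, the flow is isometric, and strip pairs are closed under uniform
limits. -/
theorem mem_lnKMS_of_isNormalKMS {ω : WeakDual ℂ A} (h1 : ω 1 = 1)
    (h : ∀ n, F.IsNormalKMS β n (F.restrictTo n ω)) : ω ∈ F.lnKMS β := by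
  refine ⟨fun a ha => ?_, h1, isKMSOn_iff_isStripPair.2 fun a _ b _ => ?_, fun n => (h n).normal⟩
  · obtain ⟨b, rfl⟩ := CStarAlgebra.nonneg_iff_eq_star_mul_self.1 ha
    refine F.dense_iUnion.induction (P := fun b => 0 ≤ ω (star b * b)) (fun x hx => ?_)
      (isClosed_Ici.preimage ((map_continuous ω).comp (continuous_star.mul continuous_id))) b
    obtain ⟨n, hn⟩ := Set.mem_iUnion.1 hx
    exact (h n).nonneg_star ⟨x, hn⟩
  · refine IsStripPair.of_approx fun ε hε => ?_
    set C := ‖WeakDual.toStrongDual ω‖ with hCdef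
    have hC : ∀ x, ‖ω x‖ ≤ C * ‖x‖ := (WeakDual.toStrongDual ω).le_opNorm
    have hC0 : 0 ≤ C := norm_nonneg _
    -- `K` collects the factors in the estimate of the difference of two products; `C + 1` keeps it
    -- positive.
    set K := (C + 1) * (‖a‖ + 1 + ‖b‖) with hK
    have hK0 : 0 < K := by positivity
    have hδ : 0 < min 1 (ε / K) := lt_min one_pos (div_pos hε hK0)
    obtain ⟨a', ha', had⟩ := F.dense_iUnion.exists_dist_lt a hδ
    obtain ⟨b', hb', hbd⟩ := F.dense_iUnion.exists_dist_lt b hδ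
    obtain ⟨n, hn⟩ := Set.mem_iUnion.1 ha'
    obtain ⟨m, hm⟩ := Set.mem_iUnion.1 hb'
    have hn' := F.alg_mono (le_max_left n m) hn
    have hm' := F.alg_mono (le_max_right n m) hm
    rw [dist_eq_norm] at had hbd
    have ha1 : ‖a'‖ ≤ ‖a‖ + 1 := by
      have h2 := norm_sub_norm_le a' a
      rw [norm_sub_rev] at h2
      linarith [min_le_left 1 (ε / K)]
    have hεK : min 1 (ε / K) * K ≤ ε := by
      have := mul_le_mul_of_nonneg_right (min_le_right 1 (ε / K)) hK0.le
      rwa [div_mul_cancel₀ _ hK0.ne'] at this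
    have hbound : ∀ t : ℝ, C * (‖a - a'‖ * ‖F.flow t b‖ + ‖a'‖ * ‖F.flow t b - F.flow t b'‖)
        ≤ ε := by
      intro t
      rw [← map_sub, StarAlgEquiv.norm_map, StarAlgEquiv.norm_map]
      have e1 : ‖a - a'‖ * ‖b‖ ≤ min 1 (ε / K) * ‖b‖ :=
        mul_le_mul_of_nonneg_right had.le (norm_nonneg _)
      have e2 : ‖a'‖ * ‖b - b'‖ ≤ (‖a‖ + 1) * min 1 (ε / K) :=
        mul_le_mul ha1 hbd.le (norm_nonneg _) (by positivity)
      have e3 : 0 ≤ min 1 (ε / K) * (‖a‖ + 1 + ‖b‖) := by positivity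
      calc C * (‖a - a'‖ * ‖b‖ + ‖a'‖ * ‖b - b'‖)
          ≤ C * (min 1 (ε / K) * (‖a‖ + 1 + ‖b‖)) :=
            mul_le_mul_of_nonneg_left (by linarith) hC0
        _ ≤ (C + 1) * (min 1 (ε / K) * (‖a‖ + 1 + ‖b‖)) := by linarith
        _ = min 1 (ε / K) * K := by rw [hK]; ring
        _ ≤ ε := hεK
    refine ⟨_, _, (h (max n m)).kms ⟨a', hn'⟩ ⟨b', hm'⟩, fun t => ⟨?_, ?_⟩⟩
    · change ‖ω (a * F.flow t b) - ω (a' * F.flow t b')‖ ≤ ε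
      rw [← map_sub, show a * F.flow t b - a' * F.flow t b'
        = (a - a') * F.flow t b + a' * (F.flow t b - F.flow t b') by noncomm_ring]
      refine (hC _).trans ((mul_le_mul_of_nonneg_left ?_ hC0).trans (hbound t))
      exact (norm_add_le _ _).trans (add_le_add (norm_mul_le _ _) (norm_mul_le _ _))
    · change ‖ω (F.flow t b * a) - ω (F.flow t b' * a')‖ ≤ ε
      rw [← map_sub, show F.flow t b * a - F.flow t b' * a'
        = F.flow t b * (a - a') + (F.flow t b - F.flow t b') * a' by noncomm_ring]
      refine (hC _).trans ((mul_le_mul_of_nonneg_left ?_ hC0).trans (hbound t))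
      refine (norm_add_le _ _).trans (add_le_add ?_ ?_)
      · rw [mul_comm ‖a - a'‖]; exact norm_mul_le _ _
      · rw [mul_comm ‖a'‖]; exact norm_mul_le _ _

end LocallyAtomicFlow

/-! ### Convexity, and the three maps of the triangle. -/

namespace LocallyAtomicFlow

variable {A : Type*} [CStarAlgebra A] [PartialOrder A] [StarOrderedRing A]
variable {F : LocallyAtomicFlow A} {β : ℝ}

theorem convex_lnKMS : Convex ℝ (F.lnKMS β) := by
  intro ω hω η hη s t hs ht hst
  have hc : ∀ a : A, (s • ω + t • η : WeakDual ℂ A) a = (s : ℂ) * ω a + (t : ℂ) * η a :=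
    fun a => rfl
  refine mem_lnKMS_of_isNormalKMS ?_ fun n => ?_
  · rw [hc, hω.2.1, hη.2.1]
    exact_mod_cast by linarith
  · exact (isNormalKMS_restrictTo hω n).add_smul (isNormalKMS_restrictTo hη n) hs ht

namespace Admissible

variable (hβ : F.Admissible β)

theorem convex_lnStates : Convex ℝ hβ.lnStates := by
  rintro ω ⟨hω, m, hm⟩ η ⟨hη, k, hk⟩ s t hs ht hst
  have hc : ∀ x, (s • ω + t • η) x = (s : ℂ) * ω x + (t : ℂ) * η x := fun x => rfl
  refine ⟨⟨?_, fun x hx => ?_⟩, max m k, fun n hn => ?_⟩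
  · rw [hc, hω.1, hη.1]
    exact_mod_cast by linarith
  · rw [hc]
    exact add_nonneg (mul_nonneg (by exact_mod_cast hs) (hω.2 x hx))
      (mul_nonneg (by exact_mod_cast ht) (hη.2 x hx))
  · obtain ⟨ξ, hξ⟩ := hm n ((le_max_left _ _).trans hn)
    obtain ⟨ζ, hζ⟩ := hk n ((le_max_right _ _).trans hn)
    refine ⟨(s : ℂ) • ξ + (t : ℂ) • ζ, LinearMap.ext fun f => ?_⟩
    rw [F.pairing_add, F.pairing_smul, F.pairing_smul, ← hξ, ← hζ]
    rfl

theorem condExp_minProj {n : ℕ} (z : F.MinProj n) : hβ.condExp n z.1 = F.centerOf z :=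
  F.center_ext fun z' => by
    rw [hβ.coeff_condExp_eq]
    exact hβ.tau_center (F.centerOf z) z'

theorem condExp_one (n : ℕ) : hβ.condExp n 1 = 1 :=
  F.center_ext fun z => by
    rw [hβ.coeff_condExp_eq, (hβ.tau_isNormalState z).unital, F.coeff_one]

variable [Nontrivial A]

theorem convex_harmonic : Convex ℝ hβ.harmonic := by
  intro ν hν μ hμ s t hs ht hst
  refine ⟨fun v => add_nonneg (mul_nonneg hs (hν.1 v)) (mul_nonneg ht (hμ.1 v)), ?_, fun n z => ?_⟩
  · change s * ν ⟨0, F.root⟩ + t * μ ⟨0, F.root⟩ = 1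
    rw [hν.2.1, hμ.2.1]
    linarith
  · have h := ((hν.2.2 n z).mul_left s).add ((hμ.2.2 n z).mul_left t)
    simp only [← mul_assoc, ← add_mul] at h
    exact h

theorem dot_injective : Function.Injective hβ.dot := by
  intro ν μ h
  refine Subtype.ext (funext fun ⟨n, z⟩ => ?_)
  have h1 : hβ.dotLevel ν n z = hβ.dotLevel μ n z :=
    congrArg (fun ξ : hβ.projLimit => (ξ.1 n : F.MinProj n → ℂ) z) h
  exact Complex.ofReal_injective h1

theorem hasSum_iota_dot_condExp (ν : hβ.harmonic) (n : ℕ) (a : F.alg n) :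
    HasSum (fun z : F.MinProj n => (ν.1 ⟨n, z⟩ : ℂ) * hβ.tau z a)
      (hβ.iota (hβ.dot ν) (hβ.thetaInf n (hβ.condExp n a))) := by
  simpa only [hβ.coeff_condExp_eq] using hβ.hasSum_iota_dot ν n (hβ.condExp n a)

/-- The restrictions of a locally normal KMS state to the centers are given by a harmonic
function. -/
theorem values_mem_harmonic {ω : WeakDual ℂ A} (hω : ω ∈ F.lnKMS β) :
    (fun v : Σ n, F.MinProj n => (ω (v.2.1 : A)).re) ∈ hβ.harmonic := by
  have hpos : ∀ n (z : F.MinProj n), 0 ≤ ω (z.1 : A) := fun n z =>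
    (isNormalKMS_restrictTo hω n).nonneg z.1 (F.minProj_nonneg z)
  have hre : ∀ n (z : F.MinProj n), (((ω (z.1 : A)).re : ℝ) : ℂ) = ω (z.1 : A) := fun n z =>
    Complex.ext rfl (Complex.nonneg_iff.1 (hpos n z)).2
  refine ⟨fun v => (Complex.nonneg_iff.1 (hpos v.1 v.2)).1, ?_, fun n z => ?_⟩
  · change (ω 1).re = 1
    rw [hω.2.1, Complex.one_re]
  · have h := hβ.hasSum_tau (isNormalKMS_restrictTo hω (n + 1)) (F.incl n z.1)
    refine Complex.hasSum_ofReal.1 ?_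
    simp only [Complex.ofReal_mul, hre, hβ.coe_link]
    exact h

/-- The map `ω ↦ ν[ω]`. -/
def toHarmonic (ω : F.lnKMS β) : hβ.harmonic := ⟨_, hβ.values_mem_harmonic ω.2⟩

theorem toHarmonic_apply (ω : F.lnKMS β) {n : ℕ} (z : F.MinProj n) :
    (((hβ.toHarmonic ω).1 ⟨n, z⟩ : ℝ) : ℂ) = ω.1 (z.1 : A) :=
  Complex.ext rfl (Complex.nonneg_iff.1
    ((isNormalKMS_restrictTo ω.2 n).nonneg z.1 (F.minProj_nonneg z))).2

/-- The map `ν ↦ ι(ν_•)`. -/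
def toState (ν : hβ.harmonic) : hβ.lnStates := ⟨_, hβ.iota_dot_mem ν⟩

theorem toState_surjective : Function.Surjective hβ.toState := fun ω =>
  ⟨⟨_, hβ.vertexFun_mem ω.2⟩, Subtype.ext (hβ.iota_dot_vertexFun ω.2)⟩

/-- Since `ω` is `ι(ν_•)`, the functional `ω ∘ Θ_{∞,n} ∘ E_n` is the mixture `∑ ν(z) τ_z`, hence
normal and KMS. Compatibility of `E` with `Θ` makes these functionals extend one another. -/
theorem exists_mem_lnKMS {ω : hβ.System →ₗ[ℂ] ℂ} (hω : ω ∈ hβ.lnStates) :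
    ∃ φ ∈ F.lnKMS β, ∀ (n : ℕ) (x : F.alg n), φ (x : A) = ω (hβ.thetaInf n (hβ.condExp n x)) := by
  obtain ⟨ν, hν⟩ := hβ.toState_surjective ⟨ω, hω⟩
  obtain rfl : hβ.iota (hβ.dot ν) = ω := congrArg Subtype.val hν
  let φ : ∀ n, F.alg n →ₗ[ℂ] ℂ := fun n => hβ.iota (hβ.dot ν) ∘ₗ hβ.thetaInf n ∘ₗ hβ.condExp n
  have hφ : ∀ n, F.IsNormalKMS β n (φ n) := fun n =>
    hβ.isNormalKMS_of_hasSum (fun z => ν.2.1 ⟨n, z⟩) (hβ.harmonic_hasSum_one ν n).summable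
      (hβ.hasSum_iota_dot_condExp ν n)
  have h1 : ∀ n, φ n 1 = 1 := fun n => by
    change hβ.iota (hβ.dot ν) (hβ.thetaInf n (hβ.condExp n 1)) = 1
    rw [hβ.condExp_one, hβ.thetaInf_one, (hβ.iota_dot_mem ν).1.1]
  obtain ⟨η, hη⟩ := exists_extension (φ := φ) (C := 2)
    (fun n a => by
      change hβ.iota (hβ.dot ν) (hβ.thetaInf (n + 1) (hβ.condExp (n + 1) (F.incl n a))) = _
      rw [hβ.condExp_incl, hβ.thetaInf_theta]
      rfl)
    (fun n a => F.norm_apply_le ⟨(hφ n).nonneg, h1 n, (hφ n).normal⟩ a)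
  refine ⟨η, mem_lnKMS_of_isNormalKMS ((hη 0 1).trans (h1 0)) fun n => ?_, hη⟩
  have e : F.restrictTo n η = φ n := LinearMap.ext fun a => hη n a
  rw [e]
  exact hφ n

/-- The map `ω ↦ E_•^*(ω)`. -/
def toKMS (ω : hβ.lnStates) : F.lnKMS β :=
  ⟨_, (hβ.exists_mem_lnKMS ω.2).choose_spec.1⟩

theorem toKMS_apply (ω : hβ.lnStates) (n : ℕ) (x : F.alg n) :
    (hβ.toKMS ω).1 (x : A) = ω.1 (hβ.thetaInf n (hβ.condExp n x)) :=
  (hβ.exists_mem_lnKMS ω.2).choose_spec.2 n x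

theorem toKMS_toState_toHarmonic (ω : F.lnKMS β) :
    hβ.toKMS (hβ.toState (hβ.toHarmonic ω)) = ω := by
  refine Subtype.ext (F.weakDual_ext fun n a => ?_)
  rw [hβ.toKMS_apply]
  refine (hβ.hasSum_iota_dot_condExp _ n a).unique ?_
  simp only [toHarmonic_apply]
  exact hβ.hasSum_tau (isNormalKMS_restrictTo ω.2 n) a

theorem toHarmonic_toKMS_toState (ν : hβ.harmonic) :
    hβ.toHarmonic (hβ.toKMS (hβ.toState ν)) = ν := by
  refine Subtype.ext (funext fun ⟨n, z⟩ => Complex.ofReal_injective ?_)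
  rw [hβ.toHarmonic_apply, hβ.toKMS_apply, hβ.condExp_minProj]
  exact hβ.iota_dot_centerOf ν z

theorem toState_toHarmonic_toKMS (ω : hβ.lnStates) :
    hβ.toState (hβ.toHarmonic (hβ.toKMS ω)) = ω := by
  obtain ⟨ν, rfl⟩ := hβ.toState_surjective ω
  rw [hβ.toHarmonic_toKMS_toState]

theorem continuous_toHarmonic : Continuous hβ.toHarmonic :=
  (continuous_pi fun v : Σ n, F.MinProj n => Complex.continuous_re.comp
    ((WeakDual.eval_continuous (v.2.1 : A)).comp continuous_subtype_val)).subtype_mk _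

/-- Every element of the system comes from some level, where the value is the expectation of a
bounded function under a probability vector. -/
theorem continuous_toState : Continuous hβ.toState := by
  refine continuous_induced_rng.2 (continuous_pi fun x => ?_)
  obtain ⟨n, f, rfl⟩ := hβ.exists_thetaInf x
  exact continuous_of_hasSum_prob (g := fun (ν : hβ.harmonic) (z : F.MinProj n) => ν.1 ⟨n, z⟩)
    (fun z => (continuous_apply _).comp continuous_subtype_val) (fun ν z => ν.2.1 _)
    (fun ν => hβ.harmonic_hasSum_one ν n) (F.norm_coeff_le f) (fun ν => hβ.hasSum_iota_dot ν n f)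

/-- At elements of some `A n` the value is an evaluation of `ω`; the uniform norm bound carries
continuity over to all of `A`. -/
theorem continuous_toKMS : Continuous hβ.toKMS := by
  refine continuous_induced_rng.2 (WeakDual.continuous_of_continuous_eval fun x => ?_)
  refine continuous_of_uniform_approx_of_continuous fun u hu => ?_
  obtain ⟨ε, hε, hεu⟩ := Metric.mem_uniformity_dist.1 hu
  obtain ⟨y, hy, hxy⟩ := F.dense_iUnion.exists_dist_lt x (half_pos hε)
  obtain ⟨n, hn⟩ := Set.mem_iUnion.1 hy
  refine ⟨fun ω => ω.1 (hβ.thetaInf n (hβ.condExp n ⟨y, hn⟩)), ?_, fun ω => hεu ?_⟩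
  · exact (continuous_apply _).comp (continuous_induced_dom (t := Pi.topologicalSpace)
      (f := fun (φ : hβ.lnStates) (v : hβ.System) => φ.1 v))
  · change dist ((hβ.toKMS ω).1 x) (ω.1 (hβ.thetaInf n (hβ.condExp n ⟨y, hn⟩))) < ε
    rw [← hβ.toKMS_apply ω n ⟨y, hn⟩, dist_eq_norm, ← map_sub]
    refine (norm_apply_le_of_mem_lnKMS (hβ.toKMS ω).2 _).trans_lt ?_
    rw [dist_eq_norm] at hxy
    linarith

theorem isAffineBetween_toState : IsAffineBetween hβ.toState := by
  intro ν μ s t hs ht hst h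
  refine hβ.system_hom_ext fun n f => (hβ.hasSum_iota_dot _ n f).unique ?_
  have h1 := ((hβ.hasSum_iota_dot ν n f).mul_left (s : ℂ)).add
    ((hβ.hasSum_iota_dot μ n f).mul_left (t : ℂ))
  simp only [← mul_assoc, ← add_mul, ← Complex.ofReal_mul, ← Complex.ofReal_add] at h1
  exact h1

theorem isAffineBetween_toKMS : IsAffineBetween hβ.toKMS := by
  intro ω η s t hs ht hst h
  refine F.weakDual_ext fun n a => ?_
  rw [hβ.toKMS_apply]
  change (s : ℂ) * _ + (t : ℂ) * _ = (s : ℂ) * (hβ.toKMS ω).1 (a : A) + t * (hβ.toKMS η).1 (a : A)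
  rw [hβ.toKMS_apply, hβ.toKMS_apply]

theorem isAffineBetween_toHarmonic : IsAffineBetween hβ.toHarmonic := by
  intro ω η s t hs ht hst h
  funext v
  change ((s : ℂ) * ω.1 (v.2.1 : A) + (t : ℂ) * η.1 (v.2.1 : A)).re
    = s * (ω.1 (v.2.1 : A)).re + t * (η.1 (v.2.1 : A)).re
  rw [Complex.add_re, Complex.re_ofReal_mul, Complex.re_ofReal_mul]

theorem isAffineBetween_dot : IsAffineBetween
    (hβ.dot : hβ.harmonic → (hβ.projLimit : Set (∀ n, F.Predual n))) := by
  intro ν μ s t hs ht hst h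
  funext n
  refine lp.ext (funext fun z => ?_)
  change ((s * ν.1 ⟨n, z⟩ + t * μ.1 ⟨n, z⟩ : ℝ) : ℂ) = s • (ν.1 ⟨n, z⟩ : ℂ) + t • (μ.1 ⟨n, z⟩ : ℂ)
  push_cast
  rfl

end Admissible

end LocallyAtomicFlow

end

theorem theorem3p11 {A : Type*} [CStarAlgebra A] [PartialOrder A] [StarOrderedRing A]
    [Nontrivial A] (F : LocallyAtomicFlow A) (β : ℝ) (hβ : F.Admissible β) :
    -- the three sets are convex
    Convex ℝ (F.lnKMS β) ∧ Convex ℝ hβ.harmonic ∧ Convex ℝ hβ.lnStates ∧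
    -- (1) the map `ν ↦ ν_•` into `L(α, β)` is well defined, injective and affine
    ∃ dot : hβ.harmonic → (hβ.projLimit : Set (∀ n, F.Predual n)),
      (∀ (ν : hβ.harmonic) (n : ℕ) (z : F.MinProj n), (dot ν).1 n z = ((ν.1 ⟨n, z⟩ : ℝ) : ℂ)) ∧
      Function.Injective dot ∧
      IsAffineBetween dot ∧
      -- (2) the locally normal states are exactly the `ι(ν_•)`
      hβ.lnStates = {ω | ∃ ν : hβ.harmonic, ω = hβ.iota (dot ν)} ∧
      -- (3) the map `ω ↦ E_•^*(ω)` is well defined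
      (∀ ω ∈ hβ.lnStates, ∃! φ : WeakDual ℂ A, φ ∈ F.lnKMS β ∧
        ∀ (n : ℕ) (x : F.alg n), φ (x : A) = ω (hβ.thetaInf n (hβ.condExp n x))) ∧
      -- (3) the triangle of affine homeomorphisms
      ∃ (a : F.lnKMS β ≃ₜ hβ.harmonic) (b : hβ.harmonic ≃ₜ hβ.lnStates)
        (c : hβ.lnStates ≃ₜ F.lnKMS β),
        (∀ (ω : F.lnKMS β) (n : ℕ) (z : F.MinProj n),
          (((a ω).1 ⟨n, z⟩ : ℝ) : ℂ) = ω.1 (z.1 : A)) ∧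
        (∀ ν : hβ.harmonic, (b ν).1 = hβ.iota (dot ν)) ∧
        (∀ (ω : hβ.lnStates) (n : ℕ) (x : F.alg n),
          (c ω).1 (x : A) = ω.1 (hβ.thetaInf n (hβ.condExp n x))) ∧
        IsAffineBetween a ∧ IsAffineBetween b ∧ IsAffineBetween c ∧
        (∀ ω, c (b (a ω)) = ω) ∧ (∀ ν, a (c (b ν)) = ν) ∧ (∀ ω, b (a (c ω)) = ω) := by
  have ha := hβ.continuous_toHarmonic
  have hb := hβ.continuous_toState
  have hc := hβ.continuous_toKMS
  have hcba := hβ.toKMS_toState_toHarmonic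
  have hacb := hβ.toHarmonic_toKMS_toState
  have hbac := hβ.toState_toHarmonic_toKMS
  refine ⟨LocallyAtomicFlow.convex_lnKMS, hβ.convex_harmonic, hβ.convex_lnStates, hβ.dot,
    fun _ _ _ => rfl, hβ.dot_injective, hβ.isAffineBetween_dot, ?_, fun ω hω => ?_,
    -- Each inverse is the composite of the other two maps, so its continuity comes for free.
    ⟨⟨hβ.toHarmonic, hβ.toKMS ∘ hβ.toState, hcba, hacb⟩, ha, hc.comp hb⟩,
    ⟨⟨hβ.toState, hβ.toHarmonic ∘ hβ.toKMS, hacb, hbac⟩, hb, ha.comp hc⟩,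
    ⟨⟨hβ.toKMS, hβ.toState ∘ hβ.toHarmonic, hbac, hcba⟩, hc, hb.comp ha⟩,
    fun ω _ z => hβ.toHarmonic_apply ω z, fun _ => rfl, hβ.toKMS_apply,
    hβ.isAffineBetween_toHarmonic, hβ.isAffineBetween_toState, hβ.isAffineBetween_toKMS,
    hcba, hacb, hbac⟩
  · ext ω
    refine ⟨fun hω => ?_, ?_⟩
    · obtain ⟨ν, hν⟩ := hβ.toState_surjective ⟨ω, hω⟩
      exact ⟨ν, (congrArg Subtype.val hν).symm⟩
    · rintro ⟨ν, rfl⟩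
      exact hβ.iota_dot_mem ν
  · obtain ⟨φ, hφ, h⟩ := hβ.exists_mem_lnKMS hω
    exact ⟨φ, ⟨hφ, h⟩, fun ψ hψ => F.weakDual_ext fun n x => by
      rw [h n x, hψ.2 n x]⟩
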